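/- **Theorem 4.1.** For $n\ge 0$ let $\pi=\pi_n$ be the probability measure on $\{0,\dots,n\}$ proportional to $\dfrac{1}{(x\vee 1)^{3/2}\,((n-x)\vee 1)^{3/2}}$, and let $X=X^{(n)}$ be the continuous-time Metropolis birth–death chain with rates $Q(x,y)=\min\{1,\pi(y)/\pi(x)\}$ for $|x-y|=1$ (and $Q(x,y)=0$ for $|x-y|\ge 2$). Let $X^{\leftarrow}$ be its time reversal, the chain with rates $\pi(y)Q(y,x)/\pi(x)$. Let $G=\{x: x\ge n/2\}$, $A=\{0,\dots,n\}\setminus G$, $\pi_A=\pi(\,\cdot\,|A)$, and let $\tau^x_K$ (resp. $\tau^{\nu}_K$) be the hitting time of $K$ from $x$ (resp. from the initial law $\nu$). For $R>1$ and $d,f,r\in(0,1)$, say that $\mathrm{Hp.G}(R,d,f,r)$ holds with basin $B\subset A$ if * $\mathbf P(\tau_G^{\pi_A}\le 2R)\le f$ (slow escape); * $d_{TV}(\mathbf P(X^x_R\in\cdot),\mathbf P(X^{y}_R\in\cdot))\le d$ for all $x,y\in B$ (fast thermalization); * $\sup_{x}\mathbf P(\tau^x_{B\cup G}>R)<r$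 (fast recurrence). For $\alpha\in(0,1)$ put $B_\alpha=\{x: 0\le x\le n^\alpha\}$ and $\mathcal B_\alpha(R,f)=\{x\in A:\ \tfrac12[\mathbf P(\tau^x_G\le 2R)+\mathbf P(\tau^{\leftarrow x}_G\le 2R)]\le f^\alpha\}$. Let $\alpha\in(0,1)$. There is $\varepsilon_0>0$ such that for every $\varepsilon\in(0,\varepsilon_0)$ and every sequence $(R_n)$ for which there is $c>0$ with $R_n\ge c\,n^{5/2-\varepsilon}$ for all large $n$, and which satisfies $R_n/n^{5/2}\to0$ (for instance $R_n=n^{5/2-\varepsilon}$), there are sequences $d_n,f_n,r_n\to 0$ such that: 1. For every $n$ with $n^\alpha<n/2$ and $R_n>1$: $B_\alpha\subset\mathcal B_\alpha(R_n,f_n)$, and $\mathrm{Hp.G}(R_n,d_n,f_n,r_n)$ holds both with basin $\mathcal B_\alpha(R_n,f_n)$ and with basin $B_\alpha$. 2. There is a sequence $\eta_n\to0$ such that for all large $n$ the quasi-stationary measure $\mu^*_A=\lim_{t\to\infty}\sum_{x\in A}\pi_A(x)\,\mathbf P(X^x_t\in\cdot\mid\tau^x_G>t)$ exists and, with $T^*_n=\mathbf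 E[\tau_G^{\mu^*_A}]$, for all $t\ge0$, $$\bigl|\mathbf P(\tau_G^{\pi_A}\ge tT_n^*)-e^{-t}\bigr|\le\eta_n e^{-t},\qquad \sup_{x\in\mathcal B_\alpha(R_n,f_n)}\bigl|\mathbf P(\tau_G^{x}\ge tT_n^*)-e^{-t}\bigr|\le\eta_n e^{-t}.$$ 3. $\tau_G^{\pi_A}/\mathbf E[\tau_G^{\pi_A}]$ converges in law to the exponential distribution of mean one, and so does $\tau_G^{\nu_n}/\mathbf E[\tau_G^{\nu_n}]$ for all probability measures $\nu_n$ supported, for all large $n$, in $\mathcal B_\alpha(R_n,f_n)$ (in particular for those supported in $B_\alpha$). -/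

import Mathlib

open Filter Topology MeasureTheory
open scoped NNReal ENNReal

noncomputable section

/-- A continuous-time Markov chain on the finite set `S` with transition rate matrix `Q`, as a family
of laws `P x` (the chain started from `x`) of a right-continuous process `X` on one measurable space:
`X 0 = x` almost surely under `P x`, and, given the values at the times `s 0 ≤ ... ≤ s m`, the value at
time `s m + u` has law `exp (u Q) (X (s m), ·)`. -/
structure CTMC {S : Type} [Fintype S] [DecidableEq S] (Q : Matrix S S ℝ) where
  Ω : Type*
  [mΩ : MeasurableSpace Ω]
  P : S → Measure Ω
  X : ℝ≥0 → Ω → S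
  prob : ∀ x, IsProbabilityMeasure (P x)
  measurable_X : ∀ t y, MeasurableSet {ω | X t ω = y}
  right_continuous : ∀ ω t, ∀ᶠ s in 𝓝[≥] t, X s ω = X t ω
  start : ∀ x, ∀ᵐ ω ∂(P x), X 0 ω = x
  markov : ∀ (x : S) (m : ℕ) (s : ℕ → ℝ≥0) (y : ℕ → S) (u : ℝ≥0) (z : S), Monotone s →
    (P x).real {ω | (∀ i ≤ m, X (s i) ω = y i) ∧ X (s m + u) ω = z} =
      (P x).real {ω | ∀ i ≤ m, X (s i) ω = y i} * (NormedSpace.exp ((u : ℝ) • Q)) (y m) z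

/-- The rate matrix of the time reversal with respect to the measure `π`. -/
def reversedRates {S : Type} (π : S → ℝ) (Q : Matrix S S ℝ) : Matrix S S ℝ :=
  fun x y => π y / π x * Q y x

open Classical in
/-- The measure `π` conditioned on the set `A`. -/
def condOn {S : Type} [Fintype S] (π : S → ℝ) (A : Set S) : S → ℝ :=
  fun x => if x ∈ A then π x / ∑ y, (if y ∈ A then π y else 0) else 0

/-- Total variation distance of two probability vectors. -/
def dTV {S : Type} [Fintype S] (μ ν : S → ℝ) : ℝ := (1 / 2) * ∑ x, |μ x - ν x|

namespace CTMC

variable {S : Type} [Fintype S] [DecidableEq S] {Q : Matrix S S ℝ}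

instance (C : CTMC Q) : MeasurableSpace C.Ω := C.mΩ

/-- The first hitting time of `K`; it is `∞` if `K` is never hit. -/
def hit (C : CTMC Q) (K : Set S) (ω : C.Ω) : ℝ≥0∞ :=
  sInf ((fun t : ℝ≥0 => (t : ℝ≥0∞)) '' {t | C.X t ω ∈ K})

/-- The law of the chain started from the distribution `ν`. -/
def lawFrom (C : CTMC Q) (ν : S → ℝ) : Measure C.Ω := ∑ x, ENNReal.ofReal (ν x) • C.P x

/-- The mean hitting time of `K` for the chain started from the distribution `ν`. -/
def meanHit (C : CTMC Q) (ν : S → ℝ) (K : Set S) : ℝ≥0∞ := ∫⁻ ω, C.hit K ω ∂(C.lawFrom ν)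

/-- The law at time `t` of the chain started from `x`. -/
def evol (C : CTMC Q) (x : S) (t : ℝ≥0) : S → ℝ := fun y => (C.P x).real {ω | C.X t ω = y}

/-- The evolution from `x` conditioned on not having hit `G` by time `t`. -/
def condEvol (C : CTMC Q) (G : Set S) (x : S) (t : ℝ≥0) : S → ℝ := fun y =>
  (C.P x).real {ω | C.X t ω = y ∧ (t : ℝ≥0∞) < C.hit G ω} / (C.P x).real {ω | (t : ℝ≥0∞) < C.hit G ω}

/-- `μ` is the quasi-stationary measure on `Gᶜ`: the limit as `t → ∞` of the conditioned evolution
started from `π` restricted to `Gᶜ`. -/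
def IsQuasiStationary (C : CTMC Q) (π : S → ℝ) (G : Set S) (μ : S → ℝ) : Prop :=
  ∀ y, Tendsto (fun t : ℝ≥0 => ∑ x, condOn π Gᶜ x * C.condEvol G x t y) atTop (𝓝 (μ y))

/-- The basin of attraction: the points of `Gᶜ` from which both the chain `C` and its time reversal `C'`
hit `G` by time `2 R` with small (averaged) probability, at most `f ^ α`. -/
def basin {Q' : Matrix S S ℝ} (C : CTMC Q) (C' : CTMC Q') (G : Set S) (R f α : ℝ) : Set S :=
  {x | x ∉ G ∧
    (1 / 2) * ((C.P x).real {ω | C.hit G ω ≤ ENNReal.ofReal (2 * R)} +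
      (C'.P x).real {ω | C'.hit G ω ≤ ENNReal.ofReal (2 * R)}) ≤ f ^ α}

/-- Hypothesis `Hp.G(R, d, f, r)` for the goal set `G` and the basin `B`. -/
structure HpG (C : CTMC Q) (π : S → ℝ) (G B : Set S) (R d f r : ℝ) : Prop where
  one_lt_R : 1 < R
  d_mem : d ∈ Set.Ioo (0 : ℝ) 1
  f_mem : f ∈ Set.Ioo (0 : ℝ) 1
  r_mem : r ∈ Set.Ioo (0 : ℝ) 1
  /-- Slow escape, on the time scale `2 R`, from the invariant measure restricted to `Gᶜ`. -/
  slow_escape : (C.lawFrom (condOn π Gᶜ)).real {ω | C.hit G ω ≤ ENNReal.ofReal (2 * R)} ≤ f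
  /-- Fast thermalization in `B`. -/
  thermalization : ∀ x ∈ B, ∀ y ∈ B, dTV (C.evol x R.toNNReal) (C.evol y R.toNNReal) ≤ d
  /-- Fast recurrence to `B ∪ G`. -/
  recurrence : ∀ x, (C.P x).real {ω | ENNReal.ofReal R < C.hit (B ∪ G) ω} < r

end CTMC

/-- The unnormalized double well weight on `{0, ..., n}`. -/
def wellWeight (n : ℕ) (x : Fin (n + 1)) : ℝ :=
  1 / ((max (x : ℝ) 1) ^ (3 / 2 : ℝ) * (max ((n : ℝ) - (x : ℝ)) 1) ^ (3 / 2 : ℝ))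

/-- The double well probability measure on `{0, ..., n}`. -/
def wellMeasure (n : ℕ) (x : Fin (n + 1)) : ℝ := (∑ y, wellWeight n y)⁻¹ * wellWeight n x

/-- Birth and death rates of the Metropolis dynamics: `min 1 (π y / π x)` for neighbours `x`, `y`. -/
def jumpRate (n : ℕ) (x y : Fin (n + 1)) : ℝ :=
  if (y : ℕ) = x + 1 ∨ (x : ℕ) = y + 1 then min 1 (wellMeasure n y / wellMeasure n x) else 0

/-- The rate matrix of the Metropolis birth and death chain (with zero row sums). -/
def wellRates (n : ℕ) : Matrix (Fin (n + 1)) (Fin (n + 1)) ℝ :=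
  fun x y => if x = y then -∑ z, jumpRate n x z else jumpRate n x y

/-- `G = {n/2, ..., n}`, that is the `x` with `x ≥ n / 2`. -/
def rightHalf (n : ℕ) : Set (Fin (n + 1)) := {x | (n : ℝ) / 2 ≤ ((x : ℕ) : ℝ)}

/-- `{0, ..., n ^ α}`. -/
def wellBottom (n : ℕ) (α : ℝ) : Set (Fin (n + 1)) := {x | ((x : ℕ) : ℝ) ≤ (n : ℝ) ^ α}

end

/-! Everything reduces to the survival function u(t,x) = P_x(τ_G > t). It solves the backward
equation u' = Qu off G with u = 0 on G and u = 1 at time 0. It is identified with row sums of the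
exponential of the killed matrix: avoiding G along a dyadic time grid gives powers of a truncated
transition matrix (`measureReal_path_notMem`), and a Chernoff product formula gives their limit.
From then on, stochastic comparisons become applications of a parabolic maximum principle.

On the left half the rates satisfy up ≤ down, so a superharmonic function vanishing on G is
decreasing and concave there (`diff_nonneg_and_mono`), hence lies above the chord v(0)(1 - 2x/n).
This applies both to u(t,·) and to the principal eigenfunction φ of the killed generator, with
eigenvalue -l and φ(0) = 1. The maximum principle gives u ≥ e^{-lt} φ. Conversely, reversibility
gives the exact identity Σ π_A φ u = e^{-lt} Σ π_A φ, and π_A has mean O(√n) = o(n); the two chord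
bounds then yield u(t,0)(1 - 32/√n) ≤ e^{-lt} (`survival_mul_le_exp`). So u(t,x)/e^{-lt} lies
between φ(x) and 1 + O(n^{-1/2}), uniformly in t.

Two quantitative inputs remain. Conservation of flux gives l ≤ (8/n)^{5/2} (`eigenvalue_mul_le`), so
escape by time 2R is unlikely when R ≪ n^{5/2}. The parabola x(n-x) has generator at most -1 between
0 and G, so {0} ∪ G is reached in mean time at most n². This gives recurrence, and thermalization as
well: in an order preserving coupling the copies have met once the upper one reaches 0
(`CTMC.sum_exp_sub_le`). It also shows that φ is close to 1 on the whole basin, since surviving to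
2R essentially means visiting 0 first (`survival_le_eigenfunction_add`). The errors are n²/R, which
needs ε < 1/2.

The quasi-stationary measure comes from the spectral limit of the killed semigroup; from it the exit
law is exactly exponential, so T* = 1/l. -/

noncomputable section

/-! ### A Chernoff product formula -/

section Chernoff

variable {𝔸 : Type*} [NormedRing 𝔸] [NormOneClass 𝔸]

/-- Telescoping: the powers are exchanged one factor at a time. The exponent of K is deliberately
not sharp. -/
theorem norm_pow_sub_pow_le_of_norm_le {a b : 𝔸} {K : ℝ} (hK : 1 ≤ K) (ha : ‖a‖ ≤ K) (hb : ‖b‖ ≤ K)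
    (n : ℕ) : ‖a ^ n - b ^ n‖ ≤ n * K ^ n * ‖a - b‖ := by
  have hK0 : 0 ≤ K := by linarith
  induction n with
  | zero => simp
  | succ n ih =>
    have e : a ^ (n + 1) - b ^ (n + 1) = a ^ n * (a - b) + (a ^ n - b ^ n) * b := by
      rw [pow_succ, pow_succ]; noncomm_ring
    rw [e]
    have h1 : ‖a ^ n * (a - b)‖ ≤ K ^ (n + 1) * ‖a - b‖ := by
      refine (norm_mul_le _ _).trans (mul_le_mul_of_nonneg_right ?_ (norm_nonneg _))
      exact ((norm_pow_le _ _).trans (pow_le_pow_left₀ (norm_nonneg _) ha n)).trans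
        (pow_le_pow_right₀ hK (Nat.le_succ n))
    have h2 : ‖(a ^ n - b ^ n) * b‖ ≤ n * K ^ (n + 1) * ‖a - b‖ := by
      refine (norm_mul_le _ _).trans ?_
      calc ‖a ^ n - b ^ n‖ * ‖b‖ ≤ (n * K ^ n * ‖a - b‖) * K := by gcongr
        _ = _ := by ring
    refine (norm_add_le _ _).trans ?_
    push_cast
    linarith

/-- F and the exponential agree to first order at 0, so they differ by o(2^{-k}) at t/2^k.
Telescoping multiplies this by 2^k and by a factor that stays bounded, since norms 1 + O(2^{-k})
raised to the power 2^k stay bounded. -/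
theorem tendsto_pow_exp_of_hasDerivAt [NormedAlgebra ℝ 𝔸] [CompleteSpace 𝔸] {F : ℝ → 𝔸} {a : 𝔸}
    (hF : HasDerivAt F a 0) (h0 : F 0 = 1) (t : ℝ) :
    Tendsto (fun k : ℕ => F (t / 2 ^ k) ^ (2 ^ k)) atTop (𝓝 (NormedSpace.exp (t • a))) := by
  let _ : NormedAlgebra ℚ 𝔸 := NormedAlgebra.restrictScalars ℚ ℝ 𝔸
  set E : ℝ → 𝔸 := fun s => NormedSpace.exp (s • a) with hE
  have hE' : HasDerivAt E a 0 := by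
    have := hasDerivAt_exp_smul_const (𝕂 := ℝ) a (0 : ℝ)
    simpa using this
  have hE0 : E 0 = 1 := by simp [hE]
  have hseq : Tendsto (fun k : ℕ => t / 2 ^ k) atTop (𝓝 0) := by
    have := (tendsto_pow_atTop_nhds_zero_of_lt_one (r := (1 / 2 : ℝ)) (by norm_num)
      (by norm_num)).const_mul t
    simpa [div_eq_mul_inv] using this
  have hbig : ∀ {f : ℝ → 𝔸}, HasDerivAt f a 0 → f 0 = 1 → ∃ C : ℝ, 0 ≤ C ∧
      ∀ᶠ h in 𝓝 (0 : ℝ), ‖f h‖ ≤ 1 + C * |h| := by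
    intro f hf hf0
    obtain ⟨c, hc⟩ := hf.isBigO_sub.bound
    refine ⟨max c 0, le_max_right _ _, hc.mono fun h hh => ?_⟩
    rw [hf0] at hh
    have h1 : ‖f h‖ ≤ ‖f h - 1‖ + ‖(1 : 𝔸)‖ := by
      simpa using norm_add_le (f h - 1) 1
    rw [norm_one] at h1
    have h2 : c * ‖h - 0‖ ≤ max c 0 * |h| := by
      rw [sub_zero, Real.norm_eq_abs]
      exact mul_le_mul_of_nonneg_right (le_max_left _ _) (abs_nonneg _)
    linarith
  obtain ⟨C1, hC1, hb1⟩ := hbig hF h0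
  obtain ⟨C2, hC2, hb2⟩ := hbig hE' hE0
  have hlittle : (fun h => F h - E h) =o[𝓝 0] fun h : ℝ => h := by
    have := (hF.sub hE').isLittleO
    simpa [h0, hE0] using this
  have hpow : ∀ k : ℕ, E (t / 2 ^ k) ^ (2 ^ k) = NormedSpace.exp (t • a) := by
    intro k
    rw [hE]
    rw [← NormedSpace.exp_nsmul, ← Nat.cast_smul_eq_nsmul ℝ, smul_smul]
    congr 2
    push_cast
    field_simp
  rw [tendsto_iff_norm_sub_tendsto_zero]
  have hlim : Tendsto (fun k : ℕ => (2 : ℝ) ^ k * Real.exp ((C1 + C2) * |t|) *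
      ‖F (t / 2 ^ k) - E (t / 2 ^ k)‖) atTop (𝓝 0) := by
    have h1 := (hlittle.comp_tendsto hseq)
    have h2 : (fun k : ℕ => F (t / 2 ^ k) - E (t / 2 ^ k)) =o[atTop]
        fun k : ℕ => ((2 : ℝ) ^ k)⁻¹ := by
      refine h1.trans_isBigO ?_
      refine Asymptotics.IsBigO.of_bound |t| (Eventually.of_forall fun k => ?_)
      simp [div_eq_mul_inv]
    have h3 := h2.norm_left.tendsto_div_nhds_zero
    have h4 := h3.const_mul (Real.exp ((C1 + C2) * |t|))
    rw [mul_zero] at h4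
    refine h4.congr fun k => ?_
    rw [div_inv_eq_mul]; ring
  refine squeeze_zero' (Eventually.of_forall fun k => norm_nonneg _) ?_ hlim
  filter_upwards [hseq.eventually hb1, hseq.eventually hb2] with k h1 h2
  rw [← hpow k]
  have hK : (1 : ℝ) ≤ 1 + (C1 + C2) * |t / 2 ^ k| := by
    have : 0 ≤ (C1 + C2) * |t / 2 ^ k| := by positivity
    linarith
  have ha : ‖F (t / 2 ^ k)‖ ≤ 1 + (C1 + C2) * |t / 2 ^ k| := by
    have : 0 ≤ C2 * |t / 2 ^ k| := by positivity
    linarith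
  have hb : ‖E (t / 2 ^ k)‖ ≤ 1 + (C1 + C2) * |t / 2 ^ k| := by
    have : 0 ≤ C1 * |t / 2 ^ k| := by positivity
    linarith
  refine (norm_pow_sub_pow_le_of_norm_le hK ha hb _).trans ?_
  push_cast
  refine mul_le_mul_of_nonneg_right (mul_le_mul_of_nonneg_left ?_ (by positivity)) (norm_nonneg _)
  calc (1 + (C1 + C2) * |t / 2 ^ k|) ^ 2 ^ k
      ≤ (Real.exp ((C1 + C2) * |t / 2 ^ k|)) ^ 2 ^ k := by
        refine pow_le_pow_left₀ (by linarith) ?_ _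
        linarith [Real.add_one_le_exp ((C1 + C2) * |t / 2 ^ k|)]
    _ = Real.exp ((C1 + C2) * |t|) := by
        rw [← Real.exp_nat_mul]
        congr 1
        rw [abs_div, abs_of_pos (by positivity : (0 : ℝ) < 2 ^ k)]
        push_cast
        field_simp

end Chernoff

/-! ### Matrix exponentials -/

section MatrixExp

open scoped Matrix.Norms.Operator

variable {S : Type*} [Fintype S] [DecidableEq S]

theorem hasDerivAt_matrix_exp_apply (Q : Matrix S S ℝ) (t : ℝ) (x y : S) :
    HasDerivAt (fun s : ℝ => NormedSpace.exp (s • Q) x y)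
      ((Q * NormedSpace.exp (t • Q)) x y) t := by
  have h := hasDerivAt_exp_smul_const' (𝕂 := ℝ) Q t
  let L : Matrix S S ℝ →ₗ[ℝ] ℝ :=
    { toFun := fun M => M x y, map_add' := fun _ _ => rfl, map_smul' := fun _ _ => rfl }
  exact (LinearMap.toContinuousLinearMap L).hasFDerivAt.comp_hasDerivAt t h

/-- Watching the chain only at times t/2^k and discarding paths seen outside T is, in the limit,
killing at rate level. Injectivity of e makes the block of the identity an identity. -/
theorem tendsto_submatrix_exp_pow (Q : Matrix S S ℝ) {T : Type*} [Fintype T] [DecidableEq T]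
    {e : T → S} (he : Function.Injective e) (t : ℝ) (x y : T) :
    Tendsto (fun k : ℕ => (((NormedSpace.exp ((t / 2 ^ k) • Q)).submatrix e e) ^ (2 ^ k)) x y) atTop
      (𝓝 (NormedSpace.exp (t • Q.submatrix e e) x y)) := by
  have : Nonempty T := ⟨x⟩
  have h := hasDerivAt_exp_smul_const (𝕂 := ℝ) Q 0
  let L : Matrix S S ℝ →ₗ[ℝ] Matrix T T ℝ :=
    { toFun := fun M => M.submatrix e e, map_add' := fun _ _ => rfl, map_smul' := fun _ _ => rfl }
  have h1 : HasDerivAt (fun s : ℝ => (NormedSpace.exp (s • Q)).submatrix e e)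
      (Q.submatrix e e) 0 := by
    rw [zero_smul, NormedSpace.exp_zero, one_mul] at h
    exact (LinearMap.toContinuousLinearMap L).hasFDerivAt.comp_hasDerivAt 0 h
  have h2 := tendsto_pow_exp_of_hasDerivAt h1 (by simp [Matrix.submatrix_one _ he]) t
  let L' : Matrix T T ℝ →ₗ[ℝ] ℝ :=
    { toFun := fun M => M x y, map_add' := fun _ _ => rfl, map_smul' := fun _ _ => rfl }
  exact ((LinearMap.toContinuousLinearMap L').continuous.tendsto _).comp h2

end MatrixExp

/-! ### Hitting times along dyadic grids -/

namespace CTMC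

variable {S : Type} [Fintype S] [DecidableEq S] {Q : Matrix S S ℝ}

instance (C : CTMC Q) (x : S) : IsProbabilityMeasure (C.P x) := C.prob x

theorem measurableSet_X_mem (C : CTMC Q) (t : ℝ≥0) (U : Set S) : MeasurableSet {ω | C.X t ω ∈ U} := by
  have : {ω | C.X t ω ∈ U} = ⋃ y ∈ U, {ω | C.X t ω = y} := by
    ext ω; simp
  rw [this]
  exact MeasurableSet.biUnion U.to_countable fun y _ => C.measurable_X t y

/-- Right-continuity supplies the strict inequality: the path keeps its value for a time δ after t,
so the infimum is at least t + δ. -/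
theorem lt_hit_iff (C : CTMC Q) (K : Set S) (t : ℝ≥0) (ω : C.Ω) :
    (t : ℝ≥0∞) < C.hit K ω ↔ ∀ s ≤ t, C.X s ω ∉ K := by
  constructor
  · intro h s hs hK
    have h1 : C.hit K ω ≤ (s : ℝ≥0∞) := sInf_le ⟨s, hK, rfl⟩
    exact absurd (h.trans_le (h1.trans (ENNReal.coe_le_coe.2 hs))) (lt_irrefl _)
  · intro h
    have hr := C.right_continuous ω t
    rw [eventually_nhdsWithin_iff] at hr
    obtain ⟨δ, hδ, hball⟩ := Metric.eventually_nhds_iff.1 hr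
    have hle : ((t + δ.toNNReal : ℝ≥0) : ℝ≥0∞) ≤ C.hit K ω := by
      refine le_sInf ?_
      rintro _ ⟨s, hs, rfl⟩
      rw [ENNReal.coe_le_coe]
      by_contra hlt
      push Not at hlt
      by_cases hst : s ≤ t
      · exact h s hst hs
      · push Not at hst
        have hd : dist s t < δ := by
          rw [NNReal.dist_eq, abs_of_nonneg (by
            have : (t : ℝ) < s := by exact_mod_cast hst
            linarith)]
          have : (s : ℝ) < t + δ.toNNReal := by exact_mod_cast hlt
          rw [Real.coe_toNNReal _ hδ.le] at this
          linarith
        have hX := hball hd hst.le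
        have hs' : C.X s ω ∈ K := hs
        rw [hX] at hs'
        exact h t le_rfl hs'
    refine lt_of_lt_of_le ?_ hle
    rw [ENNReal.coe_lt_coe]
    have : 0 < δ.toNNReal := by simpa using hδ
    exact lt_add_of_pos_right t this

/-- If the path is in K at time s, it stays there for a short while, and a fine enough grid has a
point in that interval, namely the first one not before s. -/
theorem forall_notMem_iff_dyadic (C : CTMC Q) (K : Set S) (t : ℝ≥0) (ω : C.Ω) :
    (∀ s ≤ t, C.X s ω ∉ K) ↔ ∀ k : ℕ, ∀ i : ℕ, i ≤ 2 ^ k → C.X (i * (t / 2 ^ k)) ω ∉ K := by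
  constructor
  · intro h k i hi
    refine h _ ?_
    have : (i : ℝ≥0) ≤ 2 ^ k := by exact_mod_cast hi
    calc (i : ℝ≥0) * (t / 2 ^ k) ≤ 2 ^ k * (t / 2 ^ k) := by gcongr
      _ = t := by field_simp
  · intro h s hs hK
    rcases eq_or_lt_of_le (zero_le (a := t)) with ht | ht
    · have hs0 : s = 0 := le_antisymm (by rw [ht]; exact hs) (zero_le (a := s))
      have := h 0 0 (by simp)
      simp only [Nat.cast_zero, zero_mul] at this
      exact this (hs0 ▸ hK)
    have hr := C.right_continuous ω s
    rw [eventually_nhdsWithin_iff] at hr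
    obtain ⟨δ, hδ, hball⟩ := Metric.eventually_nhds_iff.1 hr
    have ht' : (0 : ℝ) < t := by exact_mod_cast ht
    obtain ⟨k, hk⟩ : ∃ k : ℕ, (t : ℝ) / 2 ^ k < δ := by
      obtain ⟨k, hk⟩ := pow_unbounded_of_one_lt ((t : ℝ) / δ) (by norm_num : (1 : ℝ) < 2)
      refine ⟨k, ?_⟩
      rw [div_lt_iff₀ hδ] at hk
      rw [div_lt_iff₀ (by positivity)]
      linarith
    have hst : (s : ℝ) ≤ t := by exact_mod_cast hs
    have hp : (0 : ℝ) < 2 ^ k := by positivity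
    have hi1 : (s : ℝ) * 2 ^ k / t ≤ ⌈(s : ℝ) * 2 ^ k / t⌉₊ := Nat.le_ceil _
    have hi2 : (⌈(s : ℝ) * 2 ^ k / t⌉₊ : ℝ) < (s : ℝ) * 2 ^ k / t + 1 :=
      Nat.ceil_lt_add_one (by positivity)
    have hi3 : ⌈(s : ℝ) * 2 ^ k / t⌉₊ ≤ 2 ^ k := by
      refine Nat.ceil_le.2 ?_
      rw [div_le_iff₀ ht']
      push_cast
      rw [mul_comm]
      exact mul_le_mul_of_nonneg_left hst hp.le
    refine h k _ hi3 ?_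
    generalize ⌈(s : ℝ) * 2 ^ k / t⌉₊ = i at hi1 hi2 hi3
    have e1 : (s : ℝ) ≤ i * (t / 2 ^ k) := by
      rw [div_le_iff₀ ht'] at hi1
      rw [← mul_div_assoc, le_div_iff₀ hp]
      exact hi1
    have e2 : (i : ℝ) * (t / 2 ^ k) < s + δ := by
      have : (i : ℝ) * (t / 2 ^ k) < ((s : ℝ) * 2 ^ k / t + 1) * (t / 2 ^ k) :=
        mul_lt_mul_of_pos_right hi2 (by positivity)
      have e : ((s : ℝ) * 2 ^ k / t + 1) * (t / 2 ^ k) = s + t / 2 ^ k := by field_simp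
      linarith
    have e1' : s ≤ i * (t / 2 ^ k) := by exact_mod_cast e1
    rw [hball (y := i * (t / 2 ^ k)) ?_ e1']
    · exact hK
    · rw [NNReal.dist_eq]
      push_cast
      rw [abs_of_nonneg (by linarith)]
      linarith

theorem measurableSet_lt_hit (C : CTMC Q) (K : Set S) (t : ℝ≥0) :
    MeasurableSet {ω | (t : ℝ≥0∞) < C.hit K ω} := by
  have : {ω | (t : ℝ≥0∞) < C.hit K ω} =
      ⋂ k : ℕ, ⋂ i : ℕ, ⋂ _ : i ≤ 2 ^ k, {ω | C.X (i * (t / 2 ^ k)) ω ∈ Kᶜ} := by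
    ext ω
    simp only [Set.mem_ofPred_eq, Set.mem_iInter, lt_hit_iff, forall_notMem_iff_dyadic,
      Set.mem_compl_iff]
  rw [this]
  exact MeasurableSet.iInter fun k => MeasurableSet.iInter fun i => MeasurableSet.iInter fun _ =>
    C.measurableSet_X_mem _ _

theorem measurable_hit (C : CTMC Q) (K : Set S) : Measurable (C.hit K) := by
  refine measurable_of_Ioi fun a => ?_
  have : C.hit K ⁻¹' Set.Ioi a = ⋃ q : ℚ, {ω | a ≤ ((q : ℝ).toNNReal : ℝ≥0∞) ∧
      (((q : ℝ).toNNReal : ℝ≥0) : ℝ≥0∞) < C.hit K ω} := by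
    ext ω
    simp only [Set.mem_preimage, Set.mem_Ioi, Set.mem_iUnion, Set.mem_ofPred_eq]
    constructor
    · intro h
      obtain ⟨q, -, hq1, hq2⟩ := ENNReal.lt_iff_exists_rat_btwn.1 h
      exact ⟨q, hq1.le, hq2⟩
    · rintro ⟨q, h1, h2⟩
      exact h1.trans_lt h2
  rw [this]
  refine MeasurableSet.iUnion fun q => ?_
  by_cases ha : a ≤ ((q : ℝ).toNNReal : ℝ≥0∞)
  · simpa [ha] using C.measurableSet_lt_hit K _
  · simp [ha]

theorem measureReal_X_eq (C : CTMC Q) (x y : S) (t : ℝ≥0) :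
    (C.P x).real {ω | C.X t ω = y} = NormedSpace.exp ((t : ℝ) • Q) x y := by
  have h := C.markov x 0 (fun _ => 0) (fun _ => x) t y monotone_const
  have h1 : (C.P x).real {ω | ∀ i ≤ 0, C.X ((fun _ : ℕ => (0 : ℝ≥0)) i) ω = (fun _ => x) i} = 1 := by
    rw [measureReal_def, (prob_compl_eq_zero_iff₀ ?_).1 ?_]
    · simp
    · simpa using (C.measurable_X 0 x).nullMeasurableSet
    · have := C.start x
      rw [ae_iff] at this
      refine le_antisymm ((measure_mono ?_).trans this.le) zero_le
      intro ω hω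
      simpa using hω
  rw [h1, one_mul] at h
  rw [← h]
  refine measureReal_congr ?_
  filter_upwards [C.start x] with ω hω
  apply propext
  change C.X t ω = y ↔ (∀ i ≤ 0, C.X 0 ω = x) ∧ C.X (0 + t) ω = y
  simp [hω]

/-- The Markov axiom speaks of fully prescribed trajectories; the constraint of staying in U is a
finite disjoint union of these. -/
theorem measureReal_path_step (C : CTMC Q) (x : S) (h : ℝ≥0) (m : ℕ) (U : Set S) (y z : S) :
    (C.P x).real {ω | (∀ i ≤ m, C.X (i * h) ω ∈ U) ∧ C.X (m * h) ω = y ∧ C.X ((m + 1 : ℕ) * h) ω = z} =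
      (C.P x).real {ω | (∀ i ≤ m, C.X (i * h) ω ∈ U) ∧ C.X (m * h) ω = y} *
        NormedSpace.exp ((h : ℝ) • Q) y z := by
  classical
  let V : Finset (Fin (m + 1) → S) := {p | (∀ i, p i ∈ U) ∧ p (Fin.last m) = y}
  let Z : C.Ω → Fin (m + 1) → S := fun ω i => C.X (i * h) ω
  have hZ : ∀ p, MeasurableSet {ω | Z ω = p} := by
    intro p
    have : {ω | Z ω = p} = ⋂ i : Fin (m + 1), {ω | C.X (i * h) ω = p i} := by
      ext ω; simp [Z, funext_iff]
    rw [this]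
    exact MeasurableSet.iInter fun i => C.measurable_X _ _
  have hmem : ∀ ω, ((∀ i ≤ m, C.X (i * h) ω ∈ U) ∧ C.X (m * h) ω = y) ↔ Z ω ∈ V := by
    intro ω
    simp only [V, Z, Finset.mem_filter, Finset.mem_univ, true_and, Fin.val_last]
    refine and_congr_left fun _ => ⟨fun H i => H i (by omega), fun H i hi => ?_⟩
    exact H ⟨i, by omega⟩
  have key : ∀ B : Set C.Ω, MeasurableSet B →
      (C.P x).real {ω | Z ω ∈ V ∧ ω ∈ B} = ∑ p ∈ V, (C.P x).real {ω | Z ω = p ∧ ω ∈ B} := by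
    intro B hB
    rw [← measureReal_biUnion_finset]
    · congr 1
      ext ω
      simp
    · intro p _ q _ hpq
      rw [Function.onFun, Set.disjoint_left]
      rintro ω ⟨h1, -⟩ ⟨h2, -⟩
      exact hpq (h1.symm.trans h2)
    · intro p _
      exact (hZ p).inter hB
  have e1 : {ω | (∀ i ≤ m, C.X (i * h) ω ∈ U) ∧ C.X (m * h) ω = y ∧ C.X ((m + 1 : ℕ) * h) ω = z} =
      {ω | Z ω ∈ V ∧ ω ∈ {ω | C.X ((m + 1 : ℕ) * h) ω = z}} := by
    ext ω
    simp only [Set.mem_ofPred_eq, ← hmem, and_assoc]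
  have e2 : {ω | (∀ i ≤ m, C.X (i * h) ω ∈ U) ∧ C.X (m * h) ω = y} =
      {ω | Z ω ∈ V ∧ ω ∈ (Set.univ : Set C.Ω)} := by
    ext ω
    simp only [Set.mem_ofPred_eq, ← hmem, Set.mem_univ, and_true]
  rw [e1, e2, key _ (C.measurable_X _ _), key _ MeasurableSet.univ, Finset.sum_mul]
  refine Finset.sum_congr rfl fun p hp => ?_
  have hlast : p (Fin.last m) = y := by
    simp only [V, Finset.mem_filter] at hp
    exact hp.2.2
  -- The axiom wants a trajectory indexed by ℕ. Only indices up to m matter, so the wrap-around of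
  -- `Fin.ofNat` is harmless.
  have hm := C.markov x m (fun i => i * h) (fun i => p (Fin.ofNat (m + 1) i)) h z
    (fun i j hij => by dsimp only; gcongr)
  have e3 : ∀ ω, (∀ i ≤ m, C.X ((fun i : ℕ => (i : ℝ≥0) * h) i) ω = p (Fin.ofNat (m + 1) i)) ↔
      Z ω = p := by
    intro ω
    rw [funext_iff]
    constructor
    · intro H i
      have := H i (by omega)
      simpa [Z] using this
    · intro H i hi
      have := H (Fin.ofNat (m + 1) i)
      simp only [Z, Fin.ofNat, Nat.mod_eq_of_lt (show i < m + 1 by omega)] at this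
      simpa [Fin.ofNat, Nat.mod_eq_of_lt (show i < m + 1 by omega)] using this
  have e4 : Fin.ofNat (m + 1) m = Fin.last m := by
    ext; simp [Fin.ofNat]
  simp only [e3, e4, hlast] at hm
  have e5 : (m : ℝ≥0) * h + h = ((m + 1 : ℕ) : ℝ≥0) * h := by push_cast; ring
  rw [e5] at hm
  simpa using hm

end CTMC

open scoped Classical in
/-- The rate matrix `Q` killed on `K`, on the points outside `K`. -/
def killedRates {S : Type} (Q : Matrix S S ℝ) (K : Set S) : Matrix {x // x ∉ K} {x // x ∉ K} ℝ :=
  Q.submatrix Subtype.val Subtype.val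

open scoped Classical in
/-- The probability that the chain with rates `Q` started at `x` has not hit `K` by time `t`. -/
def survival {S : Type} [Fintype S] [DecidableEq S] (Q : Matrix S S ℝ) (K : Set S) (t : ℝ) (x : S) :
    ℝ :=
  if h : x ∉ K then ∑ y, NormedSpace.exp (t • killedRates Q K) ⟨x, h⟩ y else 0

/-! ### Hitting laws through the killed semigroup -/

namespace CTMC

variable {S : Type} [Fintype S] [DecidableEq S] {Q : Matrix S S ℝ}

theorem measurableSet_forall_X_mem (C : CTMC Q) (U : Set S) (h : ℝ≥0) (m : ℕ) :
    MeasurableSet {ω | ∀ i : ℕ, i ≤ m → C.X (i * h) ω ∈ U} := by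
  have : {ω | ∀ i : ℕ, i ≤ m → C.X (i * h) ω ∈ U} =
      ⋂ i : ℕ, ⋂ _ : i ≤ m, {ω | C.X (i * h) ω ∈ U} := by
    ext ω; simp
  rw [this]
  exact MeasurableSet.iInter fun i => MeasurableSet.iInter fun _ => C.measurableSet_X_mem _ _

open scoped Classical in
theorem measureReal_path_notMem (C : CTMC Q) (K : Set S) (h : ℝ≥0) (m : ℕ) (x y : {x // x ∉ K}) :
    (C.P x).real {ω | (∀ i ≤ m, C.X (i * h) ω ∈ Kᶜ) ∧ C.X (m * h) ω = y} =
      (((NormedSpace.exp ((h : ℝ) • Q)).submatrix Subtype.val Subtype.val :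
        Matrix {x // x ∉ K} {x // x ∉ K} ℝ) ^ m) x y := by
  induction m generalizing y with
  | zero =>
    have h0 := C.measureReal_X_eq x y 0
    rw [NNReal.coe_zero, zero_smul, NormedSpace.exp_zero] at h0
    rw [pow_zero]
    have e : (1 : Matrix {x // x ∉ K} {x // x ∉ K} ℝ) x y = (1 : Matrix S S ℝ) x y := by
      rw [← Matrix.submatrix_one _ Subtype.val_injective, Matrix.submatrix_apply]
    rw [e, ← h0]
    congr 1
    ext ω
    simp only [Set.mem_ofPred_eq, Nat.cast_zero, zero_mul]
    constructor
    · exact fun H => H.2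
    · intro H
      refine ⟨fun i hi => ?_, H⟩
      obtain rfl : i = 0 := by omega
      simp [H]
  | succ m ih =>
    rw [pow_succ, Matrix.mul_apply]
    simp only [← ih, Matrix.submatrix_apply, ← C.measureReal_path_step]
    rw [← measureReal_biUnion_finset]
    · congr 1
      ext ω
      simp only [Set.mem_ofPred_eq, Set.mem_iUnion, Finset.mem_univ, exists_prop, true_and]
      constructor
      · rintro ⟨h1, h2⟩
        exact ⟨⟨_, h1 m (by omega)⟩, fun i hi => h1 i (by omega), rfl, h2⟩
      · rintro ⟨z, h1, h2, h3⟩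
        refine ⟨fun i hi => ?_, h3⟩
        rcases Nat.lt_or_ge m i with hi' | hi'
        · obtain rfl : i = m + 1 := by omega
          rw [h3]; exact y.2
        · exact h1 i hi'
    · intro p _ q _ hpq
      rw [Function.onFun, Set.disjoint_left]
      rintro ω ⟨-, h1, -⟩ ⟨-, h2, -⟩
      exact hpq (Subtype.ext (h1.symm.trans h2))
    · intro p _
      refine MeasurableSet.inter ?_ ((C.measurable_X _ _).inter (C.measurable_X _ _))
      exact C.measurableSet_forall_X_mem _ _ _

open scoped Classical in
-- The events of avoiding K on the k-th dyadic grid decrease to that of avoiding K throughout, and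
-- their probabilities are powers of truncated transition matrices, to which the product formula
-- applies.
theorem measureReal_X_eq_lt_hit (C : CTMC Q) (K : Set S) (t : ℝ≥0) (x y : {x // x ∉ K}) :
    (C.P x).real {ω | C.X t ω = y ∧ (t : ℝ≥0∞) < C.hit K ω} =
      NormedSpace.exp ((t : ℝ) • killedRates Q K) x y := by
  let E : ℕ → Set C.Ω := fun k =>
    {ω | (∀ i : ℕ, i ≤ 2 ^ k → C.X (i * (t / 2 ^ k)) ω ∈ Kᶜ) ∧ C.X ((2 ^ k : ℕ) * (t / 2 ^ k)) ω = y}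
  have hk : ∀ k : ℕ, ((2 ^ k : ℕ) : ℝ≥0) * (t / 2 ^ k) = t := by
    intro k; push_cast; field_simp
  have hanti : Antitone E := by
    refine antitone_nat_of_succ_le fun k ω hω => ?_
    simp only [E, Set.mem_ofPred_eq, hk] at hω ⊢
    refine ⟨fun i hi => ?_, hω.2⟩
    have := hω.1 (2 * i) (by rw [pow_succ]; omega)
    have e : ((2 * i : ℕ) : ℝ≥0) * (t / 2 ^ (k + 1)) = i * (t / 2 ^ k) := by
      push_cast; rw [pow_succ]; field_simp
    rwa [e] at this
  have hmeas : ∀ k, MeasurableSet (E k) := by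
    intro k
    refine MeasurableSet.inter ?_ (C.measurable_X _ _)
    exact C.measurableSet_forall_X_mem _ _ _
  have hinter : ⋂ k, E k = {ω | C.X t ω = y ∧ (t : ℝ≥0∞) < C.hit K ω} := by
    ext ω
    simp only [E, Set.mem_iInter, Set.mem_ofPred_eq, hk, lt_hit_iff, forall_notMem_iff_dyadic,
      Set.mem_compl_iff]
    exact ⟨fun H => ⟨(H 0).2, fun k => (H k).1⟩, fun H k => ⟨H.2 k, H.1⟩⟩
  have h1 : Tendsto (fun k => (C.P x).real (E k)) atTop (𝓝 ((C.P x).real (⋂ k, E k))) := by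
    refine (ENNReal.tendsto_toReal (measure_ne_top _ _)).comp ?_
    exact tendsto_measure_iInter_atTop (fun k => (hmeas k).nullMeasurableSet) hanti
      ⟨0, measure_ne_top _ _⟩
  have h2 := tendsto_submatrix_exp_pow Q (T := {x // x ∉ K}) Subtype.val_injective (t : ℝ) x y
  rw [hinter] at h1
  refine tendsto_nhds_unique h1 (h2.congr fun k => ?_)
  rw [show (t : ℝ) / 2 ^ k = ((t / 2 ^ k : ℝ≥0) : ℝ) by push_cast; rfl]
  exact (C.measureReal_path_notMem K (t / 2 ^ k) (2 ^ k) x y).symm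

theorem measureReal_lt_hit (C : CTMC Q) (K : Set S) (t : ℝ≥0) {x : S} :
    (C.P x).real {ω | (t : ℝ≥0∞) < C.hit K ω} = survival Q K t x := by
  classical
  by_cases hx : x ∉ K
  · rw [survival, dif_pos hx]
    have := fun y => C.measureReal_X_eq_lt_hit K t ⟨x, hx⟩ y
    simp only [← this]
    rw [← measureReal_biUnion_finset]
    · congr 1
      ext ω
      simp only [Set.mem_ofPred_eq, Set.mem_iUnion, Finset.mem_univ, exists_prop, true_and]
      constructor
      · intro h
        exact ⟨⟨_, (C.lt_hit_iff K t ω).1 h t le_rfl⟩, rfl, h⟩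
      · rintro ⟨y, -, h⟩
        exact h
    · intro p _ q _ hpq
      rw [Function.onFun, Set.disjoint_left]
      rintro ω ⟨h1, -⟩ ⟨h2, -⟩
      exact hpq (Subtype.ext (h1.symm.trans h2))
    · intro p _
      exact (C.measurable_X _ _).inter (C.measurableSet_lt_hit _ _)
  · rw [survival, dif_neg hx, measureReal_eq_zero_iff]
    push Not at hx
    have := C.start x
    rw [ae_iff] at this
    refine measure_mono_null ?_ this
    intro ω hω h
    have h0 := (C.lt_hit_iff K t ω).1 hω 0 zero_le
    rw [h] at h0
    exact h0 hx

theorem measureReal_hit_le (C : CTMC Q) (K : Set S) (t : ℝ≥0) (x : S) :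
    (C.P x).real {ω | C.hit K ω ≤ t} = 1 - survival Q K t x := by
  rw [← C.measureReal_lt_hit, ← probReal_compl_eq_one_sub (C.measurableSet_lt_hit K t)]
  congr 1
  ext ω
  simp

theorem survival_nonneg (C : CTMC Q) (K : Set S) {t : ℝ} (ht : 0 ≤ t) (x : S) :
    0 ≤ survival Q K t x := by
  lift t to ℝ≥0 using ht
  rw [← C.measureReal_lt_hit]
  exact measureReal_nonneg

theorem survival_le_one (C : CTMC Q) (K : Set S) {t : ℝ} (ht : 0 ≤ t) (x : S) :
    survival Q K t x ≤ 1 := by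
  lift t to ℝ≥0 using ht
  rw [← C.measureReal_lt_hit]
  exact measureReal_le_one

theorem survival_antitone (C : CTMC Q) (K : Set S) {s t : ℝ} (hs : 0 ≤ s) (hst : s ≤ t) (x : S) :
    survival Q K t x ≤ survival Q K s x := by
  lift t to ℝ≥0 using hs.trans hst
  lift s to ℝ≥0 using hs
  rw [← C.measureReal_lt_hit, ← C.measureReal_lt_hit]
  refine measureReal_mono fun ω hω => ?_
  exact lt_of_le_of_lt (ENNReal.coe_le_coe.2 (by exact_mod_cast hst)) hω

open scoped Classical in
theorem exp_killedRates_nonneg (C : CTMC Q) (K : Set S) {t : ℝ} (ht : 0 ≤ t) (x y : {x // x ∉ K}) :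
    0 ≤ NormedSpace.exp (t • killedRates Q K) x y := by
  lift t to ℝ≥0 using ht
  rw [← C.measureReal_X_eq_lt_hit]
  exact measureReal_nonneg

theorem exp_rates_nonneg (C : CTMC Q) {t : ℝ} (ht : 0 ≤ t) (x y : S) :
    0 ≤ NormedSpace.exp (t • Q) x y := by
  lift t to ℝ≥0 using ht
  rw [← C.measureReal_X_eq]
  exact measureReal_nonneg

theorem sum_exp_rates (C : CTMC Q) {t : ℝ} (ht : 0 ≤ t) (x : S) :
    ∑ y, NormedSpace.exp (t • Q) x y = 1 := by
  lift t to ℝ≥0 using ht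
  simp only [← C.measureReal_X_eq]
  rw [← measureReal_biUnion_finset]
  · rw [← probReal_univ (μ := C.P x)]
    congr 1
    ext ω
    simp
  · intro p _ q _ hpq
    rw [Function.onFun, Set.disjoint_left]
    intro ω h1 h2
    exact hpq (h1.symm.trans h2)
  · intro p _
    exact C.measurable_X _ _

end CTMC

open scoped Classical in
theorem sum_mul_eq_sum_killedRates {S : Type} [Fintype S] {Q : Matrix S S ℝ}
    {K : Set S} {v : S → ℝ} (hv : ∀ x ∈ K, v x = 0) (x : {x // x ∉ K}) :
    ∑ y, Q x y * v y = ∑ y, killedRates Q K x y * v y := by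
  refine Eq.trans ?_ (Finset.sum_subtype (Finset.univ.filter fun y => y ∉ K) (by simp)
    fun y => Q x y * v y)
  symm
  refine Finset.sum_filter_of_ne fun y _ hy hK => hy ?_
  rw [hv y hK, mul_zero]

section Survival

variable {S : Type} [Fintype S] [DecidableEq S] {Q : Matrix S S ℝ} {K : Set S}

theorem survival_of_mem {x : S} (hx : x ∈ K) (t : ℝ) : survival Q K t x = 0 := by
  simp [survival, hx]

theorem survival_zero {x : S} (hx : x ∉ K) : survival Q K 0 x = 1 := by
  classical
  simp [survival, hx, Matrix.one_apply]

/-- The backward equation. The full matrix Q may replace the killed one because the survival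
function vanishes on K; this lets one maximum principle serve for every killing set. -/
theorem hasDerivAt_survival {x : S} (hx : x ∉ K) (t : ℝ) :
    HasDerivAt (fun s => survival Q K s x) (∑ y, Q x y * survival Q K t y) t := by
  classical
  have h : ∀ y : {x // x ∉ K}, HasDerivAt (fun s : ℝ => NormedSpace.exp (s • killedRates Q K) ⟨x, hx⟩ y)
      ((killedRates Q K * NormedSpace.exp (t • killedRates Q K)) ⟨x, hx⟩ y) t :=
    fun y => hasDerivAt_matrix_exp_apply _ _ _ _
  have h2 := HasDerivAt.fun_sum (u := Finset.univ) fun y _ => h y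
  have e : (fun s => survival Q K s x) =
      fun s => ∑ y, NormedSpace.exp (s • killedRates Q K) ⟨x, hx⟩ y := by
    funext s; simp [survival, hx]
  rw [e]
  refine h2.congr_deriv ?_
  symm
  rw [sum_mul_eq_sum_killedRates (fun y hy => survival_of_mem hy t) ⟨x, hx⟩]
  simp only [Matrix.mul_apply]
  rw [Finset.sum_comm]
  refine Finset.sum_congr rfl fun y _ => ?_
  rw [← Finset.mul_sum]
  congr 1
  rw [survival, dif_pos y.2]

end Survival

theorem continuous_survival {S : Type} [Fintype S] [DecidableEq S] {Q : Matrix S S ℝ} {K : Set S}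
    (x : S) : Continuous fun t => survival Q K t x := by
  by_cases hx : x ∈ K
  · simp only [survival_of_mem hx]
    exact continuous_const
  · exact continuous_iff_continuousAt.2 fun t => (hasDerivAt_survival hx t).continuousAt

theorem lintegral_Ioi_const_mul_exp {c l : ℝ} (hc : 0 ≤ c) (hl : 0 < l) :
    ∫⁻ t in Set.Ioi (0 : ℝ), ENNReal.ofReal (c * Real.exp (-(l * t))) = ENNReal.ofReal (c / l) := by
  have hint := (integrableOn_exp_mul_Ioi (a := -l) (by linarith) 0).const_mul c
  simp only [neg_mul] at hint
  rw [← ofReal_integral_eq_lintegral_ofReal hint (Eventually.of_forall fun t => by positivity)]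
  congr 1
  rw [integral_const_mul]
  have := integral_exp_mul_Ioi (a := -l) (by linarith) 0
  simp only [neg_mul] at this
  rw [this]
  simp
  field_simp

namespace CTMC

variable {S : Type} [Fintype S] [DecidableEq S] {Q : Matrix S S ℝ}

/-- The hitting time has no atom at t: the event lies in {τ > s} for every s < t, and survival is
continuous in time. At t = 0 this needs a start outside K. -/
theorem measureReal_ofReal_le_hit (C : CTMC Q) {K : Set S} {t : ℝ} (ht : 0 ≤ t) {x : S} (hx : x ∉ K) :
    (C.P x).real {ω | ENNReal.ofReal t ≤ C.hit K ω} = survival Q K t x := by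
  refine le_antisymm ?_ ?_
  · rcases ht.eq_or_lt with rfl | ht
    · rw [survival_zero hx]
      exact measureReal_le_one
    · have hc : Tendsto (fun s => survival Q K s x) (𝓝[<] t) (𝓝 (survival Q K t x)) :=
        ((continuous_survival x).tendsto t).mono_left nhdsWithin_le_nhds
      refine ge_of_tendsto hc ?_
      filter_upwards [Ioo_mem_nhdsLT ht] with s hs
      have h := C.measureReal_lt_hit K s.toNNReal (x := x)
      rw [Real.coe_toNNReal _ hs.1.le] at h
      rw [← h]
      refine measureReal_mono fun ω hω => ?_
      exact lt_of_lt_of_le ((ENNReal.ofReal_lt_ofReal_iff ht).2 hs.2) hω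
  · have h := C.measureReal_lt_hit K t.toNNReal (x := x)
    rw [Real.coe_toNNReal _ ht] at h
    rw [← h]
    refine measureReal_mono fun ω hω => ?_
    exact le_of_lt (show ENNReal.ofReal t < C.hit K ω from hω)

theorem measureReal_ofReal_lt_hit (C : CTMC Q) (K : Set S) {t : ℝ} (ht : 0 ≤ t) (x : S) :
    (C.P x).real {ω | ENNReal.ofReal t < C.hit K ω} = survival Q K t x := by
  have h := C.measureReal_lt_hit K t.toNNReal (x := x)
  rwa [Real.coe_toNNReal _ ht] at h

theorem measureReal_hit_le_ofReal (C : CTMC Q) (K : Set S) {t : ℝ} (ht : 0 ≤ t) (x : S) :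
    (C.P x).real {ω | C.hit K ω ≤ ENNReal.ofReal t} = 1 - survival Q K t x := by
  have h := C.measureReal_hit_le K t.toNNReal x
  rwa [Real.coe_toNNReal _ ht] at h

theorem evol_eq (C : CTMC Q) (x y : S) {t : ℝ} (ht : 0 ≤ t) :
    C.evol x t.toNNReal y = NormedSpace.exp (t • Q) x y := by
  rw [evol, measureReal_X_eq, Real.coe_toNNReal _ ht]

theorem lawFrom_real (C : CTMC Q) {ν : S → ℝ} (hν : ∀ x, 0 ≤ ν x) (E : Set C.Ω) :
    (C.lawFrom ν).real E = ∑ x, ν x * (C.P x).real E := by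
  rw [lawFrom, measureReal_def, Measure.coe_finsetSum, Finset.sum_apply, ENNReal.toReal_sum]
  · refine Finset.sum_congr rfl fun x _ => ?_
    rw [Measure.smul_apply, smul_eq_mul, ENNReal.toReal_mul, ENNReal.toReal_ofReal (hν x),
      measureReal_def]
  · intro x _
    rw [Measure.smul_apply, smul_eq_mul]
    exact ENNReal.mul_ne_top ENNReal.ofReal_ne_top (measure_ne_top _ _)

instance (C : CTMC Q) (ν : S → ℝ) : IsFiniteMeasure (C.lawFrom ν) := by
  constructor
  rw [lawFrom, Measure.coe_finsetSum, Finset.sum_apply]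
  refine ENNReal.sum_lt_top.2 fun x _ => ?_
  rw [Measure.smul_apply, smul_eq_mul]
  exact ENNReal.mul_lt_top ENNReal.ofReal_lt_top (measure_lt_top _ _)

theorem lawFrom_ofReal_lt_hit (C : CTMC Q) {K : Set S} {ν : S → ℝ} (hν : ∀ x, 0 ≤ ν x) {t : ℝ}
    (ht : 0 ≤ t) :
    (C.lawFrom ν).real {ω | ENNReal.ofReal t < C.hit K ω} = ∑ x, ν x * survival Q K t x := by
  simp only [C.lawFrom_real hν, C.measureReal_ofReal_lt_hit K ht]

/-- The layer-cake formula. Decay of the tail makes the hitting time finite almost surely, so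
passing to real values loses nothing. -/
theorem meanHit_eq_lintegral (C : CTMC Q) {K : Set S} {ν : S → ℝ} (hν : ∀ x, 0 ≤ ν x)
    (hfin : Tendsto (fun t => ∑ x, ν x * survival Q K t x) atTop (𝓝 0)) :
    C.meanHit ν K = ∫⁻ t in Set.Ioi (0 : ℝ), ENNReal.ofReal (∑ x, ν x * survival Q K t x) := by
  have htop : ∀ᵐ ω ∂(C.lawFrom ν), C.hit K ω ≠ ∞ := by
    rw [ae_iff, ← measureReal_eq_zero_iff]
    refine le_antisymm ?_ measureReal_nonneg
    refine ge_of_tendsto hfin ?_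
    filter_upwards [eventually_ge_atTop 0] with t ht
    rw [← C.lawFrom_ofReal_lt_hit hν ht]
    refine measureReal_mono fun ω hω => ?_
    simp only [ne_eq, not_not, Set.mem_ofPred_eq] at hω ⊢
    rw [hω]
    exact ENNReal.ofReal_lt_top
  have h1 : C.meanHit ν K = ∫⁻ ω, ENNReal.ofReal (C.hit K ω).toReal ∂(C.lawFrom ν) := by
    refine lintegral_congr_ae ?_
    filter_upwards [htop] with ω hω
    rw [ENNReal.ofReal_toReal hω]
  rw [h1, lintegral_eq_lintegral_meas_lt _ (Eventually.of_forall fun ω => ENNReal.toReal_nonneg)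
    (C.measurable_hit K).ennreal_toReal.aemeasurable]
  refine setLIntegral_congr_fun measurableSet_Ioi fun t ht => ?_
  have ht' : (0 : ℝ) ≤ t := le_of_lt ht
  rw [← C.lawFrom_ofReal_lt_hit hν ht', measureReal_def, ENNReal.ofReal_toReal (measure_ne_top _ _)]
  refine measure_congr ?_
  filter_upwards [htop] with ω hω
  apply propext
  change t < (C.hit K ω).toReal ↔ ENNReal.ofReal t < C.hit K ω
  rw [ENNReal.ofReal_lt_iff_lt_toReal ht' hω]

theorem meanHit_mem_Icc (C : CTMC Q) {K : Set S} {ν : S → ℝ} (hν : ∀ x, 0 ≤ ν x) {a b l : ℝ}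
    (ha : 0 ≤ a) (hb : 0 ≤ b) (hl : 0 < l)
    (h1 : ∀ t, 0 ≤ t → a * Real.exp (-(l * t)) ≤ ∑ x, ν x * survival Q K t x)
    (h2 : ∀ t, 0 ≤ t → ∑ x, ν x * survival Q K t x ≤ b * Real.exp (-(l * t))) :
    C.meanHit ν K ∈ Set.Icc (ENNReal.ofReal (a / l)) (ENNReal.ofReal (b / l)) := by
  have hfin : Tendsto (fun t => ∑ x, ν x * survival Q K t x) atTop (𝓝 0) := by
    have hexp : Tendsto (fun t => b * Real.exp (-(l * t))) atTop (𝓝 0) := by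
      have := (Real.tendsto_exp_neg_atTop_nhds_zero.comp
        (tendsto_id.const_mul_atTop hl)).const_mul b
      simpa using this
    refine squeeze_zero' ?_ ?_ hexp
    · filter_upwards [eventually_ge_atTop 0] with t ht
      exact (by positivity : 0 ≤ a * Real.exp (-(l * t))).trans (h1 t ht)
    · filter_upwards [eventually_ge_atTop 0] with t ht using h2 t ht
  rw [C.meanHit_eq_lintegral hν hfin, ← lintegral_Ioi_const_mul_exp ha hl,
    ← lintegral_Ioi_const_mul_exp hb hl]
  constructor
  · exact setLIntegral_mono' measurableSet_Ioi fun t ht =>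
      ENNReal.ofReal_le_ofReal (h1 t (le_of_lt ht))
  · exact setLIntegral_mono' measurableSet_Ioi fun t ht =>
      ENNReal.ofReal_le_ofReal (h2 t (le_of_lt ht))

end CTMC

/-! ### A parabolic maximum principle -/

/-- If the time derivative of `u` is nonpositive at every positive spatial maximum of `u`, then `u`
stays nonpositive. -/
theorem nonpos_of_deriv_nonpos_at_max {ι : Type*} (D : Finset ι) {u u' : ℝ → ι → ℝ}
    (hd : ∀ p ∈ D, ∀ s, 0 ≤ s → HasDerivAt (fun r => u r p) (u' s p) s)
    (h0 : ∀ p ∈ D, u 0 p ≤ 0)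
    (hmax : ∀ s, 0 < s → ∀ p ∈ D, 0 < u s p → (∀ q ∈ D, u s q ≤ u s p) → u' s p ≤ 0)
    {t : ℝ} (ht : 0 ≤ t) {p : ι} (hp : p ∈ D) : u t p ≤ 0 := by
  refine le_of_forall_pos_le_add fun δ' hδ' => ?_
  -- Subtracting δ·s makes the principle strict: at a space-time maximum of u - δs the left
  -- difference quotients force u' ≥ δ > 0, against `hmax`. The choice of δ keeps δt ≤ δ'.
  set δ := δ' / (t + 1) with hδdef
  have hδ : 0 < δ := by positivity
  suffices H : u t p ≤ δ * t by
    have : δ * t ≤ δ' := by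
      rw [hδdef, div_mul_eq_mul_div, div_le_iff₀ (by positivity)]
      nlinarith
    linarith
  by_contra hcon
  push Not at hcon
  have hmaxq : ∀ q ∈ D, ∃ s ∈ Set.Icc 0 t, ∀ r ∈ Set.Icc 0 t, u r q - δ * r ≤ u s q - δ * s := by
    intro q hq
    refine isCompact_Icc.exists_isMaxOn (f := fun r => u r q - δ * r) ⟨0, le_rfl, ht⟩ ?_
    refine ContinuousOn.sub (fun s hs => ?_) (by fun_prop)
    exact (hd q hq s hs.1).continuousAt.continuousWithinAt
  choose! σ hσ1 hσ2 using hmaxq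
  obtain ⟨q, hq, hqmax⟩ := D.exists_max_image (fun q => u (σ q) q - δ * σ q) ⟨p, hp⟩
  have hpos : 0 < u (σ q) q - δ * σ q := by
    have h1 := hσ2 p hp t ⟨ht, le_rfl⟩
    have h2 := hqmax p hp
    linarith
  have hs := hσ1 q hq
  have hs0 : 0 < σ q := by
    rcases hs.1.eq_or_lt with h | h
    · rw [← h] at hpos
      have := h0 q hq
      linarith
    · exact h
  have hspace : ∀ r ∈ D, u (σ q) r ≤ u (σ q) q := by
    intro r hr
    have h1 := hσ2 r hr (σ q) hs
    have h2 := hqmax r hr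
    linarith
  have hle := hmax (σ q) hs0 q hq (by nlinarith) hspace
  have hder : HasDerivAt (fun r => u r q - δ * r) (u' (σ q) q - δ) (σ q) := by
    have := (hd q hq (σ q) hs.1).fun_sub ((hasDerivAt_id' (σ q)).const_mul δ)
    rwa [mul_one] at this
  have hge : 0 ≤ u' (σ q) q - δ := by
    have hw := hder.hasDerivWithinAt (s := Set.Iic (σ q))
    by_contra hneg
    push Not at hneg
    have hslope := (hasDerivWithinAt_iff_tendsto_slope' (by simp)).1
      (hder.hasDerivWithinAt (s := Set.Iio (σ q)))
    have hev := hslope.eventually (gt_mem_nhds hneg)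
    have hev2 := hev.and (Ioo_mem_nhdsLT hs0)
    obtain ⟨r, hr1, hr2⟩ := hev2.exists
    have hval := hσ2 q hq r ⟨hr2.1.le, hr2.2.le.trans hs.2⟩
    rw [slope_def_field] at hr1
    have : 0 ≤ ((u r q - δ * r) - (u (σ q) q - δ * σ q)) / (r - σ q) :=
      div_nonneg_of_nonpos (by linarith) (by linarith [hr2.2])
    linarith
  linarith

/-- The parabolic maximum principle for a rate matrix. -/
theorem nonpos_of_deriv_le_rates {S : Type*} [Fintype S] {Q : Matrix S S ℝ}
    (hQ : ∀ x y, x ≠ y → 0 ≤ Q x y) (hrow : ∀ x, ∑ y, Q x y = 0) {D : Set S} {u u' : ℝ → S → ℝ}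
    (hd : ∀ x ∈ D, ∀ s, 0 ≤ s → HasDerivAt (fun r => u r x) (u' s x) s)
    (hle : ∀ x ∈ D, ∀ s, 0 ≤ s → u' s x ≤ ∑ y, Q x y * u s y)
    (h0 : ∀ x ∈ D, u 0 x ≤ 0) (hb : ∀ x ∉ D, ∀ s, 0 ≤ s → u s x ≤ 0) {t : ℝ} (ht : 0 ≤ t) (x : S) :
    u t x ≤ 0 := by
  classical
  by_cases hx : x ∈ D
  swap
  · exact hb x hx t ht
  refine nonpos_of_deriv_nonpos_at_max (Finset.univ.filter (· ∈ D)) (u := u) (u' := u')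
    (fun p hp => hd p (by simpa using hp)) (fun p hp => h0 p (by simpa using hp)) ?_ ht
    (by simpa using hx)
  intro s hs p hp hpos hmax
  simp only [Finset.mem_filter, Finset.mem_univ, true_and] at hp hmax
  refine (hle p hp s hs.le).trans ?_
  have e : ∑ y, Q p y * u s y = ∑ y, Q p y * (u s y - u s p) := by
    simp only [mul_sub, Finset.sum_sub_distrib, ← Finset.sum_mul, hrow p, zero_mul, sub_zero]
  rw [e]
  refine Finset.sum_nonpos fun y _ => ?_
  by_cases hy : p = y
  · simp [hy]
  · refine mul_nonpos_of_nonneg_of_nonpos (hQ p y hy) ?_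
    by_cases hyD : y ∈ D
    · linarith [hmax y hyD]
    · linarith [hb y hyD s hs.le]

/-! ### Spectral theory of reversible killed generators -/

section Perron

variable {T : Type*} [Fintype T] [DecidableEq T]

theorem Matrix.IsHermitian.exp_smul_apply {B : Matrix T T ℝ} (hB : B.IsHermitian) (t : ℝ) (x y : T) :
    NormedSpace.exp (t • B) x y =
      ∑ i, (hB.eigenvectorUnitary : Matrix T T ℝ) x i * Real.exp (t * hB.eigenvalues i) *
        (hB.eigenvectorUnitary : Matrix T T ℝ) y i := by
  set U : Matrix T T ℝ := (hB.eigenvectorUnitary : Matrix T T ℝ) with hU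
  have hUU : U * star U = 1 := Unitary.coe_mul_star_self hB.eigenvectorUnitary
  have hUU' : star U * U = 1 := Unitary.coe_star_mul_self hB.eigenvectorUnitary
  let V : (Matrix T T ℝ)ˣ := ⟨U, star U, hUU, hUU'⟩
  have hs : t • B = (V : Matrix T T ℝ) * Matrix.diagonal (fun i => t * hB.eigenvalues i) *
      ((V⁻¹ : (Matrix T T ℝ)ˣ) : Matrix T T ℝ) := by
    have h := hB.spectral_theorem
    rw [Unitary.conjStarAlgAut_apply] at h
    conv_lhs => rw [h]
    rw [← Matrix.smul_mul, ← Matrix.mul_smul, ← Matrix.diagonal_smul]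
    rfl
  rw [hs, Matrix.exp_units_conj, Matrix.exp_diagonal]
  change (U * _ * star U : Matrix T T ℝ) x y = _
  rw [Matrix.mul_apply]
  refine Finset.sum_congr rfl fun i _ => ?_
  rw [Matrix.mul_diagonal, Pi.coe_exp, Real.exp_eq_exp_ℝ, Matrix.star_apply, star_trivial]

/-- After scaling by the top eigenvalue, the semigroup converges to the spectral projection W onto
the top eigenspace. As a limit of nonnegative matrices W is nonnegative, so a nonzero column of it
is the eigenvector sought. No irreducibility enters, so the eigenvector may have zeros. -/
theorem Matrix.IsHermitian.exists_perron [Nonempty T] {B : Matrix T T ℝ} (hB : B.IsHermitian)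
    (hpos : ∀ t : ℝ, 0 ≤ t → ∀ x y, 0 ≤ NormedSpace.exp (t • B) x y) :
    ∃ (l : ℝ) (ψ : T → ℝ), (∀ x, 0 ≤ ψ x) ∧ (∃ x, ψ x ≠ 0) ∧ (∀ x, ∑ y, B x y * ψ y = l * ψ x) ∧
      ∀ x y, ∃ c, Tendsto (fun t : ℝ => Real.exp (-(l * t)) * NormedSpace.exp (t • B) x y) atTop
        (𝓝 c) := by
  set U : Matrix T T ℝ := (hB.eigenvectorUnitary : Matrix T T ℝ) with hU
  obtain ⟨i₀, hi₀⟩ := Finite.exists_max hB.eigenvalues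
  set l := hB.eigenvalues i₀ with hl
  let W : T → T → ℝ := fun x y => ∑ i, if hB.eigenvalues i = l then U x i * U y i else 0
  have hlim : ∀ x y, Tendsto (fun t : ℝ => Real.exp (-(l * t)) * NormedSpace.exp (t • B) x y) atTop
      (𝓝 (W x y)) := by
    intro x y
    have e : (fun t : ℝ => Real.exp (-(l * t)) * NormedSpace.exp (t • B) x y) =
        fun t => ∑ i, U x i * U y i * Real.exp ((hB.eigenvalues i - l) * t) := by
      funext t
      rw [hB.exp_smul_apply, Finset.mul_sum]
      refine Finset.sum_congr rfl fun i _ => ?_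
      rw [show (hB.eigenvalues i - l) * t = -(l * t) + t * hB.eigenvalues i by ring, Real.exp_add]
      ring
    rw [e]
    refine tendsto_finsetSum _ fun i _ => ?_
    split_ifs with h
    · simp [h]
    · have hlt : hB.eigenvalues i - l < 0 := sub_neg.2 (lt_of_le_of_ne (hi₀ i) h)
      have := (Real.tendsto_exp_atBot.comp (tendsto_id.const_mul_atTop_of_neg hlt)).const_mul
        (U x i * U y i)
      simpa using this
  have hUU' : star U * U = 1 := Unitary.coe_star_mul_self hB.eigenvectorUnitary
  obtain ⟨y₀, hy₀⟩ : ∃ y, U y i₀ ≠ 0 := by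
    by_contra hcon
    push Not at hcon
    have := congrFun (congrFun hUU' i₀) i₀
    rw [Matrix.mul_apply] at this
    simp [hcon] at this
  refine ⟨l, fun x => W x y₀, fun x => ?_, ⟨y₀, ?_⟩, fun x => ?_, fun x y => ⟨_, hlim x y⟩⟩
  · refine ge_of_tendsto (hlim x y₀) ?_
    filter_upwards [eventually_ge_atTop 0] with t ht
    exact mul_nonneg (Real.exp_pos _).le (hpos t ht _ _)
  · refine ne_of_gt (lt_of_lt_of_le (mul_self_pos.2 hy₀) ?_)
    have := Finset.single_le_sum (f := fun i => if hB.eigenvalues i = l then U y₀ i * U y₀ i else 0)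
      (fun i _ => by split_ifs <;> [exact mul_self_nonneg _; exact le_rfl]) (Finset.mem_univ i₀)
    rwa [if_pos hl.symm] at this
  · simp only [W, Finset.mul_sum]
    rw [Finset.sum_comm]
    refine Finset.sum_congr rfl fun i _ => ?_
    have hev := congrFun (hB.mulVec_eigenvectorBasis i) x
    simp only [Matrix.mulVec, dotProduct, Pi.smul_apply, smul_eq_mul] at hev
    split_ifs with h
    · have hev' : ∑ y, B x y * U y i = l * U x i := by
        simpa only [hU, hB.eigenvectorUnitary_apply, h] using hev
      rw [← mul_assoc, ← hev', Finset.sum_mul]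
      exact Finset.sum_congr rfl fun y _ => by ring
    · simp

/-- The Perron theorem for reversible matrices. -/
theorem exists_perron_of_reversible [Nonempty T] {M : Matrix T T ℝ} {π : T → ℝ} (hπ : ∀ x, 0 < π x)
    (hrev : ∀ x y, π x * M x y = π y * M y x)
    (hpos : ∀ t : ℝ, 0 ≤ t → ∀ x y, 0 ≤ NormedSpace.exp (t • M) x y) :
    ∃ (l : ℝ) (φ : T → ℝ), (∀ x, 0 ≤ φ x) ∧ (∃ x, φ x ≠ 0) ∧ (∀ x, ∑ y, M x y * φ y = l * φ x) ∧
      ∀ x y, ∃ c, Tendsto (fun t : ℝ => Real.exp (-(l * t)) * NormedSpace.exp (t • M) x y) atTop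
        (𝓝 c) := by
  have hr : ∀ x, 0 < √(π x) := fun x => Real.sqrt_pos.2 (hπ x)
  have hsq : ∀ x, √(π x) * √(π x) = π x := fun x => Real.mul_self_sqrt (hπ x).le
  -- Conjugation by the diagonal matrix of √π turns detailed balance into symmetry, and keeps the
  -- signs of all entries of the semigroup.
  let V : (Matrix T T ℝ)ˣ :=
    ⟨Matrix.diagonal fun x => √(π x), Matrix.diagonal fun x => (√(π x))⁻¹, by
      rw [Matrix.diagonal_mul_diagonal, ← Matrix.diagonal_one]
      congr 1; funext x; exact mul_inv_cancel₀ (hr x).ne', by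
      rw [Matrix.diagonal_mul_diagonal, ← Matrix.diagonal_one]
      congr 1; funext x; exact inv_mul_cancel₀ (hr x).ne'⟩
  have happ : ∀ (N : Matrix T T ℝ) x y, ((V : Matrix T T ℝ) * N *
      ((V⁻¹ : (Matrix T T ℝ)ˣ) : Matrix T T ℝ)) x y = √(π x) * N x y * (√(π y))⁻¹ := by
    intro N x y
    change (Matrix.diagonal _ * N * Matrix.diagonal _ : Matrix T T ℝ) x y = _
    rw [Matrix.mul_diagonal, Matrix.diagonal_mul]
  set B : Matrix T T ℝ := (V : Matrix T T ℝ) * M * ((V⁻¹ : (Matrix T T ℝ)ˣ) : Matrix T T ℝ) with hBdef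
  have hB : B.IsHermitian := by
    ext x y
    rw [Matrix.conjTranspose_apply, star_trivial, hBdef, happ, happ, ← div_eq_mul_inv,
      ← div_eq_mul_inv, div_eq_div_iff (hr x).ne' (hr y).ne']
    have := hrev x y
    rw [← hsq, ← hsq y] at this
    linarith
  have hexp : ∀ (t : ℝ) x y, NormedSpace.exp (t • B) x y =
      √(π x) * NormedSpace.exp (t • M) x y * (√(π y))⁻¹ := by
    intro t x y
    rw [← happ, ← Matrix.exp_units_conj, hBdef, Matrix.mul_smul, Matrix.smul_mul]
  obtain ⟨l, ψ, h1, ⟨z, hz⟩, h3, h4⟩ := hB.exists_perron fun t ht x y => by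
    rw [hexp]
    exact mul_nonneg (mul_nonneg (hr x).le (hpos t ht x y)) (inv_nonneg.2 (hr y).le)
  refine ⟨l, fun x => (√(π x))⁻¹ * ψ x, fun x => mul_nonneg (inv_nonneg.2 (hr x).le) (h1 x),
    ⟨z, mul_ne_zero (inv_ne_zero (hr z).ne') hz⟩, fun x => ?_, fun x y => ?_⟩
  · have h := h3 x
    simp only [hBdef, happ] at h
    rw [mul_left_comm, ← h, Finset.mul_sum]
    refine Finset.sum_congr rfl fun y _ => ?_
    have := (hr x).ne'
    field_simp
  · obtain ⟨c, hc⟩ := h4 x y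
    refine ⟨(√(π x))⁻¹ * √(π y) * c, (hc.const_mul ((√(π x))⁻¹ * √(π y))).congr fun t => ?_⟩
    rw [hexp]
    have := (hr x).ne'
    have := (hr y).ne'
    field_simp

end Perron

/-! ### Positivity -/

theorem hasDerivAt_exp_mul {u : ℝ → ℝ} {u' q s : ℝ} (h : HasDerivAt u u' s) :
    HasDerivAt (fun r => Real.exp (q * r) * u r) (Real.exp (q * s) * (q * u s + u')) s := by
  have h1 : HasDerivAt (fun r => Real.exp (q * r)) (Real.exp (q * s) * q) s := by
    have := ((hasDerivAt_id' s).const_mul q).exp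
    rwa [mul_one] at this
  exact (h1.fun_mul h).congr_deriv (by ring)

/-- With the integrating factor e^{qs} the function becomes nondecreasing. In the applications q =
-Q x x is the total jump rate from x, so that only off-diagonal terms remain in q u + u'. -/
theorem pos_of_deriv_ge {u u' : ℝ → ℝ} {q : ℝ} (hd : ∀ s, 0 ≤ s → HasDerivAt u (u' s) s)
    (h : ∀ s, 0 ≤ s → 0 ≤ q * u s + u' s) (h0 : 0 < u 0) {t : ℝ} (ht : 0 ≤ t) : 0 < u t := by
  have hmono : MonotoneOn (fun r => Real.exp (q * r) * u r) (Set.Ici 0) := by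
    refine monotoneOn_of_hasDerivWithinAt_nonneg (convex_Ici 0)
      (fun s hs => (hasDerivAt_exp_mul (hd s hs)).continuousAt.continuousWithinAt)
      (fun s hs => (hasDerivAt_exp_mul (q := q) (hd s ?_)).hasDerivWithinAt) fun s hs => ?_
    · exact interior_subset hs
    · exact mul_nonneg (Real.exp_pos _).le (h s (interior_subset hs))
  have := hmono (Set.mem_Ici.2 le_rfl) (Set.mem_Ici.2 ht) ht
  simp only [mul_zero, Real.exp_zero, one_mul] at this
  exact pos_of_mul_pos_right (h0.trans_le this) (Real.exp_pos _).le

theorem pos_of_deriv_gt {u u' : ℝ → ℝ} {q : ℝ} (hd : ∀ s, 0 ≤ s → HasDerivAt u (u' s) s)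
    (h : ∀ s, 0 < s → 0 < q * u s + u' s) (h0 : 0 ≤ u 0) {t : ℝ} (ht : 0 < t) : 0 < u t := by
  have hmono : StrictMonoOn (fun r => Real.exp (q * r) * u r) (Set.Ici 0) := by
    refine strictMonoOn_of_hasDerivWithinAt_pos (convex_Ici 0)
      (fun s hs => (hasDerivAt_exp_mul (hd s hs)).continuousAt.continuousWithinAt)
      (fun s hs => (hasDerivAt_exp_mul (q := q) (hd s ?_)).hasDerivWithinAt) fun s hs => ?_
    · exact interior_subset hs
    · rw [interior_Ici] at hs
      exact mul_pos (Real.exp_pos _) (h s hs)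
  have := hmono (Set.mem_Ici.2 le_rfl) (Set.mem_Ici.2 ht.le) ht
  simp only [mul_zero, Real.exp_zero, one_mul] at this
  exact pos_of_mul_pos_right (h0.trans_lt this) (Real.exp_pos _).le

section Positivity

variable {S : Type} [Fintype S] [DecidableEq S] {Q : Matrix S S ℝ}

theorem CTMC.survival_pos (C : CTMC Q) (hQ : ∀ x y, x ≠ y → 0 ≤ Q x y) {K : Set S} {x : S}
    (hx : x ∉ K) {t : ℝ} (ht : 0 ≤ t) : 0 < survival Q K t x := by
  refine pos_of_deriv_ge (q := -Q x x) (fun s _ => hasDerivAt_survival hx s) (fun s hs => ?_)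
    (by rw [survival_zero hx]; exact one_pos) ht
  rw [← Finset.add_sum_erase _ _ (Finset.mem_univ x)]
  have : 0 ≤ ∑ y ∈ Finset.univ.erase x, Q x y * survival Q K s y :=
    Finset.sum_nonneg fun y hy =>
      mul_nonneg (hQ x y (Finset.ne_of_mem_erase hy).symm) (C.survival_nonneg K hs y)
  linarith

theorem CTMC.exp_rates_self_pos (C : CTMC Q) (hQ : ∀ x y, x ≠ y → 0 ≤ Q x y) (x : S) {t : ℝ}
    (ht : 0 ≤ t) : 0 < NormedSpace.exp (t • Q) x x := by
  refine pos_of_deriv_ge (q := -Q x x) (fun s _ => hasDerivAt_matrix_exp_apply Q s x x)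
    (fun s hs => ?_) (by simp) ht
  rw [Matrix.mul_apply, ← Finset.add_sum_erase _ _ (Finset.mem_univ x)]
  have : 0 ≤ ∑ y ∈ Finset.univ.erase x, Q x y * NormedSpace.exp (s • Q) y x :=
    Finset.sum_nonneg fun y hy =>
      mul_nonneg (hQ x y (Finset.ne_of_mem_erase hy).symm) (C.exp_rates_nonneg hs y x)
  linarith

/-- Positivity of a transition probability propagates backwards along one possible jump. -/
theorem CTMC.exp_rates_pos_of_step (C : CTMC Q) (hQ : ∀ x y, x ≠ y → 0 ≤ Q x y) {x y z : S}
    (hxy : x ≠ y) (hpos : 0 < Q x y) (hy : ∀ t : ℝ, 0 < t → 0 < NormedSpace.exp (t • Q) y z) {t : ℝ}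
    (ht : 0 < t) : 0 < NormedSpace.exp (t • Q) x z := by
  refine pos_of_deriv_gt (q := -Q x x) (fun s _ => hasDerivAt_matrix_exp_apply Q s x z)
    (fun s hs => ?_) (C.exp_rates_nonneg le_rfl x z) ht
  rw [Matrix.mul_apply, ← Finset.add_sum_erase _ _ (Finset.mem_univ x)]
  have : Q x y * NormedSpace.exp (s • Q) y z ≤
      ∑ y ∈ Finset.univ.erase x, Q x y * NormedSpace.exp (s • Q) y z :=
    Finset.single_le_sum (f := fun y => Q x y * NormedSpace.exp (s • Q) y z)
      (fun w hw => mul_nonneg (hQ x w (Finset.ne_of_mem_erase hw).symm)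
        (C.exp_rates_nonneg hs.le w z)) (Finset.mem_erase.2 ⟨hxy.symm, Finset.mem_univ y⟩)
  have h2 := mul_pos hpos (hy s hs)
  linarith

end Positivity

/-! ### The killed kernel and quasi-stationarity -/

open scoped Classical in
/-- The transition kernel of the chain killed on `K`, extended by zero. -/
def killedKernel {S : Type} [Fintype S] [DecidableEq S] (Q : Matrix S S ℝ) (K : Set S) (t : ℝ)
    (x y : S) : ℝ :=
  if h : x ∉ K ∧ y ∉ K then NormedSpace.exp (t • killedRates Q K) ⟨x, h.1⟩ ⟨y, h.2⟩ else 0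

theorem condOn_nonneg {S : Type} [Fintype S] {π : S → ℝ} (hπ : ∀ x, 0 < π x) (A : Set S) (x : S) : 0 ≤ condOn π A x := by
  rw [condOn]
  split_ifs
  · exact div_nonneg (hπ x).le (Finset.sum_nonneg fun y _ => by
      split_ifs; exacts [(hπ y).le, le_rfl])
  · exact le_rfl

theorem sum_condOn {S : Type} [Fintype S] {π : S → ℝ} (hπ : ∀ x, 0 < π x) {A : Set S} (hA : A.Nonempty) :
    ∑ x, condOn π A x = 1 := by
  classical
  obtain ⟨a, ha⟩ := hA
  have hpos : 0 < ∑ y, (if y ∈ A then π y else 0) := by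
    refine Finset.sum_pos' (fun y _ => ?_) ⟨a, Finset.mem_univ a, by simp [ha, hπ a]⟩
    split_ifs; exacts [(hπ y).le, le_rfl]
  have : ∀ x, condOn π A x = (if x ∈ A then π x else 0) / ∑ y, (if y ∈ A then π y else 0) := by
    intro x
    rw [condOn]
    split_ifs
    · congr!
    · simp
  simp only [this, ← Finset.sum_div]
  exact div_self hpos.ne'

section Killed

variable {S : Type} [Fintype S] [DecidableEq S] {Q : Matrix S S ℝ} {K : Set S}

theorem sum_killedKernel_mul {x : S} (hx : x ∉ K) (t : ℝ) (f : S → ℝ) :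
    ∑ y, killedKernel Q K t x y * f y =
      letI := Classical.decPred (· ∈ K)
      ∑ y : {y // y ∉ K}, NormedSpace.exp (t • killedRates Q K) ⟨x, hx⟩ y * f y := by
  classical
  have e : ∀ y : {y // y ∉ K}, NormedSpace.exp (t • killedRates Q K) ⟨x, hx⟩ y =
      killedKernel Q K t x y := fun y => by rw [killedKernel, dif_pos ⟨hx, y.2⟩]
  simp only [e]
  refine Eq.trans ?_ (Finset.sum_subtype (Finset.univ.filter fun y => y ∉ K) (by simp)
    fun y => killedKernel Q K t x y * f y)
  symm
  refine Finset.sum_filter_of_ne fun y _ hy hK => hy ?_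
  rw [killedKernel, dif_neg (fun h => h.2 hK), zero_mul]

theorem survival_eq_sum_killedKernel {x : S} (hx : x ∉ K) (t : ℝ) :
    survival Q K t x = ∑ y, killedKernel Q K t x y := by
  have := sum_killedKernel_mul (Q := Q) hx t fun _ => 1
  simp only [mul_one] at this
  rw [this, survival, dif_pos hx]

theorem survival_add {x : S} (hx : x ∉ K) (t s : ℝ) :
    survival Q K (t + s) x = ∑ y, killedKernel Q K t x y * survival Q K s y := by
  classical
  rw [sum_killedKernel_mul hx, survival, dif_pos hx, add_smul,
    Matrix.exp_add_of_commute _ _ ((Commute.refl (killedRates Q K)).smul_left t |>.smul_right s)]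
  simp only [Matrix.mul_apply]
  rw [Finset.sum_comm]
  convert rfl using 2 with y _
  rw [survival, dif_pos y.2, Finset.mul_sum]

theorem CTMC.measureReal_X_eq_lt_hit_eq_killedKernel (C : CTMC Q) {x : S} (hx : x ∉ K) (y : S)
    (t : ℝ≥0) : (C.P x).real {ω | C.X t ω = y ∧ (t : ℝ≥0∞) < C.hit K ω} = killedKernel Q K t x y := by
  by_cases hy : y ∉ K
  · rw [killedKernel, dif_pos ⟨hx, hy⟩, ← C.measureReal_X_eq_lt_hit]
  · rw [killedKernel, dif_neg (fun h => hy h.2)]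
    have : {ω | C.X t ω = y ∧ (t : ℝ≥0∞) < C.hit K ω} = ∅ := by
      refine Set.eq_empty_of_forall_notMem ?_
      rintro ω ⟨h1, h2⟩
      exact hy (h1 ▸ (C.lt_hit_iff K t ω).1 h2 t le_rfl)
    rw [this, measureReal_empty]

theorem CTMC.killedKernel_nonneg (C : CTMC Q) {t : ℝ} (ht : 0 ≤ t) (x y : S) :
    0 ≤ killedKernel Q K t x y := by
  rw [killedKernel]
  split_ifs with h
  · exact C.exp_killedRates_nonneg K ht _ _
  · exact le_rfl

/-- Both sides solve the backward equation and vanish on K, and at time 0 the left one is the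
smaller because φ ≤ 1. -/
theorem exp_mul_eigenfunction_le_survival (hQ : ∀ x y, x ≠ y → 0 ≤ Q x y) (hrow : ∀ x, ∑ y, Q x y = 0)
    {φ : S → ℝ} {l : ℝ} (hφ : ∀ x, φ x ≤ 1) (hφK : ∀ x ∈ K, φ x = 0)
    (heig : ∀ x ∉ K, ∑ y, Q x y * φ y = -(l * φ x)) {t : ℝ} (ht : 0 ≤ t) (x : S) :
    Real.exp (-(l * t)) * φ x ≤ survival Q K t x := by
  have h := nonpos_of_deriv_le_rates hQ hrow (D := Kᶜ)
    (u := fun t x => Real.exp (-l * t) * φ x - survival Q K t x)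
    (u' := fun t x => Real.exp (-l * t) * (-l * φ x + 0) - ∑ y, Q x y * survival Q K t y)
    (fun x hx s _ => (hasDerivAt_exp_mul (hasDerivAt_const s (φ x))).fun_sub
      (hasDerivAt_survival hx s)) ?_ ?_ ?_ ht x
  · simp only [neg_mul] at h
    linarith
  · intro x hx s _
    simp only [mul_sub, Finset.sum_sub_distrib, mul_left_comm (Q x _), ← Finset.mul_sum, heig x hx]
    exact le_of_eq (by ring)
  · intro x hx
    have hx' : x ∉ K := hx
    simp [survival_zero hx', hφ x]
  · intro x hx s _
    have hx' : x ∈ K := by simpa using hx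
    simp [survival_of_mem hx', hφK x hx']

/-- By reversibility Q is symmetric for the π-weighted pairing, so in the time derivative it can be
moved from the survival function to φ, where it acts as -l. The pairing therefore decays exactly
exponentially. -/
theorem sum_eigenfunction_mul_survival {π φ : S → ℝ} {l : ℝ} (hrev : ∀ x y, π x * Q x y = π y * Q y x)
    (hφK : ∀ x ∈ K, φ x = 0) (heig : ∀ x ∉ K, ∑ y, Q x y * φ y = -(l * φ x)) (t : ℝ) :
    ∑ x, π x * φ x * survival Q K t x = Real.exp (-(l * t)) * ∑ x, π x * φ x := by
  let F : ℝ → ℝ := fun s => Real.exp (l * s) * ∑ x, π x * φ x * survival Q K s x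
  have hterm : ∀ x s, HasDerivAt (fun r => π x * φ x * survival Q K r x)
      (π x * φ x * ∑ y, Q x y * survival Q K s y) s := by
    intro x s
    by_cases hx : x ∈ K
    · simp only [hφK x hx, mul_zero, zero_mul]
      exact hasDerivAt_const s 0
    · exact (hasDerivAt_survival hx s).const_mul _
  have hsym : ∀ s, ∑ x, π x * φ x * ∑ y, Q x y * survival Q K s y =
      -(l * ∑ x, π x * φ x * survival Q K s x) := by
    intro s
    simp only [Finset.mul_sum]
    rw [Finset.sum_comm, ← Finset.sum_neg_distrib]
    refine Finset.sum_congr rfl fun y _ => ?_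
    have e : ∑ x, π x * φ x * (Q x y * survival Q K s y) =
        π y * survival Q K s y * ∑ x, Q y x * φ x := by
      rw [Finset.mul_sum]
      refine Finset.sum_congr rfl fun x _ => ?_
      linear_combination φ x * survival Q K s y * hrev x y
    rw [e]
    by_cases hy : y ∈ K
    · simp [survival_of_mem hy]
    · rw [heig y hy]; ring
  have hF : ∀ s, HasDerivAt F 0 s := by
    intro s
    have := hasDerivAt_exp_mul (q := l) (HasDerivAt.fun_sum (u := Finset.univ) fun x _ => hterm x s)
    refine this.congr_deriv ?_
    rw [hsym]; ring
  have hconst : F t = F 0 :=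
    is_const_of_deriv_eq_zero (fun s => (hF s).differentiableAt) (fun s => (hF s).deriv) t 0
  have h0 : F 0 = ∑ x, π x * φ x := by
    simp only [F, mul_zero, Real.exp_zero, one_mul]
    refine Finset.sum_congr rfl fun x _ => ?_
    by_cases hx : x ∈ K
    · simp [hφK x hx]
    · rw [survival_zero hx, mul_one]
  rw [← h0, ← hconst, Real.exp_neg]
  simp only [F]
  rw [inv_mul_cancel_left₀ (Real.exp_pos _).ne']

/-- The scaled killed kernel converges; dividing by the limit of the scaled survival gives the
conditioned limit law from each point, and μ is the average of these. That division needs φ > 0 off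
K, which Perron alone does not give and which is therefore left as a premise of the last clause. -/
theorem CTMC.exists_quasiStationary (C : CTMC Q) (hQ : ∀ x y, x ≠ y → 0 ≤ Q x y)
    (hrow : ∀ x, ∑ y, Q x y = 0) {π : S → ℝ} (hπ : ∀ x, 0 < π x)
    (hrev : ∀ x y, π x * Q x y = π y * Q y x) (hK : Kᶜ.Nonempty) :
    ∃ (l : ℝ) (φ : S → ℝ), (∀ x, 0 ≤ φ x) ∧ (∀ x ∈ K, φ x = 0) ∧ (∃ x, φ x ≠ 0) ∧
      (∀ x ∉ K, ∑ y, Q x y * φ y = -(l * φ x)) ∧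
      ((∀ x ∉ K, 0 < φ x) → ∃ μ : S → ℝ, C.IsQuasiStationary π K μ ∧ (∀ x, 0 ≤ μ x) ∧
        ∀ t, 0 ≤ t → ∑ x, μ x * survival Q K t x = Real.exp (-(l * t))) := by
  classical
  obtain ⟨a, ha⟩ := hK
  have : Nonempty {x // x ∉ K} := ⟨⟨a, ha⟩⟩
  obtain ⟨l, ψ, h1, ⟨z, hz⟩, h3, h4⟩ := exists_perron_of_reversible (M := killedRates Q K)
    (π := fun x => π x) (fun x => hπ x) (fun x y => hrev x y)
    (fun t ht x y => C.exp_killedRates_nonneg K ht x y)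
  let φ : S → ℝ := fun x => if h : x ∉ K then ψ ⟨x, h⟩ else 0
  have hφ0 : ∀ x, 0 ≤ φ x := by
    intro x
    simp only [φ]
    split_ifs
    · exact le_rfl
    · exact h1 _
  have hφK : ∀ x ∈ K, φ x = 0 := fun x hx => dif_neg (not_not.2 hx)
  have hφz : ∀ x : {x // x ∉ K}, φ x = ψ x := fun x => dif_pos x.2
  have heig : ∀ x ∉ K, ∑ y, Q x y * φ y = -(-l * φ x) := by
    intro x hx
    rw [sum_mul_eq_sum_killedRates hφK ⟨x, hx⟩]
    simp only [hφz]
    rw [h3, neg_mul, neg_neg, ← hφz]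
  -- Inside the proof l is the top eigenvalue of the killed matrix; the decay rate returned is its
  -- negative.
  refine ⟨-l, φ, hφ0, hφK, ⟨z, by rwa [hφz]⟩, heig, fun hpos => ?_⟩
  have hker : ∀ x ∉ K, ∀ y, ∃ c, Tendsto (fun t : ℝ => Real.exp (-(l * t)) * killedKernel Q K t x y)
      atTop (𝓝 c) := by
    intro x hx y
    by_cases hy : y ∉ K
    · simp only [killedKernel, dif_pos (And.intro hx hy)]
      exact h4 _ _
    · refine ⟨0, ?_⟩
      simp only [killedKernel, dif_neg (show ¬ (x ∉ K ∧ y ∉ K) from fun h => hy h.2), mul_zero]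
      exact tendsto_const_nhds
  choose! c hc using hker
  have hc0 : ∀ x ∉ K, ∀ y, 0 ≤ c x y := by
    intro x hx y
    refine ge_of_tendsto (hc x hx y) ?_
    filter_upwards [eventually_ge_atTop 0] with t ht
    exact mul_nonneg (Real.exp_pos _).le (C.killedKernel_nonneg ht x y)
  have hV : ∀ x ∉ K, Tendsto (fun t : ℝ => Real.exp (-(l * t)) * survival Q K t x) atTop
      (𝓝 (∑ y, c x y)) := by
    intro x hx
    simp only [survival_eq_sum_killedKernel hx, Finset.mul_sum]
    exact tendsto_finsetSum _ fun y _ => hc x hx y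
  have : Nonempty S := ⟨a⟩
  obtain ⟨m, hm⟩ := Finite.exists_max φ
  have hmpos : 0 < φ m := (hpos a ha).trans_le (hm a)
  have hVpos : ∀ x ∉ K, 0 < ∑ y, c x y := by
    intro x hx
    refine lt_of_lt_of_le (div_pos (hpos x hx) hmpos) (ge_of_tendsto (hV x hx) ?_)
    filter_upwards [eventually_ge_atTop 0] with t ht
    have := exp_mul_eigenfunction_le_survival (K := K) hQ hrow (φ := fun x => φ x / φ m) (l := -l)
      (fun x => (div_le_one hmpos).2 (hm x)) (fun x hx => by simp [hφK x hx])
      (fun x hx => by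
        simp only [← mul_div_assoc, ← Finset.sum_div, heig x hx]
        ring) ht x
    have e : Real.exp (-(l * t)) * Real.exp (-(-l * t)) = 1 := by
      rw [← Real.exp_add]; simp
    calc φ x / φ m = Real.exp (-(l * t)) * (Real.exp (-(-l * t)) * (φ x / φ m)) := by
          rw [← mul_assoc, e, one_mul]
      _ ≤ _ := mul_le_mul_of_nonneg_left this (Real.exp_pos _).le
  let μ : S → ℝ := fun y => ∑ x, condOn π Kᶜ x * (c x y / ∑ z, c x z)
  have hcond0 : ∀ x ∈ K, condOn π Kᶜ x = 0 := fun x hx => if_neg (by simpa using hx)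
  refine ⟨μ, ?_, ?_, ?_⟩
  · intro y
    refine tendsto_finsetSum _ fun x _ => ?_
    by_cases hx : x ∈ K
    · simp only [hcond0 x hx, zero_mul]
      exact tendsto_const_nhds
    refine Tendsto.const_mul _ ?_
    have hdiv := ((hc x hx y).div (hV x hx) (hVpos x hx).ne').comp
      (NNReal.tendsto_coe_atTop.2 tendsto_id)
    refine hdiv.congr fun t => ?_
    simp only [Function.comp, id, Pi.div_apply, condEvol]
    rw [C.measureReal_X_eq_lt_hit_eq_killedKernel hx, C.measureReal_lt_hit,
      mul_div_mul_left _ _ (Real.exp_pos _).ne']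
  · intro y
    refine Finset.sum_nonneg fun x _ => ?_
    by_cases hx : x ∈ K
    · simp [hcond0 x hx]
    · exact mul_nonneg (condOn_nonneg hπ _ _) (div_nonneg (hc0 x hx y) (hVpos x hx).le)
  · intro s hs
    -- The semigroup property at time t + s, scaled and passed to the limit in t: running for time s
    -- more costs exactly the decay factor. Hence the exit law from μ is exponential.
    have hshift : ∀ x ∉ K, ∑ y, c x y * survival Q K s y = Real.exp (-(-l * s)) * ∑ y, c x y := by
      intro x hx
      have t1 : Tendsto (fun t : ℝ => Real.exp (-(l * t)) * survival Q K (t + s) x) atTop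
          (𝓝 (∑ y, c x y * survival Q K s y)) := by
        simp only [survival_add hx, Finset.mul_sum, ← mul_assoc]
        exact tendsto_finsetSum _ fun y _ => (hc x hx y).mul_const _
      have t2 := ((hV x hx).comp (tendsto_atTop_add_const_right atTop s tendsto_id)).const_mul
        (Real.exp (-(-l * s)))
      refine tendsto_nhds_unique t1 (t2.congr fun t => ?_)
      simp only [Function.comp, id]
      rw [← mul_assoc, ← Real.exp_add]
      congr 2
      ring
    simp only [μ, Finset.sum_mul]
    rw [Finset.sum_comm]
    have e : ∀ x, ∑ y, condOn π Kᶜ x * (c x y / ∑ z, c x z) * survival Q K s y =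
        condOn π Kᶜ x * Real.exp (-(-l * s)) := by
      intro x
      by_cases hx : x ∈ K
      · simp [hcond0 x hx]
      · have h := hshift x hx
        have hne := (hVpos x hx).ne'
        calc _ = condOn π Kᶜ x * ((∑ y, c x y * survival Q K s y) / ∑ z, c x z) := by
              rw [Finset.sum_div, Finset.mul_sum]
              exact Finset.sum_congr rfl fun y _ => by ring
          _ = _ := by rw [h]; field_simp
    simp only [e, ← Finset.sum_mul]
    rw [sum_condOn hπ ⟨a, ha⟩, one_mul]

end Killed

/-! ### Survival bounds from supersolutions -/

section Comparison

variable {S : Type} [Fintype S] [DecidableEq S] {Q : Matrix S S ℝ} {K : Set S}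

/-- Markov's inequality t P(τ > t) ≤ E τ ≤ f without expectations: t u has derivative at most 1 +
Q(t u) off K, while f satisfies 0 ≥ 1 + Q f there. -/
theorem CTMC.mul_survival_le (C : CTMC Q) (hQ : ∀ x y, x ≠ y → 0 ≤ Q x y)
    (hrow : ∀ x, ∑ y, Q x y = 0) {f : S → ℝ} (hf : ∀ x, 0 ≤ f x)
    (hfQ : ∀ x ∉ K, ∑ y, Q x y * f y ≤ -1) {t : ℝ} (ht : 0 ≤ t) (x : S) :
    t * survival Q K t x ≤ f x := by
  have h := nonpos_of_deriv_le_rates hQ hrow (D := Kᶜ)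
    (u := fun t x => t * survival Q K t x - f x)
    (u' := fun t x => (1 * survival Q K t x + t * ∑ y, Q x y * survival Q K t y) - 0)
    (fun x hx s _ => ((hasDerivAt_id' s).fun_mul (hasDerivAt_survival hx s)).fun_sub
      (hasDerivAt_const s (f x))) ?_ ?_ ?_ ht x
  · linarith
  · intro x hx s hs
    simp only [mul_sub, Finset.sum_sub_distrib, mul_left_comm (Q x _), ← Finset.mul_sum]
    have h1 := C.survival_le_one K hs x
    have h2 := hfQ x hx
    linarith
  · intro x _
    simp [hf x]
  · intro x hx s _
    have hx' : x ∈ K := by simpa using hx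
    simp [survival_of_mem hx', hf x]

/-- To survive until t the chain either visits o before K, which has probability at most φ(x) as φ
is superharmonic with φ(o) = 1, or avoids both until t, which has probability at most f(x)/t. This
turns survival from a point into a lower bound for φ there. -/
theorem CTMC.mul_survival_le_eigenfunction (C : CTMC Q) (hQ : ∀ x y, x ≠ y → 0 ≤ Q x y)
    (hrow : ∀ x, ∑ y, Q x y = 0) {o : S} {f φ : S → ℝ} {l : ℝ} (hf : ∀ x, 0 ≤ f x)
    (hfQ : ∀ x ∉ insert o K, ∑ y, Q x y * f y ≤ -1) (hl : 0 ≤ l) (hφ : ∀ x, 0 ≤ φ x)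
    (hφo : φ o = 1) (heig : ∀ x ∉ K, ∑ y, Q x y * φ y = -(l * φ x))
    {t : ℝ} (ht : 0 ≤ t) (x : S) :
    t * survival Q K t x ≤ t * φ x + f x := by
  have hK : ∀ x ∉ insert o K, x ∉ K := fun x hx h => hx (Set.mem_insert_of_mem o h)
  have h := nonpos_of_deriv_le_rates hQ hrow (D := (insert o K)ᶜ)
    (u := fun t x => t * survival Q K t x - (t * φ x + f x))
    (u' := fun t x => (1 * survival Q K t x + t * ∑ y, Q x y * survival Q K t y) - 1 * φ x)
    (fun x hx s _ => ((hasDerivAt_id' s).fun_mul (hasDerivAt_survival (hK x hx) s)).fun_sub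
      (((hasDerivAt_id' s).mul_const (φ x)).add_const (f x))) ?_ ?_ ?_ ht x
  · linarith
  · intro x hx s hs
    simp only [mul_sub, mul_add, Finset.sum_sub_distrib, Finset.sum_add_distrib,
      mul_left_comm (Q x _), ← Finset.mul_sum]
    rw [heig x (hK x hx)]
    have h1 := C.survival_le_one K hs x
    have h2 := hfQ x hx
    have h3 := hφ x
    have h4 : 0 ≤ s * (l * φ x) := by positivity
    linarith
  · intro x _
    simp [hf x]
  · intro x hx s hs
    have h1 : s * survival Q K s x ≤ s * φ x := by
      refine mul_le_mul_of_nonneg_left ?_ hs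
      have hx' : x = o ∨ x ∈ K := Set.mem_insert_iff.1 (Set.notMem_compl_iff.1 hx)
      rcases hx' with rfl | hx'
      · rw [hφo]; exact C.survival_le_one K hs x
      · rw [survival_of_mem hx']; exact hφ x
    have := hf x
    linarith

end Comparison

/-! ### Total variation through a coupling -/

section Coupling

variable {S : Type} [Fintype S] [DecidableEq S] {Q : Matrix S S ℝ}

theorem CTMC.abs_sum_exp_mul_le (C : CTMC Q) {g : S → ℝ} (hg : ∀ x, |g x| ≤ 1) {t : ℝ} (ht : 0 ≤ t)
    (x : S) : |∑ z, NormedSpace.exp (t • Q) x z * g z| ≤ 1 := by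
  rw [← C.sum_exp_rates ht x]
  refine (Finset.abs_sum_le_sum_abs _ _).trans (Finset.sum_le_sum fun z _ => ?_)
  rw [abs_mul, abs_of_nonneg (C.exp_rates_nonneg ht x z)]
  exact mul_le_of_le_one_right (C.exp_rates_nonneg ht x z) (hg z)

theorem hasDerivAt_sum_exp_mul (g : S → ℝ) (x : S) (t : ℝ) :
    HasDerivAt (fun s : ℝ => ∑ z, NormedSpace.exp (s • Q) x z * g z)
      (∑ y, Q x y * ∑ z, NormedSpace.exp (t • Q) y z * g z) t := by
  refine (HasDerivAt.fun_sum (u := Finset.univ) fun z _ =>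
    (hasDerivAt_matrix_exp_apply Q t x z).mul_const (g z)).congr_deriv ?_
  simp only [Matrix.mul_apply, Finset.sum_mul, Finset.mul_sum]
  rw [Finset.sum_comm]
  exact Finset.sum_congr rfl fun y _ => Finset.sum_congr rfl fun z _ => by ring

/-- Order preserving coupling of two copies of a skip-free chain: before the upper copy reaches the
bottom point `o` the two copies have met. -/
theorem CTMC.sum_exp_sub_le (C : CTMC Q) [LinearOrder S] (hQ : ∀ x y, x ≠ y → 0 ≤ Q x y)
    (hrow : ∀ x, ∑ y, Q x y = 0) (hup : ∀ a b a', a < b → Q a a' ≠ 0 → a' ≤ b)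
    (hdown : ∀ a b b', a < b → Q b b' ≠ 0 → a ≤ b') {o : S} (ho : ∀ x, o ≤ x) (K : Set S)
    {g : S → ℝ} (hg : ∀ x, |g x| ≤ 1) {t : ℝ} (ht : 0 ≤ t) {a b : S} (hab : a ≤ b) :
    ∑ z, NormedSpace.exp (t • Q) b z * g z - ∑ z, NormedSpace.exp (t • Q) a z * g z ≤
      2 * (1 - survival Q K t b + survival Q (insert o K) t b) := by
  set F : ℝ → S → ℝ := fun s x => ∑ z, NormedSpace.exp (s • Q) x z * g z with hF
  set Ψ : ℝ → S → ℝ := fun s x => 1 - survival Q K s x + survival Q (insert o K) s x with hΨ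
  have hΨ0 : ∀ s, 0 ≤ s → ∀ x, 0 ≤ Ψ s x := by
    intro s hs x
    have h1 := C.survival_le_one K hs x
    have h2 := C.survival_nonneg (insert o K) hs x
    simp only [hΨ]; linarith
  have hΨK : ∀ s, ∀ x ∈ K, Ψ s x = 1 := by
    intro s x hx
    simp [hΨ, survival_of_mem hx, survival_of_mem (Set.mem_insert_of_mem o hx)]
  have hF2 : ∀ s, 0 ≤ s → ∀ x y, F s x - F s y ≤ 2 := by
    intro s hs x y
    have h1 := abs_le.1 (C.abs_sum_exp_mul_le hg hs x)
    have h2 := abs_le.1 (C.abs_sum_exp_mul_le hg hs y)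
    simp only [hF]; linarith [h1.2, h2.1]
  change F t b - F t a ≤ 2 * Ψ t b
  rcases hab.eq_or_lt with rfl | hab
  · have := hΨ0 t ht a
    linarith
  by_cases hbK : b ∈ K
  · rw [hΨK t b hbK]
    linarith [hF2 t ht b a]
  classical
  -- The two coordinates move independently until they meet. Skip-freeness keeps the pair ordered
  -- after a single jump, and a < b already excludes b = o. Outside D the bound is trivial: on the
  -- diagonal F cancels, and for b in K one has Ψ = 1.
  let D : Finset (S × S) := Finset.univ.filter fun p => p.1 < p.2 ∧ p.2 ∉ K
  have hmem : ∀ p, p ∈ D ↔ p.1 < p.2 ∧ p.2 ∉ K := by simp [D]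
  have key := nonpos_of_deriv_nonpos_at_max D (u := fun s p => F s p.2 - F s p.1 - 2 * Ψ s p.2)
    (u' := fun s p => ∑ y, Q p.2 y * F s y - ∑ y, Q p.1 y * F s y -
      2 * (0 - ∑ y, Q p.2 y * survival Q K s y + ∑ y, Q p.2 y * survival Q (insert o K) s y))
    ?_ ?_ ?_ ht ((hmem (a, b)).2 ⟨hab, hbK⟩)
  · dsimp only at key
    linarith
  · intro p hp s _
    rw [hmem] at hp
    have hpo : p.2 ∉ insert o K := by
      rw [Set.mem_insert_iff, not_or]
      exact ⟨((ho p.1).trans_lt hp.1).ne', hp.2⟩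
    exact ((hasDerivAt_sum_exp_mul g p.2 s).fun_sub (hasDerivAt_sum_exp_mul g p.1 s)).fun_sub
      ((((hasDerivAt_const s (1 : ℝ)).fun_sub (hasDerivAt_survival hp.2 s)).fun_add
        (hasDerivAt_survival hpo s)).const_mul 2)
  · intro p hp
    rw [hmem] at hp
    have hpo : p.2 ∉ insert o K := by
      rw [Set.mem_insert_iff, not_or]
      exact ⟨((ho p.1).trans_lt hp.1).ne', hp.2⟩
    have : Ψ 0 p.2 = 1 := by simp [hΨ, survival_zero hp.2, survival_zero hpo]
    rw [this]
    linarith [hF2 0 le_rfl p.2 p.1]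
  · rintro s hs ⟨a, b⟩ hp hpos hmax
    rw [hmem] at hp
    obtain ⟨hab, hbK⟩ := hp
    dsimp only at hab hbK hpos hmax ⊢
    have e1 : ∑ y, Q b y * F s y -
        2 * (0 - ∑ y, Q b y * survival Q K s y + ∑ y, Q b y * survival Q (insert o K) s y) =
        ∑ y, Q b y * ((F s y - F s a - 2 * Ψ s y) - (F s b - F s a - 2 * Ψ s b)) := by
      have : ∀ y, Q b y * ((F s y - F s a - 2 * Ψ s y) - (F s b - F s a - 2 * Ψ s b)) =
          Q b y * F s y - 2 * (0 - Q b y * survival Q K s y + Q b y * survival Q (insert o K) s y) -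
            Q b y * (2 + F s b - 2 * Ψ s b) := by
        intro y; simp only [hΨ]; ring
      simp only [this, Finset.sum_sub_distrib, Finset.sum_add_distrib, ← Finset.mul_sum,
        ← Finset.sum_mul, hrow, Finset.sum_const_zero]
      ring
    have e2 : -∑ y, Q a y * F s y =
        ∑ y, Q a y * ((F s b - F s y - 2 * Ψ s b) - (F s b - F s a - 2 * Ψ s b)) := by
      have : ∀ y, Q a y * ((F s b - F s y - 2 * Ψ s b) - (F s b - F s a - 2 * Ψ s b)) =
          -(Q a y * F s y) + Q a y * F s a := by
        intro y; ring
      simp only [this, Finset.sum_add_distrib, Finset.sum_neg_distrib, ← Finset.sum_mul, hrow]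
      ring
    have h1 : ∑ y, Q b y * ((F s y - F s a - 2 * Ψ s y) - (F s b - F s a - 2 * Ψ s b)) ≤ 0 := by
      refine Finset.sum_nonpos fun y _ => ?_
      by_cases hy : b = y
      · simp [hy]
      by_cases hQy : Q b y = 0
      · simp [hQy]
      refine mul_nonpos_of_nonneg_of_nonpos (hQ b y hy) ?_
      rcases (hdown a b y hab hQy).eq_or_lt with rfl | hlt
      · linarith [hΨ0 s hs.le a]
      · by_cases hyK : y ∈ K
        · rw [hΨK s y hyK]
          linarith [hF2 s hs.le y a]
        · linarith [hmax (a, y) ((hmem _).2 ⟨hlt, hyK⟩)]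
    have h2 : ∑ y, Q a y * ((F s b - F s y - 2 * Ψ s b) - (F s b - F s a - 2 * Ψ s b)) ≤ 0 := by
      refine Finset.sum_nonpos fun y _ => ?_
      by_cases hy : a = y
      · simp [hy]
      by_cases hQy : Q a y = 0
      · simp [hQy]
      refine mul_nonpos_of_nonneg_of_nonpos (hQ a y hy) ?_
      rcases (hup a b y hab hQy).eq_or_lt with rfl | hlt
      · linarith [hΨ0 s hs.le y]
      · linarith [hmax (y, b) ((hmem _).2 ⟨hlt, hbK⟩)]
    linarith

theorem dTV_comm {S : Type} [Fintype S] (μ ν : S → ℝ) : dTV μ ν = dTV ν μ := by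
  simp only [dTV, abs_sub_comm]

/-- Testing against the sign of the difference of the two laws recovers their total variation; the
factor 2 cancels the 1/2 in `dTV`. -/
theorem CTMC.dTV_evol_le (C : CTMC Q) [LinearOrder S] (hQ : ∀ x y, x ≠ y → 0 ≤ Q x y)
    (hrow : ∀ x, ∑ y, Q x y = 0) (hup : ∀ a b a', a < b → Q a a' ≠ 0 → a' ≤ b)
    (hdown : ∀ a b b', a < b → Q b b' ≠ 0 → a ≤ b') {o : S} (ho : ∀ x, o ≤ x) (K : Set S)
    {t : ℝ} (ht : 0 ≤ t) {a b : S} (hab : a ≤ b) :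
    dTV (C.evol a t.toNNReal) (C.evol b t.toNNReal) ≤
      1 - survival Q K t b + survival Q (insert o K) t b := by
  let g : S → ℝ := fun z =>
    if NormedSpace.exp (t • Q) a z ≤ NormedSpace.exp (t • Q) b z then 1 else -1
  have hg : ∀ x, |g x| ≤ 1 := by
    intro x; simp only [g]; split_ifs <;> simp
  have h := C.sum_exp_sub_le hQ hrow hup hdown ho K hg ht hab
  rw [dTV_comm, dTV]
  simp only [C.evol_eq _ _ ht]
  have e : ∑ x, |NormedSpace.exp (t • Q) b x - NormedSpace.exp (t • Q) a x| =
      ∑ z, NormedSpace.exp (t • Q) b z * g z - ∑ z, NormedSpace.exp (t • Q) a z * g z := by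
    rw [← Finset.sum_sub_distrib]
    refine Finset.sum_congr rfl fun z _ => ?_
    simp only [g]
    split_ifs with hz
    · rw [abs_of_nonneg (by linarith)]; ring
    · rw [abs_of_neg (by linarith)]; ring
  rw [e]
  linarith

theorem dTV_lt_one {S : Type} [Fintype S] {μ ν : S → ℝ} (hμ : ∀ x, 0 ≤ μ x) (hν : ∀ x, 0 ≤ ν x)
    (hμ1 : ∑ x, μ x = 1) (hν1 : ∑ x, ν x = 1) {z : S} (hμz : 0 < μ z) (hνz : 0 < ν z) :
    dTV μ ν < 1 := by
  have : ∑ x, |μ x - ν x| < ∑ x, (μ x + ν x) := by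
    refine Finset.sum_lt_sum (fun x _ => ?_) ⟨z, Finset.mem_univ z, ?_⟩
    · rw [abs_le]; constructor <;> linarith [hμ x, hν x]
    · rw [abs_lt]; constructor <;> linarith
  rw [Finset.sum_add_distrib, hμ1, hν1] at this
  rw [dTV]
  linarith

end Coupling

/-! ### The double well weights -/

/-- The base of the power in the inverse of the double well weight. -/
def wellBase (n k : ℕ) : ℝ := max (k : ℝ) 1 * max ((n : ℝ) - k) 1

/-- The double well weight as a function on the natural numbers. -/
def natWeight (n k : ℕ) : ℝ := ((wellBase n k) ^ (3 / 2 : ℝ))⁻¹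

/-- The rate of the jumps from `k` to `k + 1`. -/
def upRate (n k : ℕ) : ℝ := min 1 (natWeight n (k + 1) / natWeight n k)

/-- The rate of the jumps from `k` to `k - 1`. -/
def downRate (n k : ℕ) : ℝ := min 1 (natWeight n (k - 1) / natWeight n k)

theorem one_le_wellBase (n k : ℕ) : 1 ≤ wellBase n k :=
  one_le_mul_of_one_le_of_one_le (le_max_right _ _) (le_max_right _ _)

theorem wellBase_pos (n k : ℕ) : 0 < wellBase n k := one_pos.trans_le (one_le_wellBase n k)

theorem natWeight_pos (n k : ℕ) : 0 < natWeight n k :=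
  inv_pos.2 (Real.rpow_pos_of_pos (wellBase_pos n k) _)

theorem wellWeight_eq (n : ℕ) (x : Fin (n + 1)) : wellWeight n x = natWeight n x := by
  rw [wellWeight, natWeight, wellBase, Real.mul_rpow (by positivity) (by positivity), one_div]

theorem sum_wellWeight_pos (n : ℕ) : 0 < ∑ y, wellWeight n y :=
  Finset.sum_pos (fun y _ => by rw [wellWeight_eq]; exact natWeight_pos n y) Finset.univ_nonempty

theorem wellMeasure_pos (n : ℕ) (x : Fin (n + 1)) : 0 < wellMeasure n x := by
  rw [wellMeasure, wellWeight_eq]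
  exact mul_pos (inv_pos.2 (sum_wellWeight_pos n)) (natWeight_pos n x)

theorem wellMeasure_div (n : ℕ) (x y : Fin (n + 1)) :
    wellMeasure n y / wellMeasure n x = natWeight n y / natWeight n x := by
  rw [wellMeasure, wellMeasure, wellWeight_eq, wellWeight_eq,
    mul_div_mul_left _ _ (inv_pos.2 (sum_wellWeight_pos n)).ne']

theorem upRate_pos (n k : ℕ) : 0 < upRate n k :=
  lt_min one_pos (div_pos (natWeight_pos _ _) (natWeight_pos _ _))

theorem downRate_pos (n k : ℕ) : 0 < downRate n k :=
  lt_min one_pos (div_pos (natWeight_pos _ _) (natWeight_pos _ _))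

theorem natWeight_mul_rates (n k : ℕ) :
    natWeight n (k + 1) * downRate n (k + 1) = natWeight n k * upRate n k := by
  have h1 := natWeight_pos n k
  have h2 := natWeight_pos n (k + 1)
  rw [downRate, upRate, Nat.add_sub_cancel, mul_min_of_nonneg _ _ h2.le, mul_min_of_nonneg _ _ h1.le,
    mul_div_cancel₀ _ h1.ne', mul_div_cancel₀ _ h2.ne', mul_one, mul_one, min_comm]

theorem natWeight_div_eq (n j k : ℕ) :
    natWeight n j / natWeight n k = (wellBase n k / wellBase n j) ^ (3 / 2 : ℝ) := by
  rw [natWeight, natWeight, Real.div_rpow (wellBase_pos _ _).le (wellBase_pos _ _).le, inv_div_inv]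

theorem natWeight_anti {n j k : ℕ} (h : wellBase n j ≤ wellBase n k) :
    natWeight n k ≤ natWeight n j :=
  inv_anti₀ (Real.rpow_pos_of_pos (wellBase_pos n j) _)
    (Real.rpow_le_rpow (wellBase_pos n j).le h (by norm_num))

theorem wellBase_zero {n : ℕ} (hn : 1 ≤ n) : wellBase n 0 = n := by
  have : (1 : ℝ) ≤ n := by exact_mod_cast hn
  simp [wellBase, this]

theorem wellBase_of_pos {n k : ℕ} (hk : 0 < k) (hkn : k < n) :
    wellBase n k = (k : ℝ) * (n - k) := by
  have h1 : (1 : ℝ) ≤ k := by exact_mod_cast hk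
  have h2 : (k : ℝ) + 1 ≤ n := by exact_mod_cast hkn
  rw [wellBase, max_eq_left h1, max_eq_left (by linarith)]

/-- Left of n/2 the weight decreases with k(n-k), which is larger at k+1 than at k-1. At k = 1 the
truncation at 0 replaces the base by n, and 2(n-2) ≥ n is where n ≥ 4 enters. -/
theorem upRate_le_downRate {n k : ℕ} (hn : 4 ≤ n) (hk : 0 < k) (hkn : 2 * k < n) :
    upRate n k ≤ downRate n k := by
  refine min_le_min le_rfl (div_le_div_of_nonneg_right (natWeight_anti ?_) (natWeight_pos n k).le)
  have hn' : (4 : ℝ) ≤ n := by exact_mod_cast hn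
  rw [wellBase_of_pos (k := k + 1) (by omega) (by omega)]
  rcases Nat.lt_or_ge 1 k with h | h
  · rw [wellBase_of_pos (by omega) (by omega)]
    have hk1 : (1 : ℝ) ≤ k := by exact_mod_cast hk
    have hkn' : 2 * (k : ℝ) ≤ n := by exact_mod_cast hkn.le
    push_cast [Nat.cast_sub hk]
    nlinarith
  · obtain rfl : k = 1 := by omega
    rw [Nat.sub_self, wellBase_zero (by omega)]
    push_cast
    linarith

theorem half_le_downRate {n k : ℕ} (hn : 4 ≤ n) (hk : 0 < k) (hkn : 2 * k < n) :
    1 / 2 ≤ downRate n k := by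
  refine le_min (by norm_num) ?_
  rw [natWeight_div_eq]
  have hn' : (4 : ℝ) ≤ n := by exact_mod_cast hn
  -- The ratio is below 1 only at k = 1, where it equals (n-1)/n ≥ 3/4. Replacing the exponent 3/2
  -- by 2 gives 9/16 ≥ 1/2.
  have h34 : (3 / 4 : ℝ) ≤ wellBase n k / wellBase n (k - 1) := by
    rw [le_div_iff₀ (wellBase_pos _ _), wellBase_of_pos hk (by omega)]
    rcases Nat.lt_or_ge 1 k with h | h
    · rw [wellBase_of_pos (by omega) (by omega)]
      have hk1 : (1 : ℝ) ≤ k := by exact_mod_cast hk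
      have hkn' : 2 * (k : ℝ) ≤ n := by exact_mod_cast hkn.le
      push_cast [Nat.cast_sub hk]
      nlinarith
    · obtain rfl : k = 1 := by omega
      rw [Nat.sub_self, wellBase_zero (by omega)]
      push_cast
      linarith
  calc (1 / 2 : ℝ) ≤ (3 / 4 : ℝ) ^ (2 : ℝ) := by norm_num
    _ ≤ (3 / 4 : ℝ) ^ (3 / 2 : ℝ) :=
        Real.rpow_le_rpow_of_exponent_ge (by norm_num) (by norm_num) (by norm_num)
    _ ≤ _ := Real.rpow_le_rpow (by norm_num) h34 (by norm_num)

/-! ### The generator -/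

theorem jumpRate_nonneg (n : ℕ) (x y : Fin (n + 1)) : 0 ≤ jumpRate n x y := by
  rw [jumpRate]
  split_ifs
  · exact le_min zero_le_one (div_pos (wellMeasure_pos n y) (wellMeasure_pos n x)).le
  · exact le_rfl

theorem jumpRate_self (n : ℕ) (x : Fin (n + 1)) : jumpRate n x x = 0 := by
  rw [jumpRate, if_neg (by omega)]

theorem jumpRate_up {n : ℕ} {x y : Fin (n + 1)} (h : (y : ℕ) = x + 1) :
    jumpRate n x y = upRate n x := by
  rw [jumpRate, if_pos (Or.inl h), wellMeasure_div, upRate, h]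

theorem jumpRate_down {n : ℕ} {x y : Fin (n + 1)} (h : (x : ℕ) = y + 1) :
    jumpRate n x y = downRate n x := by
  rw [jumpRate, if_pos (Or.inr h), wellMeasure_div, downRate, h, Nat.add_sub_cancel]

theorem wellRates_nonneg (n : ℕ) (x y : Fin (n + 1)) (h : x ≠ y) : 0 ≤ wellRates n x y := by
  rw [wellRates, if_neg h]
  exact jumpRate_nonneg n x y

theorem sum_wellRates_mul (n : ℕ) (v : Fin (n + 1) → ℝ) (x : Fin (n + 1)) :
    ∑ y, wellRates n x y * v y = ∑ y, jumpRate n x y * (v y - v x) := by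
  have : ∀ y, wellRates n x y * v y =
      jumpRate n x y * v y - if x = y then (∑ z, jumpRate n x z) * v x else 0 := by
    intro y
    rw [wellRates]
    split_ifs with h
    · subst h; rw [jumpRate_self]; ring
    · ring
  simp only [this, Finset.sum_sub_distrib, Finset.sum_ite_eq, Finset.mem_univ, if_true, mul_sub,
    Finset.sum_mul]

theorem sum_wellRates (n : ℕ) (x : Fin (n + 1)) : ∑ y, wellRates n x y = 0 := by
  have := sum_wellRates_mul n (fun _ => 1) x
  simpa using this

theorem wellRates_reversible (n : ℕ) (x y : Fin (n + 1)) :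
    wellMeasure n x * wellRates n x y = wellMeasure n y * wellRates n y x := by
  by_cases h : x = y
  · rw [h]
  have h1 := wellMeasure_pos n x
  have h2 := wellMeasure_pos n y
  rw [wellRates, wellRates, if_neg h, if_neg (Ne.symm h), jumpRate, jumpRate]
  by_cases hn : (y : ℕ) = x + 1 ∨ (x : ℕ) = y + 1
  · rw [if_pos hn, if_pos hn.symm, mul_min_of_nonneg _ _ h2.le, mul_min_of_nonneg _ _ h1.le,
      mul_div_cancel₀ _ h1.ne', mul_div_cancel₀ _ h2.ne', mul_one, mul_one, min_comm]
  · rw [if_neg hn, if_neg (fun h => hn h.symm), mul_zero, mul_zero]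

theorem reversedRates_wellRates (n : ℕ) :
    reversedRates (wellMeasure n) (wellRates n) = wellRates n := by
  funext x y
  rw [reversedRates, div_mul_eq_mul_div, ← wellRates_reversible,
    mul_div_cancel_left₀ _ (wellMeasure_pos n x).ne']

theorem eq_add_one_of_wellRates_ne_zero {n : ℕ} {x y : Fin (n + 1)} (h : wellRates n x y ≠ 0)
    (hxy : x ≠ y) : (y : ℕ) = x + 1 ∨ (x : ℕ) = y + 1 := by
  by_contra hcon
  rw [wellRates, if_neg hxy, jumpRate, if_neg hcon] at h
  exact h rfl

theorem sum_wellRates_mul_interior {n : ℕ} (V : ℕ → ℝ) {x : Fin (n + 1)} (h0 : 0 < (x : ℕ))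
    (hn : (x : ℕ) < n) : ∑ y : Fin (n + 1), wellRates n x y * V y =
      upRate n x * (V (x + 1) - V x) + downRate n x * (V (x - 1) - V x) := by
  rw [sum_wellRates_mul n (fun y => V y) x]
  rw [Finset.sum_eq_add (⟨x + 1, by omega⟩ : Fin (n + 1)) ⟨x - 1, by omega⟩]
  · rw [jumpRate_up rfl, jumpRate_down (by simp only; omega)]
  · simp [Fin.ext_iff]; omega
  · rintro c - ⟨h1, h2⟩
    rw [jumpRate, if_neg, zero_mul]
    rintro (h | h)
    · exact h1 (Fin.ext h)
    · exact h2 (Fin.ext (by simp only; omega))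
  · simp
  · simp

theorem sum_wellRates_mul_zero {n : ℕ} (hn : 0 < n) (V : ℕ → ℝ) {x : Fin (n + 1)} (h0 : (x : ℕ) = 0) :
    ∑ y : Fin (n + 1), wellRates n x y * V y = upRate n 0 * (V 1 - V 0) := by
  rw [sum_wellRates_mul n (fun y => V y) x]
  rw [Finset.sum_eq_single (⟨1, by omega⟩ : Fin (n + 1))]
  · rw [jumpRate_up (by simp only; omega), h0]
  · intro c _ h1
    rw [jumpRate, if_neg, zero_mul]
    rintro (h | h)
    · exact h1 (Fin.ext (by simp only; omega))
    · omega
  · simp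

/-- The increments of k(n-k) are n-2k-1 upwards and -(n-2k+1) downwards, so up ≤ down leaves at most
-2·down ≤ -1. -/
theorem sum_wellRates_mul_parabola_le {n : ℕ} (hn : 4 ≤ n) {x : Fin (n + 1)} (h0 : 0 < (x : ℕ))
    (hx : 2 * (x : ℕ) < n) :
    ∑ y : Fin (n + 1), wellRates n x y * ((y : ℕ) * ((n : ℝ) - (y : ℕ))) ≤ -1 := by
  rw [sum_wellRates_mul_interior (fun k => (k : ℝ) * ((n : ℝ) - k)) h0 (by omega)]
  have h1 := upRate_le_downRate hn h0 hx
  have h2 := half_le_downRate hn h0 hx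
  have h3 : 2 * ((x : ℕ) : ℝ) + 1 ≤ n := by exact_mod_cast hx
  push_cast [Nat.cast_sub (show 1 ≤ (x : ℕ) from h0)]
  nlinarith [mul_le_mul_of_nonneg_right h1 (by linarith : 0 ≤ (n : ℝ) - 2 * ((x : ℕ) : ℝ) - 1)]

/-! ### Superharmonic functions on the left well are decreasing and concave -/

section Superharmonic

variable {n : ℕ} {V : ℕ → ℝ}

/-- Superharmonicity at k bounds up·(next decrement) below by down·(previous decrement), and up ≤
down makes the decrements grow. The induction starts at the reflecting end 0, where only V 1 ≤ V 0
is available. -/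
theorem diff_nonneg_and_mono (hn : 4 ≤ n) (h0 : upRate n 0 * (V 1 - V 0) ≤ 0)
    (hint : ∀ k, 0 < k → 2 * k < n →
      upRate n k * (V (k + 1) - V k) + downRate n k * (V (k - 1) - V k) ≤ 0) (k : ℕ) (hk : 2 * k < n) :
    0 ≤ V k - V (k + 1) ∧ (0 < k → V (k - 1) - V k ≤ V k - V (k + 1)) := by
  induction k with
  | zero =>
    refine ⟨?_, fun h => absurd h (lt_irrefl _)⟩
    by_contra hcon
    push Not at hcon
    have := mul_pos (upRate_pos n 0) (show 0 < V 1 - V 0 by simpa using hcon)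
    linarith
  | succ k ih =>
    have ih' := (ih (by omega)).1
    have h := hint (k + 1) (by omega) hk
    rw [Nat.add_sub_cancel] at h ⊢
    have hud := upRate_le_downRate hn (Nat.succ_pos k) hk
    have h2 := mul_le_mul_of_nonneg_right hud ih'
    have h3 : upRate n (k + 1) * (V k - V (k + 1)) ≤ upRate n (k + 1) * (V (k + 1) - V (k + 1 + 1)) := by
      linarith
    have h4 := le_of_mul_le_mul_left h3 (upRate_pos n (k + 1))
    exact ⟨by linarith, fun _ => h4⟩

theorem diff_le_diff (hn : 4 ≤ n) (h0 : upRate n 0 * (V 1 - V 0) ≤ 0)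
    (hint : ∀ k, 0 < k → 2 * k < n →
      upRate n k * (V (k + 1) - V k) + downRate n k * (V (k - 1) - V k) ≤ 0) {j k : ℕ} (hjk : j ≤ k)
    (hk : 2 * k < n) : V j - V (j + 1) ≤ V k - V (k + 1) := by
  induction k, hjk using Nat.le_induction with
  | base => exact le_rfl
  | succ k _ ih =>
    refine (ih (by omega)).trans ?_
    have := (diff_nonneg_and_mono hn h0 hint (k + 1) hk).2 (Nat.succ_pos k)
    rwa [Nat.add_sub_cancel] at this

theorem mul_diff_le (hn : 4 ≤ n) (h0 : upRate n 0 * (V 1 - V 0) ≤ 0)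
    (hint : ∀ k, 0 < k → 2 * k < n →
      upRate n k * (V (k + 1) - V k) + downRate n k * (V (k - 1) - V k) ≤ 0) {k j : ℕ}
    (hj : 2 * (k + j) < n + 2) : j * (V k - V (k + 1)) ≤ V k - V (k + j) := by
  induction j with
  | zero => simp
  | succ j ih =>
    have h1 := ih (by omega)
    have h2 := diff_le_diff hn h0 hint (Nat.le_add_right k j) (by omega)
    push_cast
    rw [← add_assoc]
    linarith

theorem sub_le_mul_diff (hn : 4 ≤ n) (h0 : upRate n 0 * (V 1 - V 0) ≤ 0)
    (hint : ∀ k, 0 < k → 2 * k < n →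
      upRate n k * (V (k + 1) - V k) + downRate n k * (V (k - 1) - V k) ≤ 0) {k j : ℕ}
    (hk : 2 * k < n) (hj : j ≤ k) : V 0 - V j ≤ j * (V k - V (k + 1)) := by
  induction j with
  | zero => simp
  | succ j ih =>
    have h1 := ih (by omega)
    have h2 := diff_le_diff hn h0 hint (show j ≤ k by omega) hk
    push_cast
    linarith

theorem le_zero_of_superharmonic (hn : 4 ≤ n) (h0 : upRate n 0 * (V 1 - V 0) ≤ 0)
    (hint : ∀ k, 0 < k → 2 * k < n →
      upRate n k * (V (k + 1) - V k) + downRate n k * (V (k - 1) - V k) ≤ 0) {k : ℕ}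
    (hk : 2 * k < n + 2) : V k ≤ V 0 := by
  have h := mul_diff_le hn h0 hint (k := 0) (j := k) (by omega)
  have h2 := (diff_nonneg_and_mono hn h0 hint 0 (by omega)).1
  simp only [zero_add] at h h2
  nlinarith [mul_nonneg (Nat.cast_nonneg k : (0 : ℝ) ≤ k) h2]

/-- A concave function lies above its chord from 0 to the first point ⌈n/2⌉ of the right half, where
it vanishes; that point is at least n/2. -/
theorem ge_of_superharmonic (hn : 4 ≤ n) (h0 : upRate n 0 * (V 1 - V 0) ≤ 0)
    (hint : ∀ k, 0 < k → 2 * k < n →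
      upRate n k * (V (k + 1) - V k) + downRate n k * (V (k - 1) - V k) ≤ 0)
    (hV : V ((n + 1) / 2) = 0) {k : ℕ} (hk : 2 * k < n) :
    V 0 * (1 - 2 * k / n) ≤ V k := by
  set m := (n + 1) / 2 with hm
  have hV0 : 0 ≤ V 0 := by
    have := le_zero_of_superharmonic hn h0 hint (k := m) (by omega)
    rwa [hV] at this
  have h1 := sub_le_mul_diff hn h0 hint hk le_rfl
  have h2 := mul_diff_le hn h0 hint (k := k) (j := m - k) (by omega)
  rw [show k + (m - k) = m by omega, hV, sub_zero] at h2
  have hd := (diff_nonneg_and_mono hn h0 hint k hk).1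
  rw [Nat.cast_sub (by omega)] at h2
  have hkm : (k : ℝ) ≤ m := by exact_mod_cast (by omega : k ≤ m)
  have hnm : (n : ℝ) ≤ 2 * m := by exact_mod_cast (by omega : n ≤ 2 * m)
  have hn0 : (0 : ℝ) < n := by exact_mod_cast (by omega : 0 < n)
  have hm0 : (0 : ℝ) < m := by linarith
  have h3 : ((m : ℝ) - k) * V 0 ≤ m * V k := by
    have a1 := mul_le_mul_of_nonneg_left h1 (by linarith : (0 : ℝ) ≤ m - k)
    have a2 := mul_le_mul_of_nonneg_left h2 (Nat.cast_nonneg k : (0 : ℝ) ≤ k)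
    nlinarith
  have h4 : V 0 * (1 - k / m) ≤ V k := by
    rw [show V 0 * (1 - (k : ℝ) / m) = ((m - k) * V 0) / m by field_simp, div_le_iff₀ hm0]
    linarith
  refine (mul_le_mul_of_nonneg_left ?_ hV0).trans h4
  have : (k : ℝ) / m ≤ 2 * k / n := by
    rw [div_le_div_iff₀ hm0 hn0]
    nlinarith [mul_le_mul_of_nonneg_left hnm (Nat.cast_nonneg k : (0 : ℝ) ≤ k)]
  linarith

end Superharmonic

theorem mem_rightHalf {n : ℕ} {x : Fin (n + 1)} : x ∈ rightHalf n ↔ n ≤ 2 * (x : ℕ) := by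
  rw [rightHalf, Set.mem_ofPred_eq, div_le_iff₀ (by norm_num)]
  constructor
  · intro h
    have : (n : ℝ) ≤ ((2 * (x : ℕ) : ℕ) : ℝ) := by push_cast; linarith
    exact_mod_cast this
  · intro h
    have : (n : ℝ) ≤ ((2 * (x : ℕ) : ℕ) : ℝ) := by exact_mod_cast h
    push_cast at this
    linarith

theorem notMem_rightHalf {n : ℕ} {x : Fin (n + 1)} : x ∉ rightHalf n ↔ 2 * (x : ℕ) < n := by
  rw [mem_rightHalf, not_le]

/-- Extension by zero of a function on `{0, ..., n}` to the natural numbers. -/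
def natExt {n : ℕ} (v : Fin (n + 1) → ℝ) (k : ℕ) : ℝ := if h : k < n + 1 then v ⟨k, h⟩ else 0

theorem natExt_coe {n : ℕ} (v : Fin (n + 1) → ℝ) (x : Fin (n + 1)) : natExt v x = v x := by
  rw [natExt, dif_pos x.2]

/-! ### Eigenvalue of the left well and mean of its invariant measure -/

section Well

variable {n : ℕ}

theorem sum_wellRates_mul_eq_natExt_zero (hn : 0 < n) (v : Fin (n + 1) → ℝ) :
    ∑ y, wellRates n 0 y * v y = upRate n 0 * (natExt v 1 - natExt v 0) := by
  rw [← sum_wellRates_mul_zero hn (natExt v) (x := 0) rfl]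
  simp only [natExt_coe]

theorem sum_wellRates_mul_eq_natExt (v : Fin (n + 1) → ℝ) {k : ℕ} (h0 : 0 < k) (hk : k < n) :
    ∑ y, wellRates n ⟨k, by omega⟩ y * v y =
      upRate n k * (natExt v (k + 1) - natExt v k) + downRate n k * (natExt v (k - 1) - natExt v k) := by
  rw [← sum_wellRates_mul_interior (natExt v) (x := ⟨k, by omega⟩) h0 hk]
  simp only [natExt_coe]

theorem natExt_superharmonic (hn : 4 ≤ n) {v : Fin (n + 1) → ℝ}
    (hv : ∀ x ∉ rightHalf n, ∑ y, wellRates n x y * v y ≤ 0) :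
    upRate n 0 * (natExt v 1 - natExt v 0) ≤ 0 ∧ ∀ k, 0 < k → 2 * k < n →
      upRate n k * (natExt v (k + 1) - natExt v k) +
        downRate n k * (natExt v (k - 1) - natExt v k) ≤ 0 := by
  constructor
  · rw [← sum_wellRates_mul_eq_natExt_zero (by omega)]
    exact hv 0 (notMem_rightHalf.2 (by simp; omega))
  · intro k h0 hk
    rw [← sum_wellRates_mul_eq_natExt v h0 (by omega)]
    exact hv _ (notMem_rightHalf.2 (by simpa using hk))

theorem natExt_eq_zero {v : Fin (n + 1) → ℝ} (hv : ∀ x ∈ rightHalf n, v x = 0) {k : ℕ}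
    (hk : n ≤ 2 * k) : natExt v k = 0 := by
  rw [natExt]
  split_ifs with h
  · exact hv _ (mem_rightHalf.2 hk)
  · rfl

theorem superharmonic_le_zero (hn : 4 ≤ n) {v : Fin (n + 1) → ℝ}
    (hv : ∀ x ∉ rightHalf n, ∑ y, wellRates n x y * v y ≤ 0) (hv0 : ∀ x ∈ rightHalf n, v x = 0)
    (x : Fin (n + 1)) : v x ≤ v 0 := by
  obtain ⟨h1, h2⟩ := natExt_superharmonic hn hv
  have key := fun k hk => le_zero_of_superharmonic hn h1 h2 (k := k) hk
  rw [← natExt_coe v x, ← natExt_coe v 0]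
  by_cases hx : x ∈ rightHalf n
  · rw [natExt_coe v x, hv0 x hx]
    have := key ((n + 1) / 2) (by omega)
    rwa [natExt_eq_zero hv0 (by omega)] at this
  · rw [notMem_rightHalf] at hx
    exact key x (by omega)

theorem superharmonic_ge (hn : 4 ≤ n) {v : Fin (n + 1) → ℝ}
    (hv : ∀ x ∉ rightHalf n, ∑ y, wellRates n x y * v y ≤ 0) (hv0 : ∀ x ∈ rightHalf n, v x = 0)
    {x : Fin (n + 1)} (hx : x ∉ rightHalf n) : v 0 * (1 - 2 * (x : ℕ) / n) ≤ v x := by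
  obtain ⟨h1, h2⟩ := natExt_superharmonic hn hv
  rw [← natExt_coe v x, ← natExt_coe v 0]
  exact ge_of_superharmonic hn h1 h2 (natExt_eq_zero hv0 (by omega)) (notMem_rightHalf.1 hx)

/-- By the backward equation this is a time derivative of the survival function, which decreases in
time. The survival function is thus superharmonic, and the concavity estimates apply to it. -/
theorem CTMC.sum_rates_mul_survival_nonpos {S : Type} [Fintype S] [DecidableEq S] {Q : Matrix S S ℝ}
    (C : CTMC Q) {K : Set S} {t : ℝ} (ht : 0 ≤ t) {x : S} (hx : x ∉ K) :
    ∑ y, Q x y * survival Q K t y ≤ 0 := by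
  have hslope := (hasDerivWithinAt_iff_tendsto_slope' (by simp)).1
    ((hasDerivAt_survival (Q := Q) hx t).hasDerivWithinAt (s := Set.Ioi t))
  refine le_of_tendsto hslope ?_
  filter_upwards [self_mem_nhdsWithin] with s hs
  rw [slope_def_field]
  have hs' : t < s := hs
  exact div_nonpos_of_nonpos_of_nonneg (by linarith [C.survival_antitone K ht hs'.le x]) (by linarith)

/-- The principal eigenvalue of the left well is at most of order `n ^ (-5/2)`. -/
theorem eigenvalue_mul_le (hn : 8 ≤ n) {φ : Fin (n + 1) → ℝ} {l : ℝ} (hl : 0 ≤ l)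
    (hφ : ∀ x, 0 ≤ φ x) (hφ0 : φ 0 = 1) (hφG : ∀ x ∈ rightHalf n, φ x = 0)
    (heig : ∀ x ∉ rightHalf n, ∑ y, wellRates n x y * φ y = -(l * φ x)) :
    l * ((n : ℝ) / 8) ^ (5 / 2 : ℝ) ≤ 1 := by
  have hsup : ∀ x ∉ rightHalf n, ∑ y, wellRates n x y * φ y ≤ 0 := by
    intro x hx
    rw [heig x hx]
    have := mul_nonneg hl (hφ x)
    linarith
  obtain ⟨h1, h2⟩ := natExt_superharmonic (by omega) hsup
  set V := natExt φ with hV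
  have hVnn : ∀ k, 0 ≤ V k := by
    intro k; rw [hV, natExt]; split_ifs
    · exact hφ _
    · exact le_rfl
  have hV0 : V 0 = 1 := by rw [← hφ0]; exact natExt_coe φ 0
  -- The flux through the edge (k, k+1) is l times the φ-weighted mass of {0, ..., k}, hence at
  -- least the contribution of the point 0 alone.
  have hflux : ∀ k, 2 * k < n → l * natWeight n 0 ≤ natWeight n k * upRate n k * (V k - V (k + 1)) := by
    intro k
    induction k with
    | zero =>
      intro _
      have := sum_wellRates_mul_eq_natExt_zero (n := n) (by omega) φ
      rw [heig 0 (notMem_rightHalf.2 (by simp; omega)), hφ0] at this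
      rw [zero_add, mul_assoc, show upRate n 0 * (V 0 - V 1) = l by linarith]
      linarith
    | succ k ih =>
      intro hk
      have h := sum_wellRates_mul_eq_natExt (n := n) φ (k := k + 1) (by omega) (by omega)
      rw [heig _ (notMem_rightHalf.2 (by simpa using hk)), Nat.add_sub_cancel] at h
      have h' : upRate n (k + 1) * (V (k + 1) - V (k + 1 + 1)) =
          l * φ ⟨k + 1, by omega⟩ + downRate n (k + 1) * (V k - V (k + 1)) := by
        rw [hV]; linarith
      rw [mul_assoc, h', mul_add, ← mul_assoc (natWeight n (k + 1)) (downRate n (k + 1)),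
        natWeight_mul_rates]
      have := ih (by omega)
      have := mul_nonneg (natWeight_pos n (k + 1)).le (mul_nonneg hl (hφ ⟨k + 1, by omega⟩))
      linarith
  -- At k = ⌈n/4⌉ the weight is already smaller than at 0 by (n/8)^{-3/2}, as k(n-k) ≥ n²/8, while
  -- at least n/8 steps remain before G. By concavity the decrement at k is then at most 8/n.
  set k := (n + 3) / 4 with hk
  set m := (n + 1) / 2 with hm
  have hkn : 2 * k < n := by omega
  have hd := mul_diff_le (n := n) (V := V) (by omega) h1 h2 (k := k) (j := m - k) (by omega)
  rw [show k + (m - k) = m by omega, show V m = 0 from natExt_eq_zero hφG (by omega), sub_zero] at hd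
  have hVk : V k ≤ 1 := by
    rw [← hV0]; exact le_zero_of_superharmonic (by omega) h1 h2 (by omega)
  have hdk := (diff_nonneg_and_mono (n := n) (V := V) (by omega) h1 h2 k hkn).1
  have hn8 : (8 : ℝ) ≤ n := by exact_mod_cast hn
  have hmk : (n : ℝ) / 8 ≤ ((m - k : ℕ) : ℝ) := by
    rw [div_le_iff₀ (by norm_num)]
    exact_mod_cast (by omega : n ≤ (m - k) * 8)
  have hw : l * (natWeight n 0 / natWeight n k) ≤ V k - V (k + 1) := by
    rw [← mul_div_assoc, div_le_iff₀ (natWeight_pos n k)]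
    refine (hflux k hkn).trans ?_
    have hu : upRate n k ≤ 1 := min_le_left _ _
    have := mul_le_mul_of_nonneg_right hu (mul_nonneg (natWeight_pos n k).le hdk)
    linarith
  have hbase : (n : ℝ) / 8 ≤ wellBase n k / wellBase n 0 := by
    rw [wellBase_zero (by omega), wellBase_of_pos (by omega) (by omega), le_div_iff₀ (by linarith)]
    have a1 : (n : ℝ) ≤ 4 * k := by exact_mod_cast (by omega : n ≤ 4 * k)
    have a2 : 2 * (k : ℝ) ≤ n := by exact_mod_cast hkn.le
    nlinarith
  have hratio : ((n : ℝ) / 8) ^ (3 / 2 : ℝ) ≤ natWeight n 0 / natWeight n k := by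
    rw [natWeight_div_eq]
    exact Real.rpow_le_rpow (by positivity) hbase (by norm_num)
  have hpow : ((n : ℝ) / 8) ^ (5 / 2 : ℝ) = (n : ℝ) / 8 * ((n : ℝ) / 8) ^ (3 / 2 : ℝ) := by
    rw [show (5 / 2 : ℝ) = 1 + 3 / 2 by norm_num, Real.rpow_add (by positivity), Real.rpow_one]
  calc l * ((n : ℝ) / 8) ^ (5 / 2 : ℝ) = (n : ℝ) / 8 * (l * ((n : ℝ) / 8) ^ (3 / 2 : ℝ)) := by
        rw [hpow]; ring
    _ ≤ (n : ℝ) / 8 * (V k - V (k + 1)) := by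
        refine mul_le_mul_of_nonneg_left ?_ (by positivity)
        exact (mul_le_mul_of_nonneg_left hratio hl).trans hw
    _ ≤ ((m - k : ℕ) : ℝ) * (V k - V (k + 1)) := mul_le_mul_of_nonneg_right hmk hdk
    _ ≤ 1 := hd.trans hVk

/-- Telescoping against 2(√(m+1) - √m). The term k = 0 is 1/0 = 0. -/
theorem sum_inv_sqrt_le (m : ℕ) : ∑ k ∈ Finset.range (m + 1), 1 / √(k : ℝ) ≤ 2 * √(m : ℝ) := by
  induction m with
  | zero => simp
  | succ m ih =>
    rw [Finset.sum_range_succ]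
    have h0 : 0 ≤ √(m : ℝ) := Real.sqrt_nonneg _
    have h1 : 0 < √((m + 1 : ℕ) : ℝ) := Real.sqrt_pos.2 (by positivity)
    have s0 : √(m : ℝ) * √(m : ℝ) = m := Real.mul_self_sqrt (by positivity)
    have s1 : √((m + 1 : ℕ) : ℝ) * √((m + 1 : ℕ) : ℝ) = m + 1 := by
      rw [Real.mul_self_sqrt (by positivity)]; push_cast; rfl
    have : 1 / √((m + 1 : ℕ) : ℝ) ≤ 2 * (√((m + 1 : ℕ) : ℝ) - √(m : ℝ)) := by
      rw [div_le_iff₀ h1]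
      nlinarith [sq_nonneg (√((m + 1 : ℕ) : ℝ) - √(m : ℝ))]
    linarith

theorem condOn_wellMeasure_le {x : Fin (n + 1)} (hn : 1 ≤ n) (hx : x ∉ rightHalf n) :
    condOn (wellMeasure n) (rightHalf n)ᶜ x ≤ natWeight n x / natWeight n 0 := by
  classical
  rw [condOn, if_pos (show x ∈ (rightHalf n)ᶜ from hx)]
  have h := wellMeasure_div n 0 x
  rw [Fin.val_zero] at h
  rw [← h]
  refine div_le_div_of_nonneg_left (wellMeasure_pos n x).le (wellMeasure_pos n 0) ?_
  have h0 : (0 : Fin (n + 1)) ∈ (rightHalf n)ᶜ := notMem_rightHalf.2 (by simp; omega)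
  have := Finset.single_le_sum (f := fun y => if y ∈ (rightHalf n)ᶜ then wellMeasure n y else 0)
    (fun y _ => by split_ifs; exacts [(wellMeasure_pos n y).le, le_rfl]) (Finset.mem_univ 0)
  rw [if_pos h0] at this
  convert this

/-- As n - x ≥ n/2 on the left half, the weight of x relative to 0 is at most (2/x)^{3/2}. Each term
is thus O(x^{-1/2}), and the mean is o(n): the invariant measure sits where the chord bounds are
close to 1. -/
theorem sum_condOn_mul_coe_le (hn : 1 ≤ n) :
    ∑ x, condOn (wellMeasure n) (rightHalf n)ᶜ x * ((x : ℕ) : ℝ) ≤ 8 * √(n : ℝ) := by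
  have hterm : ∀ x : Fin (n + 1), condOn (wellMeasure n) (rightHalf n)ᶜ x * ((x : ℕ) : ℝ) ≤
      4 * (1 / √((x : ℕ) : ℝ)) := by
    intro x
    by_cases hx : x ∈ rightHalf n
    · rw [condOn, if_neg (by simpa using hx), zero_mul]
      positivity
    by_cases h0 : (x : ℕ) = 0
    · simp [h0]
    have hxn := notMem_rightHalf.1 hx
    have hx1 : (1 : ℝ) ≤ (x : ℕ) := by exact_mod_cast Nat.one_le_iff_ne_zero.2 h0
    have hx2 : 2 * ((x : ℕ) : ℝ) ≤ n := by exact_mod_cast hxn.le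
    set k : ℝ := ((x : ℕ) : ℝ) with hk
    have hs0 : 0 < √k := Real.sqrt_pos.2 (by linarith)
    have hss : √k * √k = k := Real.mul_self_sqrt (by linarith)
    have h2 : natWeight n x / natWeight n 0 ≤ (2 / k) ^ (3 / 2 : ℝ) := by
      rw [natWeight_div_eq]
      refine Real.rpow_le_rpow (div_pos (wellBase_pos _ _) (wellBase_pos _ _)).le ?_ (by norm_num)
      rw [wellBase_zero hn, wellBase_of_pos (by omega) (by omega), ← hk,
        div_le_div_iff₀ (by nlinarith) (by linarith)]
      nlinarith
    have h3 : (2 / k) ^ (3 / 2 : ℝ) ≤ 4 / (k * √k) := by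
      rw [show (3 / 2 : ℝ) = 1 + 1 / 2 by norm_num, Real.rpow_add (by positivity), Real.rpow_one,
        ← Real.sqrt_eq_rpow, Real.sqrt_div (by norm_num)]
      rw [div_mul_div_comm]
      refine div_le_div_of_nonneg_right ?_ (by positivity)
      have : √2 ≤ 2 := by
        rw [Real.sqrt_le_left (by norm_num)]; norm_num
      linarith
    calc _ ≤ 4 / (k * √k) * k :=
          mul_le_mul_of_nonneg_right ((condOn_wellMeasure_le hn hx).trans (h2.trans h3)) (by linarith)
      _ = 4 * (1 / √k) := by field_simp
  refine (Finset.sum_le_sum fun x _ => hterm x).trans ?_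
  rw [← Finset.mul_sum, Fin.sum_univ_eq_sum_range (fun k => 1 / √(k : ℝ))]
  linarith [sum_inv_sqrt_le n]

end Well

/-! ### Survival and mixing in the left well -/

section Well

variable {n : ℕ}

theorem zero_notMem_rightHalf (hn : 1 ≤ n) : (0 : Fin (n + 1)) ∉ rightHalf n :=
  notMem_rightHalf.2 (by simp; omega)

theorem two_mul_coe_div_lt_one {x : Fin (n + 1)} (hx : x ∉ rightHalf n) :
    2 * ((x : ℕ) : ℝ) / n < 1 := by
  have h := notMem_rightHalf.1 hx
  rw [div_lt_one (by exact_mod_cast (by omega : 0 < n))]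
  exact_mod_cast h

/-- If l were 0, then Qφ would vanish off G, be nonnegative on G and be positive at the first point
of G, against stationarity, which makes the π-mean of Qφ zero. -/
theorem eigenvalue_pos (hn : 1 ≤ n) {φ : Fin (n + 1) → ℝ} {l : ℝ} (hl : 0 ≤ l)
    (hφG : ∀ x ∈ rightHalf n, φ x = 0) (hφpos : ∀ x ∉ rightHalf n, 0 < φ x)
    (heig : ∀ x ∉ rightHalf n, ∑ y, wellRates n x y * φ y = -(l * φ x)) : 0 < l := by
  refine hl.lt_of_ne fun h0 => ?_
  have hφ : ∀ x, 0 ≤ φ x := fun x => by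
    by_cases hx : x ∈ rightHalf n
    · rw [hφG x hx]
    · exact (hφpos x hx).le
  have hsum : ∑ x, wellMeasure n x * ∑ y, wellRates n x y * φ y = 0 := by
    simp only [Finset.mul_sum]
    rw [Finset.sum_comm]
    refine Finset.sum_eq_zero fun y _ => ?_
    have : ∀ x, wellMeasure n x * (wellRates n x y * φ y) =
        wellMeasure n y * φ y * wellRates n y x := fun x => by
      linear_combination φ y * wellRates_reversible n x y
    simp only [this, ← Finset.mul_sum, sum_wellRates, mul_zero]
  have hterm : ∀ x ∈ rightHalf n, ∀ y, 0 ≤ wellRates n x y * φ y := by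
    intro x hx y
    by_cases hxy : x = y
    · rw [← hxy, hφG x hx, mul_zero]
    · exact mul_nonneg (wellRates_nonneg n x y hxy) (hφ y)
  let a : Fin (n + 1) := ⟨(n + 1) / 2, by omega⟩
  let b : Fin (n + 1) := ⟨(n + 1) / 2 - 1, by omega⟩
  have ha : a ∈ rightHalf n := mem_rightHalf.2 (by simp only [a]; omega)
  have hb : b ∉ rightHalf n := notMem_rightHalf.2 (by simp only [b]; omega)
  have hpos : 0 < wellMeasure n a * ∑ y, wellRates n a y * φ y := by
    refine mul_pos (wellMeasure_pos n a) (Finset.sum_pos' (fun y _ => hterm a ha y)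
      ⟨b, Finset.mem_univ b, mul_pos ?_ (hφpos b hb)⟩)
    have hval : (a : ℕ) = b + 1 := by simp only [a, b]; omega
    rw [wellRates, if_neg (fun h => by rw [h] at hval; omega), jumpRate_down hval]
    exact downRate_pos _ _
  have hle := Finset.single_le_sum (f := fun x => wellMeasure n x * ∑ y, wellRates n x y * φ y)
    (fun x _ => by
      by_cases hx : x ∈ rightHalf n
      · exact mul_nonneg (wellMeasure_pos n x).le (Finset.sum_nonneg fun y _ => hterm x hx y)
      · rw [heig x hx, ← h0]; simp) (Finset.mem_univ a)
  rw [hsum] at hle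
  linarith

/-- The Perron eigenfunction is superharmonic, so its maximum is at 0 and the chord bound makes it
positive off G. That is what the existence of the quasi-stationary measure still required. -/
theorem exists_well_eigenfunction (C : CTMC (wellRates n)) (hn : 8 ≤ n) :
    ∃ (l : ℝ) (φ : Fin (n + 1) → ℝ), 0 < l ∧ l * ((n : ℝ) / 8) ^ (5 / 2 : ℝ) ≤ 1 ∧ (∀ x, 0 ≤ φ x) ∧
      (∀ x, φ x ≤ 1) ∧ φ 0 = 1 ∧ (∀ x ∈ rightHalf n, φ x = 0) ∧
      (∀ x ∉ rightHalf n, 1 - 2 * ((x : ℕ) : ℝ) / n ≤ φ x) ∧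
      (∀ x ∉ rightHalf n, ∑ y, wellRates n x y * φ y = -(l * φ x)) ∧
      ∃ μ : Fin (n + 1) → ℝ, C.IsQuasiStationary (wellMeasure n) (rightHalf n) μ ∧ (∀ x, 0 ≤ μ x) ∧
        ∀ t, 0 ≤ t →
          ∑ x, μ x * survival (wellRates n) (rightHalf n) t x = Real.exp (-(l * t)) := by
  obtain ⟨l, φ, hφ, hφG, ⟨z, hz⟩, heig, hqsd⟩ := C.exists_quasiStationary (wellRates_nonneg n)
    (sum_wellRates n) (wellMeasure_pos n) (wellRates_reversible n)
    ⟨0, zero_notMem_rightHalf (n := n) (by omega)⟩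
  obtain ⟨m, hm⟩ := Finite.exists_max φ
  have hmpos : 0 < φ m := lt_of_lt_of_le ((hφ z).lt_of_ne hz.symm) (hm z)
  have hmG : m ∉ rightHalf n := fun h => hmpos.ne' (hφG m h)
  -- At a maximum point of φ the generator is nonpositive.
  have hl : 0 ≤ l := by
    have h1 : ∑ y, wellRates n m y * φ y ≤ 0 := by
      rw [sum_wellRates_mul]
      exact Finset.sum_nonpos fun y _ =>
        mul_nonpos_of_nonneg_of_nonpos (jumpRate_nonneg n m y) (by linarith [hm y])
    rw [heig m hmG] at h1
    by_contra hneg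
    push Not at hneg
    have := mul_neg_of_neg_of_pos hneg hmpos
    linarith
  have hsup : ∀ x ∉ rightHalf n, ∑ y, wellRates n x y * φ y ≤ 0 := by
    intro x hx
    rw [heig x hx]
    have := mul_nonneg hl (hφ x)
    linarith
  have hle0 := superharmonic_le_zero (by omega) hsup hφG
  have h0 : 0 < φ 0 := hmpos.trans_le (hle0 m)
  have hge := fun x hx => superharmonic_ge (by omega) hsup hφG (x := x) hx
  have hφpos : ∀ x ∉ rightHalf n, 0 < φ x := fun x hx =>
    (mul_pos h0 (by linarith [two_mul_coe_div_lt_one hx])).trans_le (hge x hx)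
  have hlpos : 0 < l := eigenvalue_pos (by omega) hl hφG hφpos heig
  have heig' : ∀ x ∉ rightHalf n, ∑ y, wellRates n x y * (φ y / φ 0) = -(l * (φ x / φ 0)) := by
    intro x hx
    simp only [← mul_div_assoc, ← Finset.sum_div, heig x hx]
    ring
  have hG' : ∀ x ∈ rightHalf n, φ x / φ 0 = 0 := fun x hx => by rw [hφG x hx, zero_div]
  refine ⟨l, fun x => φ x / φ 0, hlpos,
    eigenvalue_mul_le hn hl (fun x => div_nonneg (hφ x) h0.le) (div_self h0.ne') hG' heig',
    fun x => div_nonneg (hφ x) h0.le, fun x => (div_le_one h0).2 (hle0 x), div_self h0.ne',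
    hG', fun x hx => ?_, heig', hqsd hφpos⟩
  rw [le_div_iff₀ h0]
  linarith [hge x hx]

/-- Both φ and the survival function obey the chord bound, so their product is at least v(0)(1-a)² ≥
v(0)(1-2a) with a = 2x/n. Averaging over the invariant measure, whose mean is at most 8√n, costs
32/√n, while the exact pairing identity bounds the average by e^{-lt}. -/
theorem survival_mul_le_exp (C : CTMC (wellRates n)) (hn : 4 ≤ n) {φ : Fin (n + 1) → ℝ} {l : ℝ}
    (hφ1 : ∀ x, φ x ≤ 1) (hφG : ∀ x ∈ rightHalf n, φ x = 0)
    (hφge : ∀ x ∉ rightHalf n, 1 - 2 * ((x : ℕ) : ℝ) / n ≤ φ x)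
    (heig : ∀ x ∉ rightHalf n, ∑ y, wellRates n x y * φ y = -(l * φ x)) {t : ℝ} (ht : 0 ≤ t) :
    survival (wellRates n) (rightHalf n) t 0 * (1 - 32 / √n) ≤ Real.exp (-(l * t)) := by
  classical
  set v := survival (wellRates n) (rightHalf n) t with hv
  set p := condOn (wellMeasure n) (rightHalf n)ᶜ with hp
  have hp0 : ∀ x, 0 ≤ p x := condOn_nonneg (wellMeasure_pos n) _
  have hp1 : ∑ x, p x = 1 :=
    sum_condOn (wellMeasure_pos n) ⟨0, zero_notMem_rightHalf (n := n) (by omega)⟩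
  have hv0 : 0 ≤ v 0 := C.survival_nonneg _ ht 0
  have hvge := fun x hx => superharmonic_ge hn (v := v)
    (fun x hx => C.sum_rates_mul_survival_nonpos ht hx) (fun x hx => survival_of_mem hx t) (x := x) hx
  have hpair : ∑ x, p x * φ x * v x = Real.exp (-(l * t)) * ∑ x, p x * φ x := by
    have h := sum_eigenfunction_mul_survival (wellRates_reversible n) hφG heig t
    have e : ∀ x, p x * φ x = (∑ y, if y ∈ (rightHalf n)ᶜ then wellMeasure n y else 0)⁻¹ *
        (wellMeasure n x * φ x) := by
      intro x
      by_cases hx : x ∈ rightHalf n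
      · rw [hφG x hx]; ring
      · rw [hp, condOn, if_pos (show x ∈ (rightHalf n)ᶜ from hx), div_eq_inv_mul, mul_assoc]
        congr!
    simp only [e, mul_assoc, ← Finset.mul_sum]
    simp only [mul_assoc] at h
    rw [h]
    ring
  have hupper : ∑ x, p x * φ x ≤ 1 := by
    rw [← hp1]
    exact Finset.sum_le_sum fun x _ => mul_le_of_le_one_right (hp0 x) (hφ1 x)
  have hlower : ∑ x, p x * (v 0 * (1 - 4 / n * ((x : ℕ) : ℝ))) ≤ ∑ x, p x * φ x * v x := by
    refine Finset.sum_le_sum fun x _ => ?_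
    by_cases hx : x ∈ rightHalf n
    · have : p x = 0 := if_neg (by simpa using hx)
      simp [this]
    rw [mul_assoc]
    refine mul_le_mul_of_nonneg_left ?_ (hp0 x)
    have ha := two_mul_coe_div_lt_one hx
    set a := 2 * ((x : ℕ) : ℝ) / n with had
    have e : 4 / (n : ℝ) * ((x : ℕ) : ℝ) = 2 * a := by rw [had]; ring
    rw [e]
    have h1 := hvge x hx
    have h2 := hφge x hx
    calc v 0 * (1 - 2 * a) ≤ (1 - a) * (v 0 * (1 - a)) := by nlinarith [mul_nonneg hv0 (sq_nonneg a)]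
      _ ≤ φ x * v x := mul_le_mul h2 h1 (mul_nonneg hv0 (by linarith)) (by linarith)
  have hmean := sum_condOn_mul_coe_le (n := n) (by omega)
  rw [← hp] at hmean
  have hn0 : (0 : ℝ) < n := by exact_mod_cast (by omega : 0 < n)
  have hleft : ∑ x, p x * (v 0 * (1 - 4 / n * ((x : ℕ) : ℝ))) =
      v 0 * (1 - 4 / n * ∑ x, p x * ((x : ℕ) : ℝ)) := by
    have e : ∀ x, p x * (v 0 * (1 - 4 / n * ((x : ℕ) : ℝ))) =
        v 0 * p x - v 0 * (4 / n) * (p x * ((x : ℕ) : ℝ)) := fun x => by ring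
    simp only [e, Finset.sum_sub_distrib, ← Finset.mul_sum, hp1]
    ring
  have hsq : 4 / (n : ℝ) * (8 * √n) = 32 / √n := by
    have h1 : 0 < √(n : ℝ) := Real.sqrt_pos.2 hn0
    have h2 : √(n : ℝ) * √n = n := Real.mul_self_sqrt hn0.le
    rw [div_mul_eq_mul_div, div_eq_div_iff hn0.ne' h1.ne']
    linear_combination 32 * h2
  have h4 : 4 / (n : ℝ) * ∑ x, p x * ((x : ℕ) : ℝ) ≤ 32 / √n := by
    rw [← hsq]
    exact mul_le_mul_of_nonneg_left hmean (by positivity)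
  calc v 0 * (1 - 32 / √n) ≤ v 0 * (1 - 4 / n * ∑ x, p x * ((x : ℕ) : ℝ)) :=
        mul_le_mul_of_nonneg_left (by linarith) hv0
    _ ≤ Real.exp (-(l * t)) * ∑ x, p x * φ x := by rw [← hleft, ← hpair]; exact hlower
    _ ≤ Real.exp (-(l * t)) := mul_le_of_le_one_right (Real.exp_pos _).le hupper

theorem parabola_nonneg (x : Fin (n + 1)) : 0 ≤ ((x : ℕ) : ℝ) * ((n : ℝ) - (x : ℕ)) := by
  have : ((x : ℕ) : ℝ) ≤ n := by exact_mod_cast (by omega : (x : ℕ) ≤ n)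
  exact mul_nonneg (Nat.cast_nonneg _) (by linarith)

theorem parabola_le (x : Fin (n + 1)) : ((x : ℕ) : ℝ) * ((n : ℝ) - (x : ℕ)) ≤ (n : ℝ) ^ 2 := by
  have : ((x : ℕ) : ℝ) ≤ n := by exact_mod_cast (by omega : (x : ℕ) ≤ n)
  have h0 : (0 : ℝ) ≤ (x : ℕ) := Nat.cast_nonneg _
  nlinarith

theorem sum_wellRates_mul_parabola_le' (hn : 4 ≤ n) (x : Fin (n + 1))
    (hx : x ∉ insert 0 (rightHalf n)) :
    ∑ y : Fin (n + 1), wellRates n x y * ((y : ℕ) * ((n : ℝ) - (y : ℕ))) ≤ -1 := by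
  rw [Set.mem_insert_iff, not_or, notMem_rightHalf] at hx
  refine sum_wellRates_mul_parabola_le hn (Nat.pos_of_ne_zero fun h => hx.1 (Fin.ext h)) hx.2

theorem survival_insert_zero_le (C : CTMC (wellRates n)) (hn : 4 ≤ n) {t : ℝ} (ht : 0 < t)
    (x : Fin (n + 1)) : survival (wellRates n) (insert 0 (rightHalf n)) t x ≤ n ^ 2 / t := by
  rw [le_div_iff₀ ht, mul_comm]
  exact (C.mul_survival_le (wellRates_nonneg n) (sum_wellRates n) parabola_nonneg
    (sum_wellRates_mul_parabola_le' hn) ht.le x).trans (parabola_le x)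

theorem survival_le_eigenfunction_add (C : CTMC (wellRates n)) (hn : 4 ≤ n) {φ : Fin (n + 1) → ℝ}
    {l : ℝ} (hl : 0 ≤ l) (hφ : ∀ x, 0 ≤ φ x) (hφ0 : φ 0 = 1)
    (heig : ∀ x ∉ rightHalf n, ∑ y, wellRates n x y * φ y = -(l * φ x)) {t : ℝ} (ht : 0 < t)
    (x : Fin (n + 1)) : survival (wellRates n) (rightHalf n) t x ≤ φ x + n ^ 2 / t := by
  have h := C.mul_survival_le_eigenfunction (wellRates_nonneg n) (sum_wellRates n) (o := 0)
    parabola_nonneg (sum_wellRates_mul_parabola_le' hn) hl hφ hφ0 heig ht.le x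
  have h2 := parabola_le x
  rw [← sub_le_iff_le_add', le_div_iff₀ ht]
  linarith

theorem dTV_evol_well_le (C : CTMC (wellRates n)) (hn : 4 ≤ n) {t : ℝ} (ht : 0 < t)
    {a b : Fin (n + 1)} (hab : a ≤ b) :
    dTV (C.evol a t.toNNReal) (C.evol b t.toNNReal) ≤
      1 - survival (wellRates n) (rightHalf n) t b + n ^ 2 / t := by
  refine (C.dTV_evol_le (wellRates_nonneg n) (sum_wellRates n) ?_ ?_ (o := 0) (fun x => Fin.zero_le x)
    (rightHalf n) ht.le hab).trans (by linarith [survival_insert_zero_le C hn ht b])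
  · intro a b c hab hac
    by_cases h : a = c
    · exact h ▸ hab.le
    · have := eq_add_one_of_wellRates_ne_zero hac h
      rw [Fin.lt_def] at hab
      rw [Fin.le_def]
      omega
  · intro a b c hab hbc
    by_cases h : b = c
    · exact h ▸ hab.le
    · have := eq_add_one_of_wellRates_ne_zero hbc h
      rw [Fin.lt_def] at hab
      rw [Fin.le_def]
      omega

/-- Stepping down to 0 gives all laws a common atom there. This supplies the strict bounds below 1
needed at small n. -/
theorem exp_wellRates_zero_pos (C : CTMC (wellRates n)) (x : Fin (n + 1)) {t : ℝ} (ht : 0 < t) :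
    0 < NormedSpace.exp (t • wellRates n) x 0 := by
  induction x using Fin.induction generalizing t with
  | zero => exact C.exp_rates_self_pos (wellRates_nonneg n) 0 ht.le
  | succ i ih =>
    have hne : i.succ ≠ i.castSucc := fun h => by simp [Fin.ext_iff] at h
    refine C.exp_rates_pos_of_step (wellRates_nonneg n) hne ?_ (fun t ht => ih ht) ht
    rw [wellRates, if_neg hne, jumpRate_down (by simp)]
    exact downRate_pos _ _

end Well

/-! ### Strict bounds valid for every n -/

section Finite

variable {S : Type} [Fintype S] [DecidableEq S] {Q : Matrix S S ℝ}

theorem CTMC.hit_anti (C : CTMC Q) {K L : Set S} (h : K ⊆ L) (ω : C.Ω) : C.hit L ω ≤ C.hit K ω :=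
  sInf_le_sInf (Set.image_mono fun _ ht => h ht)

theorem CTMC.survival_le_one_sub_exp (C : CTMC Q) {K : Set S} {t : ℝ} (ht : 0 ≤ t) (x : S) {y : S}
    (hy : y ∈ K) : survival Q K t x ≤ 1 - NormedSpace.exp (t • Q) x y := by
  lift t to ℝ≥0 using ht
  rw [← C.measureReal_lt_hit, ← C.measureReal_X_eq, ← probReal_compl_eq_one_sub (C.measurable_X t y)]
  refine measureReal_mono fun ω hω h => ?_
  have h' : C.X t ω = y := h
  exact (C.lt_hit_iff K t ω).1 hω t le_rfl (h' ▸ hy)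

theorem CTMC.dTV_evol_lt_one (C : CTMC Q) {t : ℝ} (ht : 0 ≤ t) {a b z : S}
    (ha : 0 < NormedSpace.exp (t • Q) a z) (hb : 0 < NormedSpace.exp (t • Q) b z) :
    dTV (C.evol a t.toNNReal) (C.evol b t.toNNReal) < 1 := by
  have h : ∀ x, C.evol x t.toNNReal = fun y => NormedSpace.exp (t • Q) x y :=
    fun x => funext fun y => C.evol_eq x y ht
  rw [h, h]
  exact dTV_lt_one (C.exp_rates_nonneg ht a) (C.exp_rates_nonneg ht b) (C.sum_exp_rates ht a)
    (C.sum_exp_rates ht b) ha hb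

/-- A finite family of reals below one has an upper bound in `(0, 1)`, which may be prescribed
whenever the prescribed value is admissible. -/
theorem exists_bound_lt_one {ι : Type*} [Finite ι] {e : ι → ℝ} (he : ∀ i, e i < 1) (b : ℝ)
    (hb : 0 < b) {P : Prop} (hP : P → ∀ i, e i ≤ b) :
    ∃ d ∈ Set.Ioo (0 : ℝ) 1, (∀ i, e i ≤ d) ∧ (P → b < 1 → d ≤ b) := by
  by_cases h : P ∧ b < 1
  · exact ⟨b, ⟨hb, h.2⟩, hP h.1, fun _ _ => le_rfl⟩
  · cases isEmpty_or_nonempty ι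
    · exact ⟨1 / 2, by norm_num, fun i => isEmptyElim i, fun h1 h2 => absurd ⟨h1, h2⟩ h⟩
    · obtain ⟨i, hi⟩ := Finite.exists_max e
      refine ⟨max (e i) (1 / 2), ⟨lt_max_of_lt_right (by norm_num), max_lt (he i) (by norm_num)⟩,
        fun j => (hi j).trans (le_max_left _ _), fun h1 h2 => absurd ⟨h1, h2⟩ h⟩

end Finite

/-! ### Exit from the basin of attraction -/

section Basin

variable {n : ℕ}

/-- The chain is reversible, so its time reversal has the same rates and the averaged probability is
the forward one. -/
theorem mem_basin_iff (C : CTMC (wellRates n))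
    (C' : CTMC (reversedRates (wellMeasure n) (wellRates n))) {R f α : ℝ} (hR : 0 ≤ R)
    {x : Fin (n + 1)} : x ∈ C.basin C' (rightHalf n) R f α ↔
      x ∉ rightHalf n ∧ 1 - survival (wellRates n) (rightHalf n) (2 * R) x ≤ f ^ α := by
  have hR2 : 0 ≤ 2 * R := by linarith
  rw [CTMC.basin, Set.mem_ofPred_eq, C.measureReal_hit_le_ofReal _ hR2,
    C'.measureReal_hit_le_ofReal _ hR2, reversedRates_wellRates]
  refine and_congr_right fun _ => ?_
  rw [show ∀ a : ℝ, 1 / 2 * (a + a) = a by intro a; ring]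

theorem sum_condOn_mul_ge {φ : Fin (n + 1) → ℝ} (hn : 1 ≤ n)
    (hφge : ∀ x ∉ rightHalf n, 1 - 2 * ((x : ℕ) : ℝ) / n ≤ φ x) :
    1 - 16 / √n ≤ ∑ x, condOn (wellMeasure n) (rightHalf n)ᶜ x * φ x := by
  set p := condOn (wellMeasure n) (rightHalf n)ᶜ with hp
  have hp0 : ∀ x, 0 ≤ p x := condOn_nonneg (wellMeasure_pos n) _
  have hp1 : ∑ x, p x = 1 := sum_condOn (wellMeasure_pos n) ⟨0, zero_notMem_rightHalf hn⟩
  have hlower : ∑ x, p x * (1 - 2 * ((x : ℕ) : ℝ) / n) ≤ ∑ x, p x * φ x := by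
    refine Finset.sum_le_sum fun x _ => ?_
    by_cases hx : x ∈ rightHalf n
    · have : p x = 0 := if_neg (by simpa using hx)
      simp [this]
    · exact mul_le_mul_of_nonneg_left (hφge x hx) (hp0 x)
  refine le_trans ?_ hlower
  have e : ∀ x : Fin (n + 1), p x * (1 - 2 * ((x : ℕ) : ℝ) / n) =
      p x - (2 / n) * (p x * ((x : ℕ) : ℝ)) := fun x => by ring
  simp only [e, Finset.sum_sub_distrib, ← Finset.mul_sum, hp1]
  have hmean := sum_condOn_mul_coe_le hn
  rw [← hp] at hmean
  have hn0 : (0 : ℝ) < n := by exact_mod_cast hn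
  have hsq : 2 / (n : ℝ) * (8 * √n) = 16 / √n := by
    have h1 : 0 < √(n : ℝ) := Real.sqrt_pos.2 hn0
    have h2 : √(n : ℝ) * √n = n := Real.mul_self_sqrt hn0.le
    rw [div_mul_eq_mul_div, div_eq_div_iff hn0.ne' h1.ne']
    linear_combination 16 * h2
  have h4 : 2 / (n : ℝ) * ∑ x, p x * ((x : ℕ) : ℝ) ≤ 16 / √n := by
    rw [← hsq]
    exact mul_le_mul_of_nonneg_left hmean (by positivity)
  linarith

theorem eigenvalue_le {l : ℝ} (hn : 1 ≤ n) (h : l * ((n : ℝ) / 8) ^ (5 / 2 : ℝ) ≤ 1) :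
    l ≤ (8 / (n : ℝ)) ^ (5 / 2 : ℝ) := by
  have hn0 : (0 : ℝ) < n := by exact_mod_cast hn
  have hpos : 0 < ((n : ℝ) / 8) ^ (5 / 2 : ℝ) := Real.rpow_pos_of_pos (by positivity) _
  rw [← le_div_iff₀ hpos] at h
  rwa [← inv_div, Real.inv_rpow (by positivity), ← one_div]

/-- Before time `t` the left well is left with small probability, both from its invariant measure and
from points near its bottom. -/
theorem exit_probability_le (C : CTMC (wellRates n)) (hn : 8 ≤ n) {t : ℝ} (ht : 0 ≤ t) :
    (1 - ∑ x, condOn (wellMeasure n) (rightHalf n)ᶜ x * survival (wellRates n) (rightHalf n) t x ≤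
      t * (8 / n) ^ (5 / 2 : ℝ) + 16 / √n) ∧
    ∀ x ∉ rightHalf n, 1 - survival (wellRates n) (rightHalf n) t x ≤
      t * (8 / n) ^ (5 / 2 : ℝ) + 2 * ((x : ℕ) : ℝ) / n := by
  obtain ⟨l, φ, hl, hl', hφ, hφ1, hφ0, hφG, hφge, heig, -⟩ := exists_well_eigenfunction C hn
  have hle := eigenvalue_le (by omega) hl'
  have hlt : l * t ≤ t * (8 / n) ^ (5 / 2 : ℝ) := by
    rw [mul_comm]; exact mul_le_mul_of_nonneg_left hle ht
  have hexp : 1 - l * t ≤ Real.exp (-(l * t)) := by linarith [Real.add_one_le_exp (-(l * t))]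
  have hexp1 : Real.exp (-(l * t)) ≤ 1 := Real.exp_le_one_iff.2 (by nlinarith)
  have hlow := fun x => exp_mul_eigenfunction_le_survival (wellRates_nonneg n) (sum_wellRates n) hφ1
    hφG heig ht x
  constructor
  · set p := condOn (wellMeasure n) (rightHalf n)ᶜ with hp
    have hp0 : ∀ x, 0 ≤ p x := condOn_nonneg (wellMeasure_pos n) _
    have h1 : Real.exp (-(l * t)) * ∑ x, p x * φ x ≤
        ∑ x, p x * survival (wellRates n) (rightHalf n) t x := by
      rw [Finset.mul_sum]
      refine Finset.sum_le_sum fun x _ => ?_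
      rw [mul_left_comm]
      exact mul_le_mul_of_nonneg_left (hlow x) (hp0 x)
    have h2 := sum_condOn_mul_ge (by omega) hφge
    rw [← hp] at h2
    have h3 : 0 ≤ 16 / √(n : ℝ) := by positivity
    nlinarith [mul_le_mul_of_nonneg_left h2 (Real.exp_pos (-(l * t))).le,
      mul_le_mul_of_nonneg_right hexp1 h3]
  · intro x hx
    have h1 := hlow x
    have h2 := hφge x hx
    have h3 : 0 ≤ 2 * ((x : ℕ) : ℝ) / n := by positivity
    nlinarith [mul_le_mul_of_nonneg_left h2 (Real.exp_pos (-(l * t))).le,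
      mul_le_mul_of_nonneg_right hexp1 h3]

/-- The exit law of the left well, from its invariant measure and from the basin of attraction, is
exponential with uniformly small relative error. -/
theorem exists_exit_rate (C : CTMC (wellRates n))
    (C' : CTMC (reversedRates (wellMeasure n) (wellRates n))) (hn : 8 ≤ n) (h32 : 32 / √(n : ℝ) ≤ 1 / 2)
    {R f α : ℝ} (hR : 0 < R) (hf : 0 < f) {η : ℝ} (hη : f ^ α + n ^ 2 / R + 64 / √n ≤ η) :
    ∃ l : ℝ, 0 < l ∧
      (∃ μ : Fin (n + 1) → ℝ, C.IsQuasiStationary (wellMeasure n) (rightHalf n) μ ∧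
        C.meanHit μ (rightHalf n) = ENNReal.ofReal (1 / l)) ∧
      (∀ t, 0 ≤ t → ∑ x, condOn (wellMeasure n) (rightHalf n)ᶜ x *
        survival (wellRates n) (rightHalf n) t x ∈
          Set.Icc ((1 - η) * Real.exp (-(l * t))) ((1 + η) * Real.exp (-(l * t)))) ∧
      ∀ x ∈ C.basin C' (rightHalf n) R f α, ∀ t, 0 ≤ t →
        survival (wellRates n) (rightHalf n) t x ∈
          Set.Icc ((1 - η) * Real.exp (-(l * t))) ((1 + η) * Real.exp (-(l * t))) := by
  obtain ⟨l, φ, hl, hl', hφ, hφ1, hφ0, hφG, hφge, heig, μ, hμ, hμ0, hμexp⟩ :=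
    exists_well_eigenfunction C hn
  have hfα : 0 < f ^ α := Real.rpow_pos_of_pos hf α
  have hnR : 0 ≤ (n : ℝ) ^ 2 / R := by positivity
  have hsn : 0 ≤ 32 / √(n : ℝ) := by positivity
  have e64 : 64 / √(n : ℝ) = 2 * (32 / √n) := by ring
  have e16 : 16 / √(n : ℝ) = (32 / √n) / 2 := by ring
  set a := 32 / √(n : ℝ) with ha
  -- Survival is largest from 0. For a = 32/√n ≤ 1/2 one has 1/(1-a) ≤ 1+2a, whence the 64/√n in η.
  have hup : ∀ t, 0 ≤ t → ∀ x, survival (wellRates n) (rightHalf n) t x ≤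
      (1 + η) * Real.exp (-(l * t)) := by
    intro t ht x
    have h1 := superharmonic_le_zero (n := n) (by omega) (v := survival (wellRates n) (rightHalf n) t)
      (fun x hx => C.sum_rates_mul_survival_nonpos ht hx) (fun x hx => survival_of_mem hx t) x
    have h2 := survival_mul_le_exp C (by omega) hφ1 hφG hφge heig ht
    rw [← ha] at h2
    have h3 := C.survival_nonneg (rightHalf n) ht 0
    refine h1.trans ?_
    have hE := Real.exp_pos (-(l * t))
    have h4 : survival (wellRates n) (rightHalf n) t 0 ≤
        (1 + 2 * a) * (survival (wellRates n) (rightHalf n) t 0 * (1 - a)) := by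
      nlinarith [mul_nonneg h3 (mul_nonneg hsn (by linarith : 0 ≤ 1 - 2 * a))]
    have h5 := mul_le_mul_of_nonneg_left h2 (by linarith : 0 ≤ 1 + 2 * a)
    have h6 : (1 + 2 * a) * Real.exp (-(l * t)) ≤ (1 + η) * Real.exp (-(l * t)) :=
      mul_le_mul_of_nonneg_right (by linarith) hE.le
    linarith
  have hlow := fun t ht x => exp_mul_eigenfunction_le_survival (t := t) (wellRates_nonneg n)
    (sum_wellRates n) hφ1 hφG heig ht x
  refine ⟨l, hl, ⟨μ, hμ, ?_⟩, fun t ht => ⟨?_, ?_⟩, fun x hx t ht => ⟨?_, hup t ht x⟩⟩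
  -- With a = b = 1 the two-sided bound pins the mean to exactly 1/l.
  · have h := C.meanHit_mem_Icc hμ0 (K := rightHalf n) zero_le_one zero_le_one hl
      (fun t ht => by rw [hμexp t ht, one_mul]) (fun t ht => by rw [hμexp t ht, one_mul])
    exact le_antisymm h.2 h.1
  · have h2 := sum_condOn_mul_ge (n := n) (by omega) hφge
    have hp0 := condOn_nonneg (wellMeasure_pos n) (rightHalf n)ᶜ
    calc (1 - η) * Real.exp (-(l * t)) ≤
        (∑ x, condOn (wellMeasure n) (rightHalf n)ᶜ x * φ x) * Real.exp (-(l * t)) :=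
          mul_le_mul_of_nonneg_right (by linarith) (Real.exp_pos _).le
      _ ≤ _ := by
        rw [Finset.sum_mul]
        refine Finset.sum_le_sum fun x _ => ?_
        rw [mul_assoc, mul_comm (φ x)]
        exact mul_le_mul_of_nonneg_left (hlow t ht x) (hp0 x)
  · have hp0 := condOn_nonneg (wellMeasure_pos n) (rightHalf n)ᶜ
    have hp1 := sum_condOn (wellMeasure_pos n) (A := (rightHalf n)ᶜ) ⟨0, zero_notMem_rightHalf (n := n) (by omega)⟩
    calc _ ≤ ∑ x, condOn (wellMeasure n) (rightHalf n)ᶜ x * ((1 + η) * Real.exp (-(l * t))) :=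
          Finset.sum_le_sum fun x _ => mul_le_mul_of_nonneg_left (hup t ht x) (hp0 x)
      _ = _ := by rw [← Finset.sum_mul, hp1, one_mul]
  -- Basin membership makes survival up to 2R at least 1 - f^α, and survival is at most φ(x) +
  -- n²/(2R). Hence φ(x) ≥ 1 - η, which then bounds survival at all times.
  · rw [mem_basin_iff C C' hR.le] at hx
    have h1 := survival_le_eigenfunction_add C (by omega) hl.le hφ hφ0 heig
      (by linarith : 0 < 2 * R) x
    have h2 : (n : ℝ) ^ 2 / (2 * R) ≤ n ^ 2 / R :=
      div_le_div_of_nonneg_left (by positivity) hR (by linarith)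
    refine le_trans ?_ (hlow t ht x)
    rw [mul_comm]
    exact mul_le_mul_of_nonneg_left (by linarith [hx.2]) (Real.exp_pos _).le

end Basin

/-- Asymptotically exponential hitting times stay so after normalization by their means. -/
theorem tendsto_lawFrom_normalized {S : ℕ → Type} [∀ n, Fintype (S n)] [∀ n, DecidableEq (S n)]
    {Q : ∀ n, Matrix (S n) (S n) ℝ} (C : ∀ n, CTMC (Q n)) {K : ∀ n, Set (S n)} {ν : ∀ n, S n → ℝ}
    {η : ℕ → ℝ} (hη : Tendsto η atTop (𝓝 0))
    (h : ∀ᶠ n in atTop, (∀ x, 0 ≤ ν n x) ∧ ∃ l : ℝ, 0 < l ∧ ∀ t, 0 ≤ t →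
      ∑ x, ν n x * survival (Q n) (K n) t x ∈
        Set.Icc ((1 - η n) * Real.exp (-(l * t))) ((1 + η n) * Real.exp (-(l * t))))
    {t : ℝ} (ht : 0 ≤ t) :
    Tendsto (fun n => ((C n).lawFrom (ν n)).real
      {ω | ENNReal.ofReal t * (C n).meanHit (ν n) (K n) < (C n).hit (K n) ω}) atTop
      (𝓝 (Real.exp (-t))) := by
  -- The mean is within a factor 1 ± η of 1/l, so the rescaled time l·t·mean lies between t(1-η) and
  -- t(1+η); these are the resulting bounds on the tail.
  have hlo : Tendsto (fun n => (1 - η n) * Real.exp (-(t * (1 + η n)))) atTop (𝓝 (Real.exp (-t))) := by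
    have : Tendsto (fun n => (1 - η n) * Real.exp (-(t * (1 + η n)))) atTop
        (𝓝 ((1 - 0) * Real.exp (-(t * (1 + 0))))) :=
      (tendsto_const_nhds.sub hη).mul
        ((Real.continuous_exp.tendsto _).comp ((tendsto_const_nhds.add hη).const_mul t).neg)
    simpa using this
  have hhi : Tendsto (fun n => (1 + η n) * Real.exp (-(t * (1 - η n)))) atTop (𝓝 (Real.exp (-t))) := by
    have : Tendsto (fun n => (1 + η n) * Real.exp (-(t * (1 - η n)))) atTop
        (𝓝 ((1 + 0) * Real.exp (-(t * (1 - 0))))) :=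
      (tendsto_const_nhds.add hη).mul
        ((Real.continuous_exp.tendsto _).comp ((tendsto_const_nhds.sub hη).const_mul t).neg)
    simpa using this
  have hev : ∀ᶠ n in atTop, (1 - η n) * Real.exp (-(t * (1 + η n))) ≤
      ((C n).lawFrom (ν n)).real
        {ω | ENNReal.ofReal t * (C n).meanHit (ν n) (K n) < (C n).hit (K n) ω} ∧
      ((C n).lawFrom (ν n)).real
        {ω | ENNReal.ofReal t * (C n).meanHit (ν n) (K n) < (C n).hit (K n) ω} ≤
        (1 + η n) * Real.exp (-(t * (1 - η n))) := by
    filter_upwards [h, hη.eventually (Ioo_mem_nhds (show (-1 : ℝ) < 0 by norm_num) zero_lt_one)]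
      with n hn hη1
    obtain ⟨hν, l, hl, hb⟩ := hn
    have hm := (C n).meanHit_mem_Icc hν (K := K n) (a := 1 - η n) (b := 1 + η n)
      (by linarith [hη1.2]) (by linarith [hη1.1]) hl (fun t ht => (hb t ht).1)
      (fun t ht => (hb t ht).2)
    set M := (C n).meanHit (ν n) (K n) with hM
    have hMtop : M ≠ ∞ := ne_top_of_le_ne_top ENNReal.ofReal_ne_top hm.2
    have hM0 : 0 ≤ M.toReal := ENNReal.toReal_nonneg
    have h1 : 1 - η n ≤ l * M.toReal := by
      have := (ENNReal.ofReal_le_iff_le_toReal hMtop).1 hm.1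
      rw [div_le_iff₀ hl] at this
      linarith
    have h2 : l * M.toReal ≤ 1 + η n := by
      have := ENNReal.toReal_le_of_le_ofReal (div_nonneg (by linarith [hη1.1]) hl.le) hm.2
      rw [le_div_iff₀ hl] at this
      linarith
    have e : ENNReal.ofReal t * M = ENNReal.ofReal (t * M.toReal) := by
      rw [ENNReal.ofReal_mul ht, ENNReal.ofReal_toReal hMtop]
    rw [e, (C n).lawFrom_ofReal_lt_hit hν (mul_nonneg ht hM0)]
    obtain ⟨b1, b2⟩ := hb (t * M.toReal) (mul_nonneg ht hM0)
    have e2 : l * (t * M.toReal) = t * (l * M.toReal) := by ring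
    rw [e2] at b1 b2
    constructor
    · refine le_trans (mul_le_mul_of_nonneg_left (Real.exp_le_exp.2 ?_) (by linarith [hη1.2])) b1
      exact neg_le_neg (mul_le_mul_of_nonneg_left h2 ht)
    · refine b2.trans (mul_le_mul_of_nonneg_left (Real.exp_le_exp.2 ?_) (by linarith [hη1.1]))
      exact neg_le_neg (mul_le_mul_of_nonneg_left h1 ht)
  exact tendsto_of_tendsto_of_tendsto_of_le_of_le' hlo hhi (hev.mono fun n hn => hn.1)
    (hev.mono fun n hn => hn.2)

/-! ### The parameters d, f and r -/

section Parameters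

variable {n : ℕ}

theorem wellBottom_notMem {α : ℝ} (hα : (n : ℝ) ^ α < (n : ℝ) / 2) {x : Fin (n + 1)}
    (hx : x ∈ wellBottom n α) : x ∉ rightHalf n := by
  intro h
  have h1 : ((x : ℕ) : ℝ) ≤ (n : ℝ) ^ α := hx
  have h2 : (n : ℝ) / 2 ≤ ((x : ℕ) : ℝ) := h
  linarith

theorem zero_mem_wellBottom (n : ℕ) (α : ℝ) : (0 : Fin (n + 1)) ∈ wellBottom n α := by
  rw [wellBottom, Set.mem_ofPred_eq]
  simp only [Fin.val_zero, Nat.cast_zero]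
  positivity

/-- One f must serve both the invariant measure and all points of the well bottom, so that the
bottom lies in the basin defined by the same f. All these probabilities are below 1 by positivity of
survival; the explicit vanishing bound is used as soon as it is below 1. -/
theorem exists_escape_bound (C : CTMC (wellRates n)) {α R : ℝ} (hα : (n : ℝ) ^ α < (n : ℝ) / 2)
    (hR : 1 < R) : ∃ f ∈ Set.Ioo (0 : ℝ) 1,
      (1 - ∑ x, condOn (wellMeasure n) (rightHalf n)ᶜ x *
        survival (wellRates n) (rightHalf n) (2 * R) x ≤ f) ∧
      (∀ x ∈ wellBottom n α, 1 - survival (wellRates n) (rightHalf n) (2 * R) x ≤ f) ∧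
      (8 ≤ n → 2 * R * (8 / n) ^ (5 / 2 : ℝ) + (2 * ((n : ℝ) ^ α / n) + 16 / √n) < 1 →
        f ≤ 2 * R * (8 / n) ^ (5 / 2 : ℝ) + (2 * ((n : ℝ) ^ α / n) + 16 / √n)) := by
  have h0 : (0 : Fin (n + 1)) ∉ rightHalf n := wellBottom_notMem hα (zero_mem_wellBottom n α)
  have hn : 0 < n := by
    have := notMem_rightHalf.1 h0
    omega
  have hn0 : (0 : ℝ) < n := by exact_mod_cast hn
  have hR2 : 0 ≤ 2 * R := by linarith
  have hlt : ∀ x ∉ rightHalf n, 1 - survival (wellRates n) (rightHalf n) (2 * R) x < 1 := fun x hx => by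
    linarith [C.survival_pos (wellRates_nonneg n) hx hR2]
  -- `none` stands for the invariant measure, `some x` for the starting point x.
  let e : Option {x // x ∈ wellBottom n α} → ℝ := fun i =>
    i.elim (1 - ∑ x, condOn (wellMeasure n) (rightHalf n)ᶜ x *
      survival (wellRates n) (rightHalf n) (2 * R) x)
      fun x => 1 - survival (wellRates n) (rightHalf n) (2 * R) x
  have he : ∀ i, e i < 1 := by
    rintro (_ | x)
    · have hp0 := condOn_nonneg (wellMeasure_pos n) (rightHalf n)ᶜ
      have hpos : 0 < condOn (wellMeasure n) (rightHalf n)ᶜ 0 := by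
        rw [condOn, if_pos (show (0 : Fin (n + 1)) ∈ (rightHalf n)ᶜ from h0)]
        refine div_pos (wellMeasure_pos n 0) (Finset.sum_pos' (fun y _ => ?_)
          ⟨0, Finset.mem_univ _, ?_⟩)
        · split_ifs; exacts [(wellMeasure_pos n y).le, le_rfl]
        · rw [if_pos (show (0 : Fin (n + 1)) ∈ (rightHalf n)ᶜ from h0)]
          exact wellMeasure_pos n 0
      have := Finset.sum_pos' (f := fun x => condOn (wellMeasure n) (rightHalf n)ᶜ x *
        survival (wellRates n) (rightHalf n) (2 * R) x)
        (fun x _ => mul_nonneg (hp0 x) (C.survival_nonneg _ hR2 x))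
        ⟨0, Finset.mem_univ _, mul_pos hpos (C.survival_pos (wellRates_nonneg n) h0 hR2)⟩
      simp only [e, Option.elim]
      linarith
    · exact hlt x (wellBottom_notMem hα x.2)
  obtain ⟨f, hf, h1, h2⟩ := exists_bound_lt_one he
    (2 * R * (8 / n) ^ (5 / 2 : ℝ) + (2 * ((n : ℝ) ^ α / n) + 16 / √n)) (by positivity) (P := 8 ≤ n) (by
      intro h8
      obtain ⟨b1, b2⟩ := exit_probability_le C h8 hR2
      have hA : 0 ≤ 2 * ((n : ℝ) ^ α / n) := by positivity
      have hB : 0 ≤ 16 / √(n : ℝ) := by positivity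
      rintro (_ | x)
      · simp only [e, Option.elim]
        linarith
      · have h3 := b2 x (wellBottom_notMem hα x.2)
        have h4 : ((x : Fin (n + 1)) : ℝ) ≤ (n : ℝ) ^ α := x.2
        have h5 : 2 * (((x : Fin (n + 1)) : ℕ) : ℝ) / n ≤ 2 * ((n : ℝ) ^ α / n) := by
          rw [mul_div_assoc]
          gcongr
        simp only [e, Option.elim]
        linarith)
  exact ⟨f, hf, h1 none, fun x hx => h1 (some ⟨x, hx⟩), h2⟩

/-- In the coupling only the upper starting point matters: its exit probability by R is at most that
by 2R, hence at most f^α, and its chance of not reaching 0 or G is at most n²/R. -/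
theorem exists_thermalization_bound (C : CTMC (wellRates n))
    (C' : CTMC (reversedRates (wellMeasure n) (wellRates n))) {α R f : ℝ} (hR : 0 < R) (hf : 0 < f) :
    ∃ d ∈ Set.Ioo (0 : ℝ) 1,
      (∀ x ∈ C.basin C' (rightHalf n) R f α, ∀ y ∈ C.basin C' (rightHalf n) R f α,
        dTV (C.evol x R.toNNReal) (C.evol y R.toNNReal) ≤ d) ∧
      (8 ≤ n → f ^ α + n ^ 2 / R < 1 → d ≤ f ^ α + n ^ 2 / R) := by
  set B := C.basin C' (rightHalf n) R f α with hB
  have hfα : 0 < f ^ α := Real.rpow_pos_of_pos hf α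
  have hbound : 8 ≤ n → ∀ x y : Fin (n + 1), x ≤ y → y ∈ B →
      dTV (C.evol x R.toNNReal) (C.evol y R.toNNReal) ≤ f ^ α + n ^ 2 / R := by
    intro hn x y hxy hy
    rw [hB, mem_basin_iff C C' hR.le] at hy
    have h1 := dTV_evol_well_le C (by omega) hR hxy
    have h2 := C.survival_antitone (rightHalf n) hR.le (by linarith : R ≤ 2 * R) y
    linarith [hy.2]
  obtain ⟨d, hd, h1, h2⟩ := exists_bound_lt_one (ι := {x // x ∈ B} × {x // x ∈ B})
    (e := fun p => dTV (C.evol p.1 R.toNNReal) (C.evol p.2 R.toNNReal))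
    (fun p => C.dTV_evol_lt_one hR.le (exp_wellRates_zero_pos C _ hR) (exp_wellRates_zero_pos C _ hR))
    (f ^ α + n ^ 2 / R) (by positivity) (P := 8 ≤ n) (by
      rintro hn ⟨x, y⟩
      rcases le_total (x : Fin (n + 1)) y with h | h
      · exact hbound hn x y h y.2
      · rw [dTV_comm]
        exact hbound hn y x h x.2)
  exact ⟨d, hd, fun x hx y hy => h1 (⟨x, hx⟩, ⟨y, hy⟩), h2⟩

theorem exists_recurrence_bound (C : CTMC (wellRates n)) {R : ℝ} (hR : 0 < R) :
    ∃ r ∈ Set.Ioo (0 : ℝ) 1,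
      (∀ x, survival (wellRates n) (insert 0 (rightHalf n)) R x < r) ∧
      (8 ≤ n → (n : ℝ) ^ 2 / R + 1 / (n + 2) < 1 → r ≤ n ^ 2 / R + 1 / (n + 2)) := by
  have hn2 : (0 : ℝ) < 1 / (n + 2) := by positivity
  have hn2' : 1 / ((n : ℝ) + 2) < 1 := by
    rw [div_lt_one (by positivity)]
    linarith [Nat.cast_nonneg (α := ℝ) n]
  have hs1 : ∀ x, survival (wellRates n) (insert 0 (rightHalf n)) R x < 1 := fun x =>
    (C.survival_le_one_sub_exp hR.le x (Set.mem_insert 0 _)).trans_lt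
      (by linarith [exp_wellRates_zero_pos C x hR])
  obtain ⟨r, hr, h1, h2⟩ := exists_bound_lt_one (ι := Fin (n + 1))
    -- Recurrence asks for a strict inequality with r. The added fraction 1/(n+2) of the gap to 1
    -- lies strictly above the survival probability, stays below 1 and vanishes in the limit.
    (e := fun x => survival (wellRates n) (insert 0 (rightHalf n)) R x +
      (1 - survival (wellRates n) (insert 0 (rightHalf n)) R x) * (1 / (n + 2)))
    (fun x => by nlinarith [hs1 x])
    ((n : ℝ) ^ 2 / R + 1 / (n + 2)) (by positivity) (P := 8 ≤ n) (by
      intro hn x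
      have h3 := survival_insert_zero_le C (by omega) hR x
      have h4 := C.survival_nonneg (insert 0 (rightHalf n)) hR.le x
      nlinarith)
  exact ⟨r, hr, fun x => lt_of_lt_of_le
    (lt_add_of_pos_right _ (mul_pos (by linarith [hs1 x]) hn2)) (h1 x), h2⟩

/-- A basin containing 0 is reached no later than 0 itself, so recurrence to {0} ∪ G suffices for
both basins. -/
theorem hpG_of_bounds (C : CTMC (wellRates n)) {B : Set (Fin (n + 1))} {R d f r : ℝ} (hR : 1 < R)
    (hd : d ∈ Set.Ioo (0 : ℝ) 1) (hf : f ∈ Set.Ioo (0 : ℝ) 1) (hr : r ∈ Set.Ioo (0 : ℝ) 1)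
    (h0 : (0 : Fin (n + 1)) ∈ B) (hn : 1 ≤ n)
    (hslow : 1 - ∑ x, condOn (wellMeasure n) (rightHalf n)ᶜ x *
        survival (wellRates n) (rightHalf n) (2 * R) x ≤ f)
    (hth : ∀ x ∈ B, ∀ y ∈ B, dTV (C.evol x R.toNNReal) (C.evol y R.toNNReal) ≤ d)
    (hrec : ∀ x, survival (wellRates n) (insert 0 (rightHalf n)) R x < r) :
    C.HpG (wellMeasure n) (rightHalf n) B R d f r where
  one_lt_R := hR
  d_mem := hd
  f_mem := hf
  r_mem := hr
  slow_escape := by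
    have hR2 : 0 ≤ 2 * R := by linarith
    rw [C.lawFrom_real (condOn_nonneg (wellMeasure_pos n) _)]
    simp only [C.measureReal_hit_le_ofReal _ hR2, mul_sub, mul_one, Finset.sum_sub_distrib]
    rwa [sum_condOn (wellMeasure_pos n) ⟨0, zero_notMem_rightHalf hn⟩]
  thermalization := hth
  recurrence x := by
    refine lt_of_le_of_lt ?_ (hrec x)
    rw [← C.measureReal_ofReal_lt_hit _ (by linarith : 0 ≤ R)]
    refine measureReal_mono fun ω hω => ?_
    refine lt_of_lt_of_le (show ENNReal.ofReal R < C.hit (B ∪ rightHalf n) ω from hω) (C.hit_anti ?_ ω)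
    exact Set.insert_subset (Or.inl h0) Set.subset_union_right

end Parameters

/-! ### Limits of the error terms -/

theorem tendsto_natCast_rpow_neg {a : ℝ} (ha : 0 < a) :
    Tendsto (fun n : ℕ => (n : ℝ) ^ (-a)) atTop (𝓝 0) :=
  (tendsto_rpow_neg_atTop ha).comp tendsto_natCast_atTop_atTop

theorem tendsto_const_div_sqrt (a : ℝ) : Tendsto (fun n : ℕ => a / √(n : ℝ)) atTop (𝓝 0) := by
  have := (tendsto_natCast_rpow_neg (a := 1 / 2) (by norm_num)).const_mul a
  rw [mul_zero] at this
  refine this.congr fun n => ?_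
  rw [Real.rpow_neg (Nat.cast_nonneg n), ← Real.sqrt_eq_rpow, div_eq_mul_inv]

theorem tendsto_rpow_div_self {α : ℝ} (hα : α < 1) :
    Tendsto (fun n : ℕ => (n : ℝ) ^ α / n) atTop (𝓝 0) := by
  refine (tendsto_natCast_rpow_neg (sub_pos.2 hα)).congr' ?_
  filter_upwards [eventually_gt_atTop 0] with n hn
  have hn0 : (0 : ℝ) < n := by exact_mod_cast hn
  rw [neg_sub, Real.rpow_sub hn0, Real.rpow_one]

/-- The window between relaxation, of order at most n², and escape, of order at least n^{5/2}: the
ratio is O(n^{-(1/2-ε)}), which is what fixes ε₀ = 1/2. -/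
theorem tendsto_sq_div {R : ℕ → ℝ} {c ε : ℝ} (hc : 0 < c) (hε : ε < 1 / 2)
    (hR : ∀ᶠ n : ℕ in atTop, c * (n : ℝ) ^ (5 / 2 - ε) ≤ R n) :
    Tendsto (fun n : ℕ => (n : ℝ) ^ 2 / R n) atTop (𝓝 0) := by
  have h := (tendsto_natCast_rpow_neg (a := 1 / 2 - ε) (by linarith)).const_mul c⁻¹
  rw [mul_zero] at h
  have hev : ∀ᶠ n : ℕ in atTop, 0 ≤ (n : ℝ) ^ 2 / R n ∧
      (n : ℝ) ^ 2 / R n ≤ c⁻¹ * (n : ℝ) ^ (-(1 / 2 - ε)) := by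
    filter_upwards [hR, eventually_gt_atTop 0] with n h1 hn
    have hn0 : (0 : ℝ) < n := by exact_mod_cast hn
    have hpos : 0 < c * (n : ℝ) ^ (5 / 2 - ε) := mul_pos hc (Real.rpow_pos_of_pos hn0 _)
    refine ⟨div_nonneg (by positivity) (hpos.le.trans h1), ?_⟩
    refine (div_le_div_of_nonneg_left (by positivity) hpos h1).trans (le_of_eq ?_)
    rw [show -(1 / 2 - ε) = 2 - (5 / 2 - ε) by ring, Real.rpow_sub hn0 2, Real.rpow_two]
    field_simp
  exact tendsto_of_tendsto_of_tendsto_of_le_of_le' tendsto_const_nhds h (hev.mono fun n hn => hn.1)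
    (hev.mono fun n hn => hn.2)

theorem tendsto_atTop_of_rpow_le {R : ℕ → ℝ} {c ε : ℝ} (hc : 0 < c) (hε : ε < 1 / 2)
    (hR : ∀ᶠ n : ℕ in atTop, c * (n : ℝ) ^ (5 / 2 - ε) ≤ R n) : Tendsto R atTop atTop := by
  refine tendsto_atTop_mono' atTop hR ?_
  exact ((tendsto_rpow_atTop (by linarith : 0 < 5 / 2 - ε)).comp
    tendsto_natCast_atTop_atTop).const_mul_atTop hc

theorem tendsto_rate_mul {R : ℕ → ℝ}
    (hR : Tendsto (fun n : ℕ => R n / (n : ℝ) ^ (5 / 2 : ℝ)) atTop (𝓝 0)) :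
    Tendsto (fun n : ℕ => 2 * R n * (8 / (n : ℝ)) ^ (5 / 2 : ℝ)) atTop (𝓝 0) := by
  have := hR.const_mul (2 * 8 ^ (5 / 2 : ℝ))
  rw [mul_zero] at this
  refine this.congr fun n => ?_
  rw [Real.div_rpow (by norm_num) (Nat.cast_nonneg n)]
  ring

end

/-! ### Choice of the sequences and conclusion -/

theorem theorem4p1
    -- the chains and their time reversals, one for each `n`
    (C : ∀ n : ℕ, CTMC (wellRates n))
    (C' : ∀ n : ℕ, CTMC (reversedRates (wellMeasure n) (wellRates n)))
    (α : ℝ) (hα0 : 0 < α) (hα1 : α < 1) :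
    ∃ ε₀ : ℝ, 0 < ε₀ ∧ ∀ ε : ℝ, 0 < ε → ε < ε₀ →
      -- all time scales with `n ^ (5/2 - ε) ≲ R n ≪ n ^ (5/2)`
      ∀ R : ℕ → ℝ,
        (∃ c : ℝ, 0 < c ∧ ∀ᶠ n : ℕ in atTop, c * (n : ℝ) ^ (5 / 2 - ε) ≤ R n) →
        Tendsto (fun n : ℕ => R n / (n : ℝ) ^ (5 / 2 : ℝ)) atTop (𝓝 0) →
        ∃ d f r : ℕ → ℝ,
          Tendsto d atTop (𝓝 0) ∧ Tendsto f atTop (𝓝 0) ∧ Tendsto r atTop (𝓝 0) ∧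
          -- the hypothesis, for the basin of attraction and for the well bottom contained in it
          (∀ n : ℕ, (n : ℝ) ^ α < (n : ℝ) / 2 → 1 < R n →
            wellBottom n α ⊆ (C n).basin (C' n) (rightHalf n) (R n) (f n) α ∧
            (C n).HpG (wellMeasure n) (rightHalf n)
              ((C n).basin (C' n) (rightHalf n) (R n) (f n) α) (R n) (d n) (f n) (r n) ∧
            (C n).HpG (wellMeasure n) (rightHalf n) (wellBottom n α) (R n) (d n) (f n) (r n)) ∧
          -- exponential law of the exit time, uniformly in time, with vanishing relative error
          (∃ η : ℕ → ℝ, Tendsto η atTop (𝓝 0) ∧ ∀ᶠ n : ℕ in atTop,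
            ∃ μ : Fin (n + 1) → ℝ, (C n).IsQuasiStationary (wellMeasure n) (rightHalf n) μ ∧
              ∀ t : ℝ, 0 ≤ t →
                |((C n).lawFrom (condOn (wellMeasure n) (rightHalf n)ᶜ)).real
                    {ω | ENNReal.ofReal t * (C n).meanHit μ (rightHalf n) ≤
                      (C n).hit (rightHalf n) ω} - Real.exp (-t)| ≤ η n * Real.exp (-t) ∧
                ∀ x ∈ (C n).basin (C' n) (rightHalf n) (R n) (f n) α,
                  |((C n).P x).real
                    {ω | ENNReal.ofReal t * (C n).meanHit μ (rightHalf n) ≤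
                      (C n).hit (rightHalf n) ω} - Real.exp (-t)| ≤ η n * Real.exp (-t)) ∧
          -- convergence in law to the exponential distribution of mean one after normalization by
          -- the mean, from the restricted invariant measure ...
          (∀ t : ℝ, 0 ≤ t → Tendsto (fun n : ℕ =>
            ((C n).lawFrom (condOn (wellMeasure n) (rightHalf n)ᶜ)).real
              {ω | ENNReal.ofReal t *
                  (C n).meanHit (condOn (wellMeasure n) (rightHalf n)ᶜ) (rightHalf n) <
                (C n).hit (rightHalf n) ω}) atTop (𝓝 (Real.exp (-t)))) ∧
          -- ... and from any initial distributions supported in the basins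
          (∀ ν : (n : ℕ) → Fin (n + 1) → ℝ,
            (∀ᶠ n : ℕ in atTop, (∀ x, 0 ≤ ν n x) ∧ ∑ x, ν n x = 1 ∧
              ∀ x, ν n x ≠ 0 → x ∈ (C n).basin (C' n) (rightHalf n) (R n) (f n) α) →
            ∀ t : ℝ, 0 ≤ t → Tendsto (fun n : ℕ =>
              ((C n).lawFrom (ν n)).real
                {ω | ENNReal.ofReal t * (C n).meanHit (ν n) (rightHalf n) <
                  (C n).hit (rightHalf n) ω}) atTop (𝓝 (Real.exp (-t)))) := by
  refine ⟨1 / 2, by norm_num, fun ε _ hε R hRlow hRup => ?_⟩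
  obtain ⟨c, hc, hRc⟩ := hRlow
  have hbt : Tendsto (fun n : ℕ => 2 * R n * (8 / (n : ℝ)) ^ (5 / 2 : ℝ) +
      (2 * ((n : ℝ) ^ α / n) + 16 / √(n : ℝ))) atTop (𝓝 0) := by
    simpa using (tendsto_rate_mul hRup).add
      (((tendsto_rpow_div_self hα1).const_mul 2).add (tendsto_const_div_sqrt 16))
  have hsq := tendsto_sq_div hc hε hRc
  have hgood : ∀ᶠ n : ℕ in atTop, 8 ≤ n ∧ (n : ℝ) ^ α < (n : ℝ) / 2 ∧ 1 < R n := by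
    filter_upwards [eventually_ge_atTop 8, (tendsto_atTop_of_rpow_le hc hε hRc).eventually_gt_atTop 1,
      (tendsto_rpow_div_self hα1).eventually (gt_mem_nhds (by norm_num : (0 : ℝ) < 1 / 2))]
      with n h8 h1 h2
    have hn0 : (0 : ℝ) < n := by exact_mod_cast (by omega : 0 < n)
    rw [div_lt_iff₀ hn0] at h2
    exact ⟨h8, by linarith, h1⟩
  -- f is chosen before d and r because the basin depends on it. For the n excluded by the side
  -- conditions the default 1/2 keeps f in (0,1).
  have hF : ∀ n : ℕ, ∃ f ∈ Set.Ioo (0 : ℝ) 1, (n : ℝ) ^ α < (n : ℝ) / 2 → 1 < R n →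
      (1 - ∑ x, condOn (wellMeasure n) (rightHalf n)ᶜ x *
        survival (wellRates n) (rightHalf n) (2 * R n) x ≤ f) ∧
      (∀ x ∈ wellBottom n α, 1 - survival (wellRates n) (rightHalf n) (2 * R n) x ≤ f) ∧
      (8 ≤ n → 2 * R n * (8 / n) ^ (5 / 2 : ℝ) + (2 * ((n : ℝ) ^ α / n) + 16 / √n) < 1 →
        f ≤ 2 * R n * (8 / n) ^ (5 / 2 : ℝ) + (2 * ((n : ℝ) ^ α / n) + 16 / √n)) := by
    intro n
    by_cases h : (n : ℝ) ^ α < (n : ℝ) / 2 ∧ 1 < R n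
    · obtain ⟨f, hf, hf'⟩ := exists_escape_bound (C n) h.1 h.2
      exact ⟨f, hf, fun _ _ => hf'⟩
    · exact ⟨1 / 2, by norm_num, fun h1 h2 => absurd ⟨h1, h2⟩ h⟩
  choose f hf hfb using hF
  have hDR : ∀ n : ℕ, ∃ d r : ℝ, 1 < R n → d ∈ Set.Ioo (0 : ℝ) 1 ∧ r ∈ Set.Ioo (0 : ℝ) 1 ∧
      (∀ x ∈ (C n).basin (C' n) (rightHalf n) (R n) (f n) α,
        ∀ y ∈ (C n).basin (C' n) (rightHalf n) (R n) (f n) α,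
        dTV ((C n).evol x (R n).toNNReal) ((C n).evol y (R n).toNNReal) ≤ d) ∧
      (∀ x, survival (wellRates n) (insert 0 (rightHalf n)) (R n) x < r) ∧
      (8 ≤ n → f n ^ α + n ^ 2 / R n < 1 → d ≤ f n ^ α + n ^ 2 / R n) ∧
      (8 ≤ n → (n : ℝ) ^ 2 / R n + 1 / (n + 2) < 1 → r ≤ n ^ 2 / R n + 1 / (n + 2)) := by
    intro n
    by_cases h : 1 < R n
    · obtain ⟨d, hd, hd1, hd2⟩ :=
        exists_thermalization_bound (C n) (C' n) (α := α) (one_pos.trans h) (hf n).1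
      obtain ⟨r, hr, hr1, hr2⟩ := exists_recurrence_bound (C n) (one_pos.trans h)
      exact ⟨d, r, fun _ => ⟨hd, hr, hd1, hr1, hd2, hr2⟩⟩
    · exact ⟨0, 0, fun h1 => absurd h1 h⟩
  choose d r hdr using hDR
  have hft : Tendsto f atTop (𝓝 0) := by
    refine tendsto_of_tendsto_of_tendsto_of_le_of_le' tendsto_const_nhds hbt
      (Eventually.of_forall fun n => (hf n).1.le) ?_
    filter_upwards [hgood, hbt.eventually (gt_mem_nhds one_pos)] with n hn hb
    exact (hfb n hn.2.1 hn.2.2).2.2 hn.1 hb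
  have hfα : Tendsto (fun n => f n ^ α) atTop (𝓝 0) := by
    have := hft.rpow_const (p := α) (Or.inr hα0.le)
    rwa [Real.zero_rpow hα0.ne'] at this
  have hdb : Tendsto (fun n : ℕ => f n ^ α + (n : ℝ) ^ 2 / R n) atTop (𝓝 0) := by
    simpa using hfα.add hsq
  have hrb : Tendsto (fun n : ℕ => (n : ℝ) ^ 2 / R n + 1 / ((n : ℝ) + 2)) atTop (𝓝 0) := by
    have h2 : Tendsto (fun n : ℕ => 1 / ((n : ℝ) + 2)) atTop (𝓝 0) := by
      simp only [one_div]
      exact (tendsto_atTop_add_const_right atTop 2 tendsto_natCast_atTop_atTop).inv_tendsto_atTop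
    simpa using hsq.add h2
  have hdt : Tendsto d atTop (𝓝 0) := by
    refine tendsto_of_tendsto_of_tendsto_of_le_of_le' tendsto_const_nhds hdb ?_ ?_
    · filter_upwards [hgood] with n hn using (hdr n hn.2.2).1.1.le
    · filter_upwards [hgood, hdb.eventually (gt_mem_nhds one_pos)] with n hn hb
      exact (hdr n hn.2.2).2.2.2.2.1 hn.1 hb
  have hrt : Tendsto r atTop (𝓝 0) := by
    refine tendsto_of_tendsto_of_tendsto_of_le_of_le' tendsto_const_nhds hrb ?_ ?_
    · filter_upwards [hgood] with n hn using (hdr n hn.2.2).2.1.1.le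
    · filter_upwards [hgood, hrb.eventually (gt_mem_nhds one_pos)] with n hn hb
      exact (hdr n hn.2.2).2.2.2.2.2 hn.1 hb
  set η : ℕ → ℝ := fun n => f n ^ α + (n : ℝ) ^ 2 / R n + 64 / √(n : ℝ) with hη
  have hηt : Tendsto η atTop (𝓝 0) := by simpa using hdb.add (tendsto_const_div_sqrt 64)
  have hrate : ∀ᶠ n : ℕ in atTop, 8 ≤ n ∧ 1 < R n ∧ 32 / √(n : ℝ) ≤ 1 / 2 := by
    filter_upwards [hgood, (tendsto_const_div_sqrt 32).eventually
      (gt_mem_nhds (by norm_num : (0 : ℝ) < 1 / 2))] with n hn h32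
    exact ⟨hn.1, hn.2.2, h32.le⟩
  refine ⟨d, f, r, hdt, hft, hrt, ?_, ⟨η, hηt, ?_⟩, ?_, ?_⟩
  · intro n hα hR
    have hR0 : 0 < R n := one_pos.trans hR
    obtain ⟨hslow, hbot, -⟩ := hfb n hα hR
    obtain ⟨hd, hr, hth, hrec, -⟩ := hdr n hR
    have hsub : wellBottom n α ⊆ (C n).basin (C' n) (rightHalf n) (R n) (f n) α := by
      intro x hx
      rw [mem_basin_iff _ _ hR0.le]
      refine ⟨wellBottom_notMem hα hx, (hbot x hx).trans ?_⟩
      -- For f in (0,1) and α < 1 one has f ≤ f^α, so the escape bound at the well bottom implies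
      -- membership in the basin.
      calc f n = f n ^ (1 : ℝ) := (Real.rpow_one _).symm
        _ ≤ f n ^ α := Real.rpow_le_rpow_of_exponent_ge (hf n).1 (hf n).2.le hα1.le
    have hn : 1 ≤ n := by
      have := notMem_rightHalf.1 (wellBottom_notMem hα (zero_mem_wellBottom n α))
      omega
    exact ⟨hsub, hpG_of_bounds (C n) hR hd (hf n) hr (hsub (zero_mem_wellBottom n α)) hn hslow hth hrec,
      hpG_of_bounds (C n) hR hd (hf n) hr (zero_mem_wellBottom n α) hn hslow
        (fun x hx y hy => hth x (hsub hx) y (hsub hy)) hrec⟩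
  · filter_upwards [hrate] with n hn
    obtain ⟨l, hl, ⟨μ, hμ, hmean⟩, hπ, hbasin⟩ := exists_exit_rate (C n) (C' n) hn.1 hn.2.2
      (one_pos.trans hn.2.1) (hf n).1 (α := α) (le_refl (η n))
    refine ⟨μ, hμ, fun t ht => ?_⟩
    have htl : 0 ≤ t / l := div_nonneg ht hl.le
    have e : ENNReal.ofReal t * (C n).meanHit μ (rightHalf n) = ENNReal.ofReal (t / l) := by
      rw [hmean, ← ENNReal.ofReal_mul ht, mul_one_div]
    -- Since T* = 1/l, time t·T* turns e^{-l·} into e^{-t}, and the relative error η carries over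
    -- unchanged.
    have habs : ∀ p : ℝ, p ∈ Set.Icc ((1 - η n) * Real.exp (-(l * (t / l))))
        ((1 + η n) * Real.exp (-(l * (t / l)))) → |p - Real.exp (-t)| ≤ η n * Real.exp (-t) := by
      intro p hp
      rw [mul_div_cancel₀ _ hl.ne'] at hp
      rw [abs_le]
      constructor <;> linarith [hp.1, hp.2]
    rw [e]
    refine ⟨habs _ ?_, fun x hx => habs _ ?_⟩
    · have h := hπ (t / l) htl
      have e2 : ((C n).lawFrom (condOn (wellMeasure n) (rightHalf n)ᶜ)).real
          {ω | ENNReal.ofReal (t / l) ≤ (C n).hit (rightHalf n) ω} =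
          ∑ x, condOn (wellMeasure n) (rightHalf n)ᶜ x *
            survival (wellRates n) (rightHalf n) (t / l) x := by
        rw [(C n).lawFrom_real (condOn_nonneg (wellMeasure_pos n) _)]
        refine Finset.sum_congr rfl fun x _ => ?_
        by_cases hx : x ∈ rightHalf n
        · have : condOn (wellMeasure n) (rightHalf n)ᶜ x = 0 := if_neg (by simpa using hx)
          rw [this, zero_mul, zero_mul]
        · rw [(C n).measureReal_ofReal_le_hit htl hx]
      rwa [e2]
    · rw [(C n).measureReal_ofReal_le_hit htl hx.1]
      exact hbasin x hx (t / l) htl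
  · intro t ht
    refine tendsto_lawFrom_normalized C (K := fun n => rightHalf n)
      (ν := fun n => condOn (wellMeasure n) (rightHalf n)ᶜ) hηt ?_ ht
    filter_upwards [hrate] with n hn
    obtain ⟨l, hl, -, hπ, -⟩ := exists_exit_rate (C n) (C' n) hn.1 hn.2.2
      (one_pos.trans hn.2.1) (hf n).1 (α := α) (le_refl (η n))
    exact ⟨condOn_nonneg (wellMeasure_pos n) _, l, hl, hπ⟩
  · intro ν hν t ht
    refine tendsto_lawFrom_normalized C (K := fun n => rightHalf n) hηt ?_ ht
    filter_upwards [hrate, hν] with n hn hνn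
    obtain ⟨h0, h1, hsupp⟩ := hνn
    obtain ⟨l, hl, -, -, hbasin⟩ := exists_exit_rate (C n) (C' n) hn.1 hn.2.2
      (one_pos.trans hn.2.1) (hf n).1 (α := α) (le_refl (η n))
    refine ⟨h0, l, hl, fun s hs => ?_⟩
    have hx : ∀ x, ν n x * ((1 - η n) * Real.exp (-(l * s))) ≤
          ν n x * survival (wellRates n) (rightHalf n) s x ∧
        ν n x * survival (wellRates n) (rightHalf n) s x ≤
          ν n x * ((1 + η n) * Real.exp (-(l * s))) := by
      intro x
      by_cases hx : ν n x = 0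
      · simp [hx]
      · obtain ⟨b1, b2⟩ := hbasin x (hsupp x hx) s hs
        exact ⟨mul_le_mul_of_nonneg_left b1 (h0 x), mul_le_mul_of_nonneg_left b2 (h0 x)⟩
    have e : ∀ a : ℝ, a = ∑ x, ν n x * a := fun a => by rw [← Finset.sum_mul, h1, one_mul]
    constructor
    · rw [e ((1 - η n) * Real.exp (-(l * s)))]
      exact Finset.sum_le_sum fun x _ => (hx x).1
    · rw [e ((1 + η n) * Real.exp (-(l * s)))]
      exact Finset.sum_le_sum fun x _ => (hx x).2
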